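/- Setting. Let $V=\mathbb C^3$ with the hermitian form $\langle x,y\rangle=-x_1\overline{y_1}+x_2\overline{y_2}+x_3\overline{y_3}$, let $q_1,q_2,q_3$ be its standard basis, let $\mathrm{PU}$ be the projective unitary group of the form, and let $\mathbb B\subset\mathbb PV$ be the complex hyperbolic plane of points $p$ with $\langle p,p\rangle<0$. A complex geodesic is $\mathbb Pp^\perp\cap\overline{\mathbb B}$ with $p$ positive (its polar point); $R(p):x\mapsto 2\frac{\langle x,p\rangle}{\langle p,p\rangle}p-x$ is the reflection in it. Put $\mathrm{ta}(x,y)=\frac{\langle x,y\rangle\langle y,x\rangle}{\langle x,x\rangle\langle y,y\rangle}$. Toledo invariant. For $n\ge5$ let $H_n=\langle r_1,\dots,r_n\mid r_n\cdots r_1=1,\ r_i^2=1\rangle$. It acts on the real hyperbolic plane $\mathbb H$, $r_i$ being the half-turn about the middle point of the edge $e_i=[v_i,v_{i+1}]$ of the regular $n$-gon $P$ with interior angles $2\pi/n$ and counterclockwise vertices $v_1,\dots,v_n$; $P$ is a fundamental domain. For $\varrho:H_n\to\mathrm{PU}$ the Toledo invariant is $\tau(\varrho)=\frac4{2\pi}\int_P\varphi^*\omega$,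 where $\varphi$ is any smooth $\varrho$-equivariant map to $\mathbb B$, given on $P$ by a smooth map $P\to\mathbb B$ with $\varphi(r_ix)=\varrho(r_i)\varphi(x)$ for $x\in e_i$ and all $i$ (such maps exist and the value does not depend on the choice), and the Kähler form is $\omega(v_p,w_p)=\mathrm{Im}\big(-\langle p,p\rangle\langle v,w\rangle\big)$ for $v,w\in p^\perp$, where $v_p=\langle-,p\rangle v\in\mathrm{Hom}(\mathbb Cp,V/\mathbb Cp)=T_p\mathbb B$. Quadrangle conditions. Let $n,k,l,p$ be integers, $n\ge5$, $0\le k\le l\le n-3$, $p\in\{1,2\}$. Put $$u_1=e^{\frac{(2np-k)\pi i}{3n}},\quad u_2=e^{\frac{(2np-k-3)\pi i}{3n}},\quad u_3=e^{\frac{(2np+2k+3)\pi i}{3n}},\quad w_1=e^{\frac{l\pi i}{3n}},\quad w_2=e^{\frac{(l+3)\pi i}{3n}},\quad w_3=e^{-\frac{(2l+3)\pi i}{3n}},$$ $v=\frac12\sum_i(u_i^2+w_i^2)$ and $W=\mathrm{diag}(w_1^2,w_2^2,w_3^2)$. Require $\mathrm{Re}(vw_2)<\mathrm{Re}\,w_2^3$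 and $\mathrm{Re}(vw_3)\le\mathrm{Re}(w_1^2w_3)$, and put $$m_j=\sqrt{\frac{\mathrm{Re}((w_1^2-v)w_j)}{\mathrm{Re}((w_1^2-w_j^2)w_j)}}\ (j=2,3),\qquad m_1=\sqrt{m_2^2+m_3^2-1},\qquad m=(m_1,m_2,m_3).$$ Require $u_i^2+w_j^2\ne0$ for all $i,j$, and let $h_i$ be the vector with coordinates $m_j/(u_i^2w_j^{-2}+1)$, $j=1,2,3$. Require further: (a) $\langle h_1,h_1\rangle<0$, $\mathrm{ta}(m,Wm)>1$, $\mathrm{ta}(m,h_2)>1$; (b) for $t_{12}=\sqrt{\mathrm{ta}(q_2,m)}$, $t_{23}=\sqrt{\mathrm{ta}(m,Wm)}$, $t_{31}=\sqrt{\mathrm{ta}(Wm,q_2)}$, $\kappa=\langle q_2,m\rangle\langle m,Wm\rangle\langle Wm,q_2\rangle$, $\varepsilon=\kappa/|\kappa|$, $\varepsilon_0=\mathrm{Re}\,\varepsilon$: $t_{12}^2\varepsilon_0^2+t_{23}^2+t_{31}^2<1+2t_{12}t_{23}t_{31}\varepsilon_0$, $t_{23}^2\varepsilon_0^2+t_{31}^2+t_{12}^2<1+2t_{12}t_{23}t_{31}\varepsilon_0$,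 $\mathrm{Im}\,\varepsilon<0$; and the same for $t_{12}=\sqrt{\mathrm{ta}(h_2,Wm)}$, $t_{23}=\sqrt{\mathrm{ta}(m,Wm)}$, $t_{31}=\sqrt{\mathrm{ta}(m,h_2)}$, $\kappa=\langle h_2,Wm\rangle\langle Wm,m\rangle\langle m,h_2\rangle$; (c) $\Big|\mathrm{Re}\frac{\langle h_2,q_2\rangle\langle m,m\rangle}{\langle h_2,m\rangle\langle m,q_2\rangle}-1\Big|<\sqrt{1-\frac1{\mathrm{ta}(m,h_2)}}\sqrt{1-\frac1{\mathrm{ta}(m,q_2)}}$; (d) $\mathrm{Im}\frac{\langle q_2,h_1\rangle\langle h_1,m\rangle}{\langle q_2,m\rangle}\ge0$ and $\mathrm{Im}\frac{\langle Wm,h_1\rangle\langle h_1,q_2\rangle}{\langle Wm,q_2\rangle}\ge0$. Let $S_2$ be the complex geodesic with polar point $h_2$ and $S_i=W^{i-2}S_2$, indices modulo $n$. Then $S_i$ and $S_{i+1}$ are ultraparallel, and the reflections $R_i$ in the middle slices of the segments of bisectors $B_i=B[S_i,S_{i+1}]$ satisfy $R_n\cdots R_1=1$ in $\mathrm{PU}$,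 that is, $\mathcal C=(B_1,\dots,B_n)$ is a cycle of bisectors. (The middle slice of $B[S,S']$ is the slice the reflection in which exchanges $S$ and $S'$.) Proposition. Let $t$ be an integer with $0\le t<3n$ and $t\equiv2np-k-l\pmod{3n}$. Then the Toledo invariant of the representation $H_n\to\mathrm{PU}$, $r_i\mapsto R_i$, provided by $\mathcal C$ equals $\frac23t-n$. -/

import Mathlib

open scoped ContDiff LinearAlgebra.Projectivization ComplexConjugate

noncomputable section

namespace CHyp

/-! ### The hermitian space and its projective unitary group -/

/-- The three-dimensional complex vector space, written in an orthonormal basis `q₁, q₂, q₃`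
of signature `-++`. -/
abbrev V : Type := Fin 3 → ℂ

/-- The hermitian form of signature `-++`, linear in the first argument. -/
def herm (x y : V) : ℂ := -(x 0 * conj (y 0)) + x 1 * conj (y 1) + x 2 * conj (y 2)

/-- The (real) number `⟨x, x⟩`. -/
def hnorm (x : V) : ℝ := (herm x x).re

/-- The tance `⟨x, y⟩⟨y, x⟩ / (⟨x, x⟩⟨y, y⟩)` of nonisotropic `x`, `y` (a real number). -/
def tance (x y : V) : ℝ := (herm x y * herm y x / (herm x x * herm y y)).re

lemma herm_add_left (x y z : V) : herm (x + y) z = herm x z + herm y z := by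
  simp [herm]; ring

lemma herm_sub_left (x y z : V) : herm (x - y) z = herm x z - herm y z := by
  simp [herm]; ring

lemma herm_smul_left (c : ℂ) (x z : V) : herm (c • x) z = c * herm x z := by
  simp [herm]; ring

lemma herm_conj (x y : V) : conj (herm x y) = herm y x := by
  simp [herm]; ring

lemma herm_sub_right (x y z : V) : herm z (x - y) = herm z x - herm z y := by
  simp [herm]; ring

lemma herm_smul_right (c : ℂ) (x z : V) : herm z (c • x) = conj c * herm z x := by
  simp [herm]; ring

/-- The unitary group of the hermitian form. -/
def U : Subgroup (V ≃ₗ[ℂ] V) where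
  carrier := {g | ∀ x y, herm (g x) (g y) = herm x y}
  one_mem' := fun _ _ => rfl
  mul_mem' := fun {a b} ha hb x y => (ha (b x) (b y)).trans (hb x y)
  inv_mem' := fun {a} ha x y => by
    have h := ha (a⁻¹ x) (a⁻¹ y)
    have e : ∀ z, a (a⁻¹ z) = z := fun z => a.apply_symm_apply z
    rw [e, e] at h
    exact h.symm

/-- The projective unitary group, as the group of projective transformations of `ℙ V`
induced by unitary maps. -/
def PU : Subgroup (Equiv.Perm (ℙ ℂ V)) := (MulAction.toPermHom U (ℙ ℂ V)).range

/-- The reflection `x ↦ 2 (⟨x, p⟩ / ⟨p, p⟩) p - x`; for positive `p`, it is the reflection in the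
complex geodesic with polar point `p`. -/
def reflLin (p : V) : V →ₗ[ℂ] V where
  toFun x := (2 * (herm x p / herm p p)) • p - x
  map_add' x y := by rw [herm_add_left]; module
  map_smul' c x := by
    rw [herm_smul_left, RingHom.id_apply]; module

lemma reflLin_apply (p x : V) : reflLin p x = (2 * (herm x p / herm p p)) • p - x := rfl

lemma reflLin_involutive (p x : V) : reflLin p (reflLin p x) = x := by
  rw [reflLin_apply, reflLin_apply, herm_sub_left, herm_smul_left]
  by_cases h : herm p p = 0
  · simp [h]
  · have e : (2 * (herm x p / herm p p) * herm p p - herm x p) / herm p p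
        = herm x p / herm p p := by field_simp; ring
    rw [e]; module

/-- The reflection as an element of the unitary group. -/
def reflU (p : V) : U :=
  ⟨LinearEquiv.ofInvolutive (reflLin p) (reflLin_involutive p), fun x y => by
    change herm (reflLin p x) (reflLin p y) = herm x y
    simp only [reflLin_apply, herm_sub_left, herm_smul_left, herm_sub_right, herm_smul_right,
      map_mul, map_div₀, herm_conj, map_ofNat]
    by_cases h : herm p p = 0
    · simp [h]
    · field_simp; ring⟩

lemma reflU_mul_self (p : V) : reflU p * reflU p = 1 := by
  apply Subtype.ext
  apply LinearEquiv.ext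
  intro x
  exact reflLin_involutive p x

/-- The projection of the unitary group onto the projective unitary group. -/
def toPU : U →* PU := (MulAction.toPermHom U (ℙ ℂ V)).rangeRestrict

/-- The reflection as an element of the projective unitary group. -/
def reflPU (p : V) : PU := toPU (reflU p)

lemma reflPU_mul_self (p : V) : reflPU p * reflPU p = 1 := by
  rw [reflPU, ← map_mul, reflU_mul_self, map_one]

/-! ### The group `H_n` and its action on the hyperbolic plane

The generators `r_1, …, r_n` of the group are indexed by `j : Fin n`, the index `j` standing for
`r_{j+1}`. -/

/-- The defining relators `r_n ⋯ r_1` and `r_i²`. -/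
def hnRels (n : ℕ) : Set (FreeGroup (Fin n)) :=
  {(List.ofFn fun j : Fin n => FreeGroup.of j).reverse.prod} ∪
    Set.range fun j : Fin n => FreeGroup.of j ^ 2

/-- The group `H_n = ⟨r_1, …, r_n ∣ r_n ⋯ r_1 = 1, r_i² = 1⟩`. -/
abbrev Hn (n : ℕ) : Type := PresentedGroup (hnRels n)

/-- The generators of `H_n`. -/
def Hn.r {n : ℕ} (j : Fin n) : Hn n := PresentedGroup.of j

/-- The hyperbolic plane is the open unit disc of `ℂ` in the Klein model: the point `x`
corresponds to the line spanned by the vector `(x, 1)` of the Lorentz space `ℂ × ℝ`, whose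
form, evaluated at `(x, 1)` and `(y, 1)`, is the following number. Geodesics are chords. -/
def lorentz (x y : ℂ) : ℝ := (x * conj y).re - 1

/-- The half-turn of the hyperbolic plane about the point `a`, induced by the linear map
`X ↦ 2 (⟨X, A⟩ / ⟨A, A⟩) A - X`, where `A = (a, 1)`. -/
def halfTurn (a x : ℂ) : ℂ :=
  (((2 * (lorentz x a / lorentz a a) : ℝ) : ℂ) * a - x) /
    ((2 * (lorentz x a / lorentz a a) - 1 : ℝ) : ℂ)

/-- For `n ≥ 5`, the vertices `v_{j+1}`, in counterclockwise order, of the regular hyperbolic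
`n`-gon centred at `0` with all interior angles `2π/n`, hence with angle sum `2π`. Its hyperbolic
circumradius `r` satisfies `cosh r = cot² (π/n)`, and the radius in the Klein model is
`tanh r = √(1 - tan⁴ (π/n))`. -/
def vertex (n : ℕ) (j : ℕ) : ℂ :=
  (√(1 - Real.tan (Real.pi / n) ^ 4) : ℝ) * Complex.exp (2 * Real.pi * Complex.I * j / n)

/-- The polygon `P`, a fundamental domain of `H_n` acting on the hyperbolic plane by letting
`r_{j+1}` be the half-turn `sideTurn n j` about the middle point of the edge `e_{j+1}`. -/
def polygon (n : ℕ) : Set ℂ := convexHull ℝ (Set.range (vertex n))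

/-- The edge `e_{j+1}` of the polygon, from `v_{j+1}` to `v_{j+2}` (indices modulo `n`). -/
def edge (n : ℕ) (j : ℕ) : Set ℂ := segment ℝ (vertex n j) (vertex n (j + 1))

/-- The half-turn about the middle point of the edge `e_{j+1}`. -/
def sideTurn (n : ℕ) (j : ℕ) (x : ℂ) : ℂ :=
  halfTurn (midpoint ℝ (vertex n j) (vertex n (j + 1))) x

/-! ### The Toledo invariant -/

/-- The Kähler form `ω(v_p, w_p) = Im (-⟨p, p⟩⟨v, w⟩)`, `v, w ∈ p^⊥`, of the complex hyperbolic
plane, evaluated at the point represented by the negative vector `p` on the tangent vectors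
represented by velocities `x`, `y` of lifts to `V` of curves through that point. The velocity `x`
represents the tangent vector `v_p = ⟨-, p⟩ v` with
`v = (x - (⟨x, p⟩ / ⟨p, p⟩) p) / ⟨p, p⟩`. -/
def kahler (p x y : V) : ℝ :=
  (-(herm p p) * herm ((herm p p)⁻¹ • (x - (herm x p / herm p p) • p))
    ((herm p p)⁻¹ • (y - (herm y p / herm p p) • p))).im

/-- `φ` is (a lift to `V` of) a smooth `ϱ`-equivariant map from the polygon `P` to the complex
hyperbolic plane `𝔹`, the set of negative points of `ℙ V`. Equivariance on the fundamental polygon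
means compatibility with the side pairings, `φ (r x) = ϱ(r) φ(x)` for `x` in the edge paired
by the generator `r`: such maps are the sections over the closed orbifold given by `P`
of the flat bundle with fibre `𝔹` and holonomy `ϱ`. In particular, every smooth map from the
hyperbolic plane to `𝔹` which is equivariant under `H_n` restricts to such a map. -/
structure IsEquivariantMap {n : ℕ} (ϱ : Hn n →* PU) (φ : ℂ → V) : Prop where
  neg : ∀ x ∈ polygon n, hnorm (φ x) < 0
  smooth : ∀ x ∈ polygon n, ContDiffAt ℝ ∞ φ x
  equivariant : ∀ (j : Fin n), ∀ x ∈ edge n j, ∀ (hx : φ x ≠ 0) (hy : φ (sideTurn n j x) ≠ 0),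
    (ϱ (Hn.r j) : Equiv.Perm (ℙ ℂ V)) (Projectivization.mk ℂ (φ x) hx) =
      Projectivization.mk ℂ (φ (sideTurn n j x)) hy

/-- The density of `φ^*ω` with respect to the oriented Lebesgue measure on `ℂ`. -/
def pullbackKahler (φ : ℂ → V) (z : ℂ) : ℝ :=
  kahler (φ z) (fderiv ℝ φ z 1) (fderiv ℝ φ z Complex.I)

/-- The Toledo invariant of `ϱ : H_n → PU` is the number `(4 / 2π) ∫_P φ^*ω`, where `φ` is any
smooth `ϱ`-equivariant map; the predicate says that there are such maps and that this number
equals `τ` for all of them. -/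
def IsToledoInvariant {n : ℕ} (ϱ : Hn n →* PU) (τ : ℝ) : Prop :=
  (∃ φ : ℂ → V, IsEquivariantMap ϱ φ) ∧
    ∀ φ : ℂ → V, IsEquivariantMap ϱ φ →
      MeasureTheory.IntegrableOn (pullbackKahler φ) (polygon n) ∧
        4 / (2 * Real.pi) * ∫ z in polygon n, pullbackKahler φ z = τ

/-! ### Cycles of bisectors

A complex geodesic is given by its polar point, represented by a positive vector. -/

/-- For positive `p`, `p'` with `tance p p' > 1`, polar to the ultraparallel complex geodesics
`S`, `S'`: the vector `m` is polar to a slice of the segment of bisector `B[S, S']`. The polar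
points to the slices of the segment form the arc of positive points from `p` to `p'` in the
real projective line spanned by the vectors `p` and `⟨p, p'⟩ p'`, whose product is
`|⟨p, p'⟩|² > 0`. -/
def IsSegmentSlice (p p' m : V) : Prop :=
  ∃ a b : ℝ, 0 ≤ a ∧ 0 ≤ b ∧ (a ≠ 0 ∨ b ≠ 0) ∧
    ∃ c : ℂ, c ≠ 0 ∧ m = c • ((a : ℂ) • p + ((b : ℂ) * herm p p') • p')

/-- `m` is polar to the middle slice of `B[S, S']`: the reflection in this slice of the segment
exchanges `S` and `S'`. -/
structure IsMiddleSlice (p p' m : V) : Prop where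
  slice : IsSegmentSlice p p' m
  swap : ∃ c : ℂ, reflLin m p = c • p'
  swap' : ∃ c : ℂ, reflLin m p' = c • p

/-- A cycle of bisectors `(B_1, …, B_n)`, `B_i = B[S_i, S_{i+1}]` (indices modulo `n`): the complex
geodesics `S_i` and `S_{i+1}` are ultraparallel and the reflections `R_i` in the middle slices
`M_i` of `B_i` satisfy `R_n ⋯ R_1 = 1` in `PU`. The index `j : Fin n` stands for `i = j + 1`. -/
structure BisectorCycle (n : ℕ) where
  /-- polar points to the complex geodesics `S_i` -/
  s : Fin n → V
  /-- polar points to the middle slices `M_i` -/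
  m : Fin n → V
  pos : ∀ j, 0 < hnorm (s j)
  ultraparallel : ∀ j, 1 < tance (s j) (s (finRotate n j))
  middle : ∀ j, IsMiddleSlice (s j) (s (finRotate n j)) (m j)
  relation : (List.ofFn fun j => reflPU (m j)).reverse.prod = 1

/-- The representation `H_n → PU`, `r_i ↦ R_i`, provided by a cycle of bisectors. -/
def BisectorCycle.rep {n : ℕ} (C : BisectorCycle n) : Hn n →* PU :=
  PresentedGroup.toGroup (f := fun j => reflPU (C.m j)) (by
    rintro x (rfl | ⟨j, rfl⟩)
    · rw [map_list_prod, List.map_reverse, List.map_ofFn]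
      simpa [Function.comp_def] using C.relation
    · simp [pow_two, reflPU_mul_self])

/-! ### The explicit family -/

section Family

variable (n : ℕ) (k l p : ℤ)

/-- `u₁, u₂, u₃`; the squares are the eigenvalues of `U = W R(m)`. -/
def uu : Fin 3 → ℂ := ![
  Complex.exp (((2 * n * p - k : ℤ) : ℂ) * Real.pi * Complex.I / (3 * n)),
  Complex.exp (((2 * n * p - k - 3 : ℤ) : ℂ) * Real.pi * Complex.I / (3 * n)),
  Complex.exp (((2 * n * p + 2 * k + 3 : ℤ) : ℂ) * Real.pi * Complex.I / (3 * n))]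

/-- `w₁, w₂, w₃`; the squares are the eigenvalues of `W`. -/
def ww : Fin 3 → ℂ := ![
  Complex.exp ((l : ℂ) * Real.pi * Complex.I / (3 * n)),
  Complex.exp (((l + 3 : ℤ) : ℂ) * Real.pi * Complex.I / (3 * n)),
  Complex.exp ((-(2 * l + 3) : ℤ) * Real.pi * Complex.I / (3 * n))]

/-- `v = (u₁² + u₂² + u₃² + w₁² + w₂² + w₃²) / 2`. -/
def vv : ℂ := (∑ i, uu n k p i ^ 2 + ∑ i, ww n l i ^ 2) / 2

/-- The coordinate `m₂`. -/
def m₂ : ℝ :=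
  √(((ww n l 0 ^ 2 - vv n k l p) * ww n l 1).re / ((ww n l 0 ^ 2 - ww n l 1 ^ 2) * ww n l 1).re)

/-- The coordinate `m₃`. -/
def m₃ : ℝ :=
  √(((ww n l 0 ^ 2 - vv n k l p) * ww n l 2).re / ((ww n l 0 ^ 2 - ww n l 2 ^ 2) * ww n l 2).re)

/-- The coordinate `m₁`. -/
def m₁ : ℝ := √(m₂ n k l p ^ 2 + m₃ n k l p ^ 2 - 1)

/-- The polar point `m` to the complex geodesic `M₁`. -/
def mm : V := ![(m₁ n k l p : ℂ), (m₂ n k l p : ℂ), (m₃ n k l p : ℂ)]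

/-- The isometry `W`. -/
def W : Matrix (Fin 3) (Fin 3) ℂ := Matrix.diagonal fun i => ww n l i ^ 2

/-- The polar point `W m` to the complex geodesic `M₂ = W M₁`. -/
def Wm : V := Matrix.mulVec (W n l) (mm n k l p)

/-- The vectors `h₁, h₂, h₃` (indexed from `0`), eigenvectors of `U = W R(m)`. -/
def hh (i : Fin 3) : V := fun j => mm n k l p j / (uu n k p i ^ 2 * (ww n l j ^ 2)⁻¹ + 1)

/-- The basis vector `q₂`, polar to the complex geodesic `C`. -/
def q₂ : V := ![0, 1, 0]

/-- The condition on the invariants `t₁₂, t₂₃, t₃₁` and `ε = κ / |κ|` of a triangle of bisectors by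
which it is transversal and counterclockwise-oriented. -/
def TriangleCondition (t₁₂ t₂₃ t₃₁ : ℝ) (ε : ℂ) : Prop :=
  t₁₂ ^ 2 * ε.re ^ 2 + t₂₃ ^ 2 + t₃₁ ^ 2 < 1 + 2 * t₁₂ * t₂₃ * t₃₁ * ε.re ∧
  t₂₃ ^ 2 * ε.re ^ 2 + t₃₁ ^ 2 + t₁₂ ^ 2 < 1 + 2 * t₂₃ * t₃₁ * t₁₂ * ε.re ∧
  ε.im < 0

/-- `κ = ⟨q₂, m⟩⟨m, Wm⟩⟨Wm, q₂⟩`. -/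
def kap : ℂ :=
  herm q₂ (mm n k l p) * herm (mm n k l p) (Wm n k l p) * herm (Wm n k l p) q₂

/-- `κ' = ⟨h₂, Wm⟩⟨Wm, m⟩⟨m, h₂⟩`. -/
def kap' : ℂ :=
  herm (hh n k l p 1) (Wm n k l p) * herm (Wm n k l p) (mm n k l p) *
    herm (mm n k l p) (hh n k l p 1)

/-- The quadrangle conditions. -/
structure QuadrangleConditions : Prop where
  k_nonneg : 0 ≤ k
  k_le_l : k ≤ l
  l_le : l ≤ (n : ℤ) - 3
  p_mem : p = 1 ∨ p = 2
  re_w₂ : (vv n k l p * ww n l 1).re < (ww n l 1 ^ 3).re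
  re_w₃ : (vv n k l p * ww n l 2).re ≤ (ww n l 0 ^ 2 * ww n l 2).re
  nontrivial : ∀ i j, uu n k p i ^ 2 + ww n l j ^ 2 ≠ 0
  h₁_neg : hnorm (hh n k l p 0) < 0
  tance_m_Wm : 1 < tance (mm n k l p) (Wm n k l p)
  tance_m_h₂ : 1 < tance (mm n k l p) (hh n k l p 1)
  triangle : TriangleCondition (√(tance q₂ (mm n k l p))) (√(tance (mm n k l p) (Wm n k l p)))
    (√(tance (Wm n k l p) q₂)) (kap n k l p / (‖kap n k l p‖ : ℂ))
  triangle' : TriangleCondition (√(tance (hh n k l p 1) (Wm n k l p)))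
    (√(tance (mm n k l p) (Wm n k l p))) (√(tance (mm n k l p) (hh n k l p 1)))
    (kap' n k l p / (‖kap' n k l p‖ : ℂ))
  transversal :
    |(herm (hh n k l p 1) q₂ * herm (mm n k l p) (mm n k l p) /
        (herm (hh n k l p 1) (mm n k l p) * herm (mm n k l p) q₂)).re - 1| <
      √(1 - 1 / tance (mm n k l p) (hh n k l p 1)) * √(1 - 1 / tance (mm n k l p) q₂)
  sector : 0 ≤ (herm q₂ (hh n k l p 0) * herm (hh n k l p 0) (mm n k l p) /
    herm q₂ (mm n k l p)).im
  sector' : 0 ≤ (herm (Wm n k l p) (hh n k l p 0) * herm (hh n k l p 0) q₂ /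
    herm (Wm n k l p) q₂).im

/-- The cycle of bisectors `𝒞` is the one whose complex geodesics are `S_i = W^{i-2} S_2`, where
`S_2` has the polar point `h₂`; the index `j` stands for `i = j + 1`. -/
def familyPolar (j : Fin n) : V :=
  Matrix.mulVec (W n l ^ ((j : ℤ) - 1)) (hh n k l p 1)

end Family

end CHyp

end

/-!
The Toledo invariant is computed as a sum over the edges of the polygon, and the sum is compared with
the one for an explicit orbit.

*Reduction to the edges.* On negative vectors, the `1`-form `x ↦ Im (⟨x, p⟩/⟨p, p⟩ - ⟨x, c⟩/⟨p, c⟩)`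
at `p` descends to the complex hyperbolic plane and is a primitive of twice the Kähler form
(`curl_primitive`). By Stokes' theorem on the polygon (`stokes_polygon`), the integral of `φ^*ω` is half
the integral of the pullback of this primitive, with `c = q₁`, along the boundary. Replacing the centre
`q₁` by a point `a` changes the primitive by the differential of Cartan's angular invariant
`arg (-⟨p, a⟩⟨a, q₁⟩⟨q₁, p⟩)`. If `a` lies on the mirror of the reflection `R_j`, then the integral along
the `j`-th edge for the centre `a` vanishes, as `R_j` reverses the image of the edge. So the edge
contributes the variation of the angular invariant between its ends (`integral_primitive_edge`).

*Comparison.* The cycle has a rotational symmetry: `M_{j+1} = T^j M_1`, where `T` is `W` normalized so as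
to fix `q₁`, and `T^n = 1`. The vector `X = W⁻¹ h₁` is negative and satisfies `R(m) T X = c X` with
`c = u₁²/w₁² = e^{2πit/3n}`. By the cocycle identity for the angular invariant, which holds exactly and
not only modulo `2π` since all the angles lie in `(-π/2, π/2)`, the values `φ(v_j)` may be replaced by
`T^j X`: the error terms telescope (`integral_pullbackKahler_eq`). For the orbit of `X`, every edge
contributes an angle `θ` with `e^{iθ} = -c` which lies in `(-π, π)`, hence `θ = 2πt/3n - π`, and the
invariant is `nθ/π = 2t/3 - n`.

*Existence.* A smooth equivariant map is obtained by joining `X` to `R(m) X`, spreading the path over the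
boundary by means of `T`, extending it radially and deforming it to the constant `q₁` near the centre
(`isEquivariantMap_modelMap`).

*The cycle.* The equations which define `m` say that `⟨m, m⟩ = 1` and that `W R(m)` has trace `∑ u_i²`.
A partial fraction expansion then gives `⟨h_i, m⟩ = 1/2` (`herm_hh_mm`), i.e. `R(m) h_i = m - h_i`, so
that `h_i` is an eigenvector of `W R(m)` with eigenvalue `u_i²`. The `u_i²` are distinct and have the
same `n`-th power, whence `R_n ⋯ R_1` is scalar (`exists_bisectorCycle`).
-/

noncomputable section

namespace CHyp

/-! ### Triples of negative vectors -/

lemma herm_self (x : V) : herm x x = (hnorm x : ℂ) := by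
  apply Complex.ext
  · simp [hnorm]
  · have h := congrArg Complex.im (herm_conj x x)
    simp only [Complex.conj_im, Complex.ofReal_im] at h ⊢
    linarith

lemma hnorm_eq (x : V) : hnorm x = -‖x 0‖ ^ 2 + ‖x 1‖ ^ 2 + ‖x 2‖ ^ 2 := by
  simp [hnorm, herm, Complex.mul_conj, Complex.sq_norm]

lemma hnorm_smul (c : ℂ) (x : V) : hnorm (c • x) = ‖c‖ ^ 2 * hnorm x := by
  simp only [hnorm_eq, Pi.smul_apply, smul_eq_mul, norm_mul]
  ring

lemma herm_mul_herm (x y : V) : herm x y * herm y x = ((‖herm x y‖ ^ 2 : ℝ) : ℂ) := by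
  rw [← herm_conj x y, Complex.mul_conj, Complex.sq_norm]

lemma norm_herm_comm (x y : V) : ‖herm x y‖ = ‖herm y x‖ := by
  rw [← herm_conj x y, Complex.norm_conj]

lemma ne_zero_of_hnorm_neg {x : V} (h : hnorm x < 0) : x ≠ 0 := by
  rintro rfl
  simp [hnorm, herm] at h

lemma apply_zero_ne_zero_of_hnorm_neg {x : V} (h : hnorm x < 0) : x 0 ≠ 0 := by
  intro h0
  rw [hnorm_eq, h0, norm_zero] at h
  nlinarith [sq_nonneg ‖x 1‖, sq_nonneg ‖x 2‖]

lemma hnorm_smul_neg {c : ℂ} (hc : c ≠ 0) {x : V} (hx : hnorm x < 0) : hnorm (c • x) < 0 := by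
  rw [hnorm_smul]
  exact mul_neg_of_pos_of_neg (by positivity) hx

/-- The reverse Cauchy–Schwarz inequality for negative vectors. -/
lemma hnorm_mul_hnorm_le {x y : V} (hx : hnorm x < 0) (hy : hnorm y < 0) :
    hnorm x * hnorm y ≤ ‖herm x y‖ ^ 2 := by
  rw [hnorm_eq] at hx hy ⊢
  rw [hnorm_eq]
  set a := ‖x 0‖
  set b := ‖y 0‖
  set c := √(‖x 1‖ ^ 2 + ‖x 2‖ ^ 2) with hc
  set d := √(‖y 1‖ ^ 2 + ‖y 2‖ ^ 2) with hd
  have ha : 0 ≤ a := norm_nonneg _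
  have hb : 0 ≤ b := norm_nonneg _
  have hc2 : c ^ 2 = ‖x 1‖ ^ 2 + ‖x 2‖ ^ 2 := Real.sq_sqrt (by positivity)
  have hd2 : d ^ 2 = ‖y 1‖ ^ 2 + ‖y 2‖ ^ 2 := Real.sq_sqrt (by positivity)
  have hc0 : 0 ≤ c := Real.sqrt_nonneg _
  have hd0 : 0 ≤ d := Real.sqrt_nonneg _
  have h1 : ‖x 1 * conj (y 1) + x 2 * conj (y 2)‖ ≤ c * d := by
    refine (norm_add_le _ _).trans ?_
    simp only [norm_mul, Complex.norm_conj]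
    refine abs_le_of_sq_le_sq' ?_ (by positivity) |>.2
    rw [mul_pow, hc2, hd2]
    nlinarith [sq_nonneg (‖x 1‖ * ‖y 2‖ - ‖x 2‖ * ‖y 1‖)]
  have h2 : a * b - c * d ≤ ‖herm x y‖ := by
    have h3 : ‖x 0 * conj (y 0)‖ ≤
        ‖herm x y‖ + ‖x 1 * conj (y 1) + x 2 * conj (y 2)‖ := by
      have e : x 0 * conj (y 0) = (x 1 * conj (y 1) + x 2 * conj (y 2)) - herm x y := by
        rw [herm]; ring
      rw [e]
      linarith [norm_sub_le (x 1 * conj (y 1) + x 2 * conj (y 2)) (herm x y)]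
    rw [norm_mul, Complex.norm_conj] at h3
    linarith
  have hca : c ≤ a := abs_le_of_sq_le_sq' (by linarith) ha |>.2
  have hdb : d ≤ b := abs_le_of_sq_le_sq' (by linarith) hb |>.2
  have h4 : 0 ≤ a * b - c * d := by nlinarith
  have h5 : (a * b - c * d) ^ 2 ≤ ‖herm x y‖ ^ 2 := by gcongr
  have h6 : -a ^ 2 + ‖x 1‖ ^ 2 + ‖x 2‖ ^ 2 = -(a ^ 2 - c ^ 2) := by rw [hc2]; ring
  have h7 : -b ^ 2 + ‖y 1‖ ^ 2 + ‖y 2‖ ^ 2 = -(b ^ 2 - d ^ 2) := by rw [hd2]; ring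
  rw [h6, h7]
  nlinarith [sq_nonneg (a * d - b * c)]

lemma herm_ne_zero {x y : V} (hx : hnorm x < 0) (hy : hnorm y < 0) : herm x y ≠ 0 := by
  intro h
  have := hnorm_mul_hnorm_le hx hy
  rw [h, norm_zero] at this
  nlinarith [mul_pos_of_neg_of_neg hx hy]

/-- The Gram determinant of three vectors is nonpositive, being `-|det|²`. -/
lemma gram_det_nonpos (x y z : V) :
    hnorm x * hnorm y * hnorm z + 2 * (herm x y * herm y z * herm z x).re
      - hnorm x * ‖herm y z‖ ^ 2 - hnorm y * ‖herm z x‖ ^ 2 - hnorm z * ‖herm x y‖ ^ 2 ≤ 0 := by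
  set d : ℂ := x 0 * (y 1 * z 2 - y 2 * z 1) - x 1 * (y 0 * z 2 - y 2 * z 0)
    + x 2 * (y 0 * z 1 - y 1 * z 0) with hd
  have key : herm x x * herm y y * herm z z
      + (herm x y * herm y z * herm z x + conj (herm x y * herm y z * herm z x))
      - herm x x * (herm y z * herm z y) - herm y y * (herm z x * herm x z)
      - herm z z * (herm x y * herm y x) = -(d * conj d) := by
    simp only [hd, herm, map_mul, map_add, map_sub, map_neg, Complex.conj_conj]
    ring
  rw [Complex.add_conj, Complex.mul_conj, herm_mul_herm, herm_mul_herm, herm_mul_herm,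
    herm_self, herm_self, herm_self] at key
  have key' : hnorm x * hnorm y * hnorm z + 2 * (herm x y * herm y z * herm z x).re
      - hnorm x * ‖herm y z‖ ^ 2 - hnorm y * ‖herm z x‖ ^ 2 - hnorm z * ‖herm x y‖ ^ 2
      = -Complex.normSq d := by exact_mod_cast key
  rw [key']
  linarith [Complex.normSq_nonneg d]

lemma re_triple_neg {x y z : V} (hx : hnorm x < 0) (hy : hnorm y < 0) (hz : hnorm z < 0) :
    (herm x y * herm y z * herm z x).re < 0 := by
  have h := gram_det_nonpos x y z
  have h1 : hnorm y * hnorm z ≤ ‖herm y z‖ ^ 2 := hnorm_mul_hnorm_le hy hz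
  have h2 : 0 < ‖herm z x‖ ^ 2 := by
    have := norm_pos_iff.2 (herm_ne_zero hz hx); positivity
  have h3 : 0 < ‖herm x y‖ ^ 2 := by
    have := norm_pos_iff.2 (herm_ne_zero hx hy); positivity
  nlinarith [mul_neg_of_neg_of_pos hy h2, mul_neg_of_neg_of_pos hz h3]

/-- The angular invariant `arg (-⟨x, y⟩⟨y, z⟩⟨z, x⟩)` of Cartan of three negative points. -/
def cartanArg (x y z : V) : ℝ := Complex.arg (-(herm x y * herm y z * herm z x))

lemma abs_cartanArg_lt {x y z : V} (hx : hnorm x < 0) (hy : hnorm y < 0) (hz : hnorm z < 0) :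
    |cartanArg x y z| < Real.pi / 2 := by
  rw [cartanArg, Complex.abs_arg_lt_pi_div_two_iff]
  left
  simpa using re_triple_neg hx hy hz

lemma norm_mul_exp_cartanArg (x y z : V) :
    (‖herm x y * herm y z * herm z x‖ : ℂ) * Complex.exp (cartanArg x y z * Complex.I) =
      -(herm x y * herm y z * herm z x) := by
  rw [cartanArg, ← norm_neg, Complex.norm_mul_exp_arg_mul_I]

lemma cartanArg_eq_of_mul {x y z x' y' z' : V} {r : ℝ} (hr : 0 < r)
    (h : herm x' y' * herm y' z' * herm z' x' = r * (herm x y * herm y z * herm z x)) :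
    cartanArg x' y' z' = cartanArg x y z := by
  rw [cartanArg, cartanArg, h, ← mul_neg, Complex.arg_real_mul _ hr]

lemma cartanArg_smul_left {c : ℂ} (hc : c ≠ 0) (x y z : V) :
    cartanArg (c • x) y z = cartanArg x y z := by
  apply cartanArg_eq_of_mul (r := Complex.normSq c) (Complex.normSq_pos.2 hc)
  rw [herm_smul_left, herm_smul_right, ← Complex.mul_conj]
  ring

lemma cartanArg_rotate (x y z : V) : cartanArg y z x = cartanArg x y z := by
  apply cartanArg_eq_of_mul one_pos
  push_cast
  ring

lemma cartanArg_smul_mid {c : ℂ} (hc : c ≠ 0) (x y z : V) :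
    cartanArg x (c • y) z = cartanArg x y z := by
  rw [← cartanArg_rotate, cartanArg_smul_left hc, cartanArg_rotate]

lemma cartanArg_smul_right {c : ℂ} (hc : c ≠ 0) (x y z : V) :
    cartanArg x y (c • z) = cartanArg x y z := by
  rw [← cartanArg_rotate, cartanArg_smul_mid hc, cartanArg_rotate]

lemma herm_U (g : U) (x y : V) : herm (g • x) (g • y) = herm x y :=
  g.2 x y

lemma hnorm_U (g : U) (x : V) : hnorm (g • x) = hnorm x := by
  rw [hnorm, herm_U, hnorm]

lemma cartanArg_U (g : U) (x y z : V) : cartanArg (g • x) (g • y) (g • z) = cartanArg x y z := by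
  simp only [cartanArg, herm_U]

lemma eq_of_exp_eq_of_abs_sub_lt {a b : ℝ}
    (h : Complex.exp (a * Complex.I) = Complex.exp (b * Complex.I))
    (hab : |a - b| < 2 * Real.pi) : a = b := by
  obtain ⟨k, hk⟩ := Complex.exp_eq_exp_iff_exists_int.1 h
  have hk' : a = b + k * (2 * Real.pi) := by
    have := congrArg Complex.im hk
    simpa [Complex.mul_im, Complex.add_im] using this
  have hk0 : k = 0 := by
    rw [hk', add_sub_cancel_left, abs_mul, abs_of_pos Real.two_pi_pos] at hab
    have : |(k : ℝ)| < 1 := by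
      by_contra! hge
      nlinarith [Real.two_pi_pos]
    have : |k| < 1 := by exact_mod_cast this
    exact Int.abs_lt_one_iff.1 this
  rw [hk', hk0]; simp

/-- The cocycle identity of the angular invariant. It holds modulo `2π` because the product of the
four triple products is real and positive, and exactly because each angle is less than `π / 2`. -/
lemma cartanArg_cocycle {x y z w : V} (hx : hnorm x < 0) (hy : hnorm y < 0) (hz : hnorm z < 0)
    (hw : hnorm w < 0) :
    cartanArg x z w - cartanArg y z w = cartanArg x y w - cartanArg x y z := by
  have hxy := herm_ne_zero hx hy
  have hxz := herm_ne_zero hx hz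
  have hxw := herm_ne_zero hx hw
  have hyz := herm_ne_zero hy hz
  have hyw := herm_ne_zero hy hw
  have hzw := herm_ne_zero hz hw
  have b1 := abs_lt.1 (abs_cartanArg_lt hx hz hw)
  have b2 := abs_lt.1 (abs_cartanArg_lt hy hz hw)
  have b3 := abs_lt.1 (abs_cartanArg_lt hx hy hw)
  have b4 := abs_lt.1 (abs_cartanArg_lt hx hy hz)
  suffices h : cartanArg x z w + cartanArg x y z = cartanArg x y w + cartanArg y z w by linarith
  apply eq_of_exp_eq_of_abs_sub_lt _ (abs_lt.2 ⟨by linarith, by linarith⟩)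
  have e1 := norm_mul_exp_cartanArg x z w
  have e2 := norm_mul_exp_cartanArg y z w
  have e3 := norm_mul_exp_cartanArg x y w
  have e4 := norm_mul_exp_cartanArg x y z
  push_cast
  rw [add_mul, add_mul, Complex.exp_add, Complex.exp_add]
  set E1 := Complex.exp (cartanArg x z w * Complex.I)
  set E2 := Complex.exp (cartanArg y z w * Complex.I)
  set E3 := Complex.exp (cartanArg x y w * Complex.I)
  set E4 := Complex.exp (cartanArg x y z * Complex.I)
  have n : ∀ a b : V, ((‖herm a b‖ : ℝ) : ℂ) * (‖herm a b‖ : ℝ) = herm a b * herm b a := by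
    intro a b
    rw [herm_mul_herm]; push_cast; ring
  have n' : ∀ {a b : V}, herm a b ≠ 0 → ((‖herm a b‖ : ℝ) : ℂ) ≠ 0 := fun h =>
    Complex.ofReal_ne_zero.2 (norm_ne_zero_iff.2 h)
  simp only [norm_mul] at e1 e2 e3 e4
  rw [norm_herm_comm w x] at e1 e3
  rw [norm_herm_comm w y] at e2
  rw [norm_herm_comm z x] at e4
  push_cast at e1 e2 e3 e4
  have h1 := n' hxy; have h2 := n' hxz; have h3 := n' hxw
  have h4 := n' hyz; have h5 := n' hyw; have h6 := n' hzw
  set a := ((‖herm x y‖ : ℝ) : ℂ)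
  set b := ((‖herm x z‖ : ℝ) : ℂ)
  set c := ((‖herm x w‖ : ℝ) : ℂ)
  set d := ((‖herm y z‖ : ℝ) : ℂ)
  set e := ((‖herm y w‖ : ℝ) : ℂ)
  set f := ((‖herm z w‖ : ℝ) : ℂ)
  have L : (a * b ^ 2 * c * d * f) * (E1 * E4)
      = herm x z * herm z x * herm z w * herm w x * herm x y * herm y z := by
    linear_combination (a * d * b) * E4 * e1 - herm x z * herm z w * herm w x * e4
  have R : (a * c * d * e ^ 2 * f) * (E3 * E2)
      = herm y w * herm w y * herm z w * herm w x * herm x y * herm y z := by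
    linear_combination (d * f * e) * E2 * e3 - herm x y * herm y w * herm w x * e2
  have nb : b * b = herm x z * herm z x := n x z
  have ne : e * e = herm y w * herm w y := n y w
  have hne : a * b ^ 2 * c * d * f * e ^ 2 ≠ 0 := by positivity
  apply mul_left_cancel₀ hne
  linear_combination e ^ 2 * L - b ^ 2 * R
    + (herm x z * herm z x * herm z w * herm w x * herm x y * herm y z) * ne
    - (herm y w * herm w y * herm z w * herm w x * herm x y * herm y z) * nb

/-! ### Stokes' theorem on triangles with a vertex at the origin -/

/-- The area form of `ℂ`. -/
def cross (x y : ℂ) : ℝ := (conj x * y).im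

lemma cross_def (x y : ℂ) : cross x y = x.re * y.im - x.im * y.re := by
  simp [cross]; ring

/-- The triangle with vertices `0, a, b`, without its vertex `0` and its side from `0` to `b`. -/
def triangle (a b : ℂ) : Set ℂ := {z | 0 ≤ cross a z ∧ 0 < cross z b ∧
  cross a z + cross z b ≤ cross a b}

/-- The parametrization of the triangle with vertices `0, a, b` by the unit square, which
collapses one side of the square to the vertex `0`. -/
def coneMap (a b : ℂ) (p : ℝ × ℝ) : ℂ := (p.1 : ℂ) * (a + p.2 * (b - a))

lemma continuous_cross_right (a : ℂ) : Continuous (cross a) := by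
  unfold cross; fun_prop

lemma continuous_cross_left (b : ℂ) : Continuous fun z => cross z b := by
  unfold cross; fun_prop

lemma measurableSet_triangle (a b : ℂ) : MeasurableSet (triangle a b) := by
  have h1 := continuous_cross_right a
  have h2 := continuous_cross_left b
  exact (measurableSet_le measurable_const h1.measurable).inter
    ((measurableSet_lt measurable_const h2.measurable).inter
      (measurableSet_le (h1.add h2).measurable measurable_const))

lemma cross_coneMap_right (a b : ℂ) (p : ℝ × ℝ) :
    cross a (coneMap a b p) = p.1 * p.2 * cross a b := by
  simp [coneMap, cross_def]; ring

lemma cross_coneMap_left (a b : ℂ) (p : ℝ × ℝ) :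
    cross (coneMap a b p) b = p.1 * (1 - p.2) * cross a b := by
  simp [coneMap, cross_def]; ring

lemma coneMap_injOn {a b : ℂ} (h : 0 < cross a b) :
    Set.InjOn (coneMap a b) (Set.Ioc 0 1 ×ˢ Set.Ico 0 1) := by
  rintro ⟨s, t⟩ hp ⟨s', t'⟩ - he
  have h1 := cross_coneMap_right a b (s, t)
  have h2 := cross_coneMap_left a b (s, t)
  rw [he, cross_coneMap_right] at h1
  rw [he, cross_coneMap_left] at h2
  have h1' := mul_right_cancel₀ h.ne' h1
  have h2' := mul_right_cancel₀ h.ne' h2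
  simp only at h1' h2'
  have hs : s' = s := by linarith
  subst hs
  have ht : t' = t := mul_left_cancel₀ hp.1.1.ne' h1'
  rw [ht]

lemma coneMap_image {a b : ℂ} (h : 0 < cross a b) :
    coneMap a b '' (Set.Ioc 0 1 ×ˢ Set.Ico 0 1) = triangle a b := by
  ext z
  constructor
  · rintro ⟨⟨s, t⟩, ⟨⟨hs0, hs1⟩, ht0, ht1⟩, rfl⟩
    simp only at hs0 hs1 ht0 ht1
    refine ⟨?_, ?_, ?_⟩
    · rw [cross_coneMap_right]; positivity
    · rw [cross_coneMap_left]
      have : 0 < 1 - t := by linarith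
      positivity
    · rw [cross_coneMap_right, cross_coneMap_left]; simp only; nlinarith
  · rintro ⟨h1, h2, h3⟩
    set D := cross a b
    set A := cross a z with hA
    set B := cross z b with hB
    have hAB : 0 < A + B := by linarith
    refine ⟨((A + B) / D, A / (A + B)), ⟨⟨by positivity, (div_le_one h).2 h3⟩, by positivity,
      (div_lt_one hAB).2 (by linarith)⟩, ?_⟩
    -- Cramer's rule
    have key : (D : ℂ) * z = B * a + A * b := by
      apply Complex.ext
      · simp [D, hA, hB, cross_def]; ring
      · simp [D, hA, hB, cross_def]; ring
    have hD : (D : ℂ) ≠ 0 := by exact_mod_cast h.ne'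
    have hAB' : (A : ℂ) + B ≠ 0 := by exact_mod_cast hAB.ne'
    simp only [coneMap]
    push_cast
    field_simp
    linear_combination -key

/-- The derivative of `coneMap`, read in `ℝ × ℝ`. -/
def coneMapDeriv (a b : ℂ) (p : ℝ × ℝ) : ℝ × ℝ →L[ℝ] ℝ × ℝ :=
  (Matrix.toLin (.finTwoProd ℝ) (.finTwoProd ℝ)
    !![(a + p.2 * (b - a)).re, p.1 * (b - a).re;
      (a + p.2 * (b - a)).im, p.1 * (b - a).im]).toContinuousLinearMap

lemma hasFDerivAt_coneMap_re_im (a b : ℂ) (p : ℝ × ℝ) :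
    HasFDerivAt (fun p => ((coneMap a b p).re, (coneMap a b p).im)) (coneMapDeriv a b p) p := by
  unfold coneMapDeriv
  rw [Matrix.toLin_finTwoProd_toContinuousLinearMap]
  have e : (fun p : ℝ × ℝ => ((coneMap a b p).re, (coneMap a b p).im)) =
      fun p => (p.1 * (a.re + p.2 * (b - a).re), p.1 * (a.im + p.2 * (b - a).im)) := by
    funext p; simp [coneMap]
  rw [e]
  have h1 : HasFDerivAt (Prod.fst : ℝ × ℝ → ℝ) (ContinuousLinearMap.fst ℝ ℝ ℝ) p := hasFDerivAt_fst
  have h2 : HasFDerivAt (Prod.snd : ℝ × ℝ → ℝ) (ContinuousLinearMap.snd ℝ ℝ ℝ) p := hasFDerivAt_snd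
  convert!
    HasFDerivAt.prodMk (𝕜 := ℝ)
      (h1.mul ((h2.mul_const (b - a).re).const_add a.re))
      (h1.mul ((h2.mul_const (b - a).im).const_add a.im)) using 2 <;>
  · ext <;> simp

lemma det_coneMapDeriv (a b : ℂ) (p : ℝ × ℝ) :
    (coneMapDeriv a b p).det = p.1 * cross a b := by
  unfold coneMapDeriv
  simp only [LinearMap.det_toContinuousLinearMap, LinearMap.det_toLin, Matrix.det_fin_two_of,
    cross_def]
  simp
  ring

lemma setIntegral_triangle {a b : ℂ} (h : 0 < cross a b) (g : ℂ → ℝ) :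
    ∫ z in triangle a b, g z =
      ∫ p in Set.Icc (0 : ℝ × ℝ) 1, p.1 * cross a b * g (coneMap a b p) := by
  have e := (MeasureTheory.MeasurePreserving.setIntegral_image_emb
    Complex.volume_preserving_equiv_real_prod.symm
    Complex.measurableEquivRealProd.symm.measurableEmbedding g
    ((fun p => ((coneMap a b p).re, (coneMap a b p).im)) '' (Set.Ioc 0 1 ×ˢ Set.Ico 0 1)))
  have himg : Complex.measurableEquivRealProd.symm ''
      ((fun p => ((coneMap a b p).re, (coneMap a b p).im)) '' (Set.Ioc 0 1 ×ˢ Set.Ico 0 1)) =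
      triangle a b := by
    rw [← coneMap_image h, Set.image_image]
    refine Set.image_congr fun p _ => ?_
    exact Complex.measurableEquivRealProd.symm_apply_apply (coneMap a b p)
  have hinj : Set.InjOn (fun p => ((coneMap a b p).re, (coneMap a b p).im))
      (Set.Ioc 0 1 ×ˢ Set.Ico 0 1) := by
    intro p hp q hq hpq
    refine coneMap_injOn h hp hq ?_
    simp only [Prod.mk.injEq] at hpq
    exact Complex.ext hpq.1 hpq.2
  rw [himg] at e
  rw [e, MeasureTheory.integral_image_eq_integral_abs_det_fderiv_smul MeasureTheory.volume
    (measurableSet_Ioc.prod measurableSet_Ico)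
    (fun p _ => (hasFDerivAt_coneMap_re_im a b p).hasFDerivWithinAt) hinj]
  have hae : (Set.Ioc (0 : ℝ) 1 ×ˢ Set.Ico (0 : ℝ) 1 : Set (ℝ × ℝ))
      =ᵐ[MeasureTheory.volume] Set.Icc (0 : ℝ × ℝ) 1 := by
    have : Set.Icc (0 : ℝ × ℝ) 1 = Set.Icc (0 : ℝ) 1 ×ˢ Set.Icc (0 : ℝ) 1 := by
      rw [← Prod.mk_zero_zero, ← Prod.mk_one_one, Set.Icc_prod_eq]
    rw [this]
    exact MeasureTheory.Measure.set_prod_ae_eq MeasureTheory.Ioc_ae_eq_Icc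
      MeasureTheory.Ico_ae_eq_Icc
  rw [← MeasureTheory.setIntegral_congr_set hae]
  refine MeasureTheory.setIntegral_congr_fun (measurableSet_Ioc.prod measurableSet_Ico) ?_
  rintro ⟨s, t⟩ ⟨⟨hs0, hs1⟩, -⟩
  simp only at hs0 hs1
  simp only [det_coneMapDeriv, smul_eq_mul]
  rw [abs_of_pos (by positivity)]
  rfl

/-- The density of the exterior derivative of a `1`-form on `ℂ`. -/
def curl (α : ℂ → ℂ →L[ℝ] ℝ) (z : ℂ) : ℝ := fderiv ℝ α z 1 Complex.I - fderiv ℝ α z Complex.I 1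

lemma bilin_sub_eq (B : ℂ →L[ℝ] ℂ →L[ℝ] ℝ) (x y : ℂ) :
    B x y - B y x = cross x y * (B 1 Complex.I - B Complex.I 1) := by
  have hd : ∀ z : ℂ, z = z.re • (1 : ℂ) + z.im • Complex.I := fun z => by
    simp
  rw [hd x, hd y]
  simp only [map_add, map_smul, add_apply, smul_apply,
    smul_eq_mul, cross_def]
  simp
  ring

lemma continuousAt_curl {α : ℂ → ℂ →L[ℝ] ℝ} {z : ℂ} (h : ContDiffAt ℝ 1 α z) :
    ContinuousAt (curl α) z := by
  have h1 : ContinuousAt (fderiv ℝ α) z :=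
    (h.fderiv_right (m := 0) (by norm_num)).continuousAt
  unfold curl
  fun_prop

lemma stokes_triangle {a b : ℂ} (h : 0 < cross a b) {α : ℂ → ℂ →L[ℝ] ℝ}
    (hα : ∀ p ∈ Set.Icc (0 : ℝ × ℝ) 1, ContDiffAt ℝ 1 α (coneMap a b p)) :
    ∫ z in triangle a b, curl α z = (∫ t in (0 : ℝ)..1, α (a + t * (b - a)) (b - a))
      - (∫ s in (0 : ℝ)..1, α (s * b) b) + ∫ s in (0 : ℝ)..1, α (s * a) a := by
  rw [setIntegral_triangle h]
  set d := b - a with hd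
  -- the derivative of `coneMap`
  let L : ℝ × ℝ → ℝ × ℝ →L[ℝ] ℂ := fun p =>
    (ContinuousLinearMap.fst ℝ ℝ ℝ).smulRight (a + p.2 * d) +
      (ContinuousLinearMap.snd ℝ ℝ ℝ).smulRight (p.1 * d)
  have h1 : ∀ p, HasFDerivAt (Prod.fst : ℝ × ℝ → ℝ) (ContinuousLinearMap.fst ℝ ℝ ℝ) p :=
    fun p => hasFDerivAt_fst
  have h2 : ∀ p, HasFDerivAt (Prod.snd : ℝ × ℝ → ℝ) (ContinuousLinearMap.snd ℝ ℝ ℝ) p :=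
    fun p => hasFDerivAt_snd
  have hF : ∀ p, HasFDerivAt (coneMap a b) (L p) p := by
    intro p
    have h3 := (h1 p).fun_smul (((h2 p).smul_const d).const_add a)
    have e : coneMap a b = fun p => p.1 • (a + p.2 • d) := by
      funext p; simp [coneMap, hd]; ring
    rw [e]
    exact h3.congr_fderiv (by ext <;> simp [L])
  have hcF : Continuous (coneMap a b) := continuous_iff_continuousAt.2 fun p => (hF p).continuousAt
  have hA : ∀ p ∈ Set.Icc (0 : ℝ × ℝ) 1, HasFDerivAt (fun p => α (coneMap a b p))
      ((fderiv ℝ α (coneMap a b p)).comp (L p)) p := fun p hp =>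
    ((hα p hp).differentiableAt one_ne_zero).hasFDerivAt.comp p (hF p)
  have hs : ∀ p : ℝ × ℝ, HasFDerivAt (fun p : ℝ × ℝ => (p.1 : ℂ) * d)
      ((ContinuousLinearMap.fst ℝ ℝ ℝ).smulRight d) p := fun p => by
    simpa using (h1 p).smul_const d
  have ht : ∀ p : ℝ × ℝ, HasFDerivAt (fun p : ℝ × ℝ => a + (p.2 : ℂ) * d)
      ((ContinuousLinearMap.snd ℝ ℝ ℝ).smulRight d) p := fun p => by
    simpa using ((h2 p).smul_const d).const_add a
  have hf := fun p hp => (hA p hp).clm_apply (hs p)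
  have hg := fun p hp => ((hA p hp).clm_apply (ht p)).neg
  have hsub : Set.Ioo (0 : ℝ) 1 ×ˢ Set.Ioo (0 : ℝ) 1 ⊆ Set.Icc (0 : ℝ × ℝ) 1 := by
    rintro ⟨s, t⟩ ⟨h1, h2⟩
    exact ⟨⟨h1.1.le, h2.1.le⟩, ⟨h1.2.le, h2.2.le⟩⟩
  have hpt : ∀ p : ℝ × ℝ, p.1 * cross a b * curl α (coneMap a b p) =
      (fderiv ℝ α (coneMap a b p) (a + p.2 * d) (p.1 * d) + α (coneMap a b p) d) +
      -(fderiv ℝ α (coneMap a b p) (p.1 * d) (a + p.2 * d) + α (coneMap a b p) d) := by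
    intro p
    have h1 := bilin_sub_eq (fderiv ℝ α (coneMap a b p)) (a + p.2 * d) (p.1 * d)
    have h2 : cross (a + p.2 * d) (p.1 * d) = p.1 * cross a b := by
      simp [cross_def, hd]; ring
    rw [h2] at h1
    rw [curl]
    linarith
  have hcont : ContinuousOn (fun p : ℝ × ℝ => p.1 * cross a b * curl α (coneMap a b p))
      (Set.Icc 0 1) := by
    intro p hp
    have := ContinuousAt.comp (f := coneMap a b) (continuousAt_curl (hα p hp)) hcF.continuousAt
    exact ((by fun_prop : ContinuousAt (fun p : ℝ × ℝ => p.1 * cross a b) p).mul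
      this).continuousWithinAt
  have main := MeasureTheory.integral_divergence_prod_Icc_of_hasFDerivAt_of_le
    (fun p => α (coneMap a b p) (p.1 * d)) (fun p => -α (coneMap a b p) (a + p.2 * d)) _ _
    (0 : ℝ × ℝ) 1 (by simp)
    (fun p hp => (hf p hp).continuousAt.continuousWithinAt)
    (fun p hp => (hg p hp).continuousAt.continuousWithinAt)
    (fun p hp => hf p (hsub hp)) (fun p hp => hg p (hsub hp))
    (by
      refine (hcont.integrableOn_compact isCompact_Icc).congr_fun (fun p _ => ?_)
        measurableSet_Icc
      simp only [hpt]
      simp [L]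
      ring)
  have e1 : ∫ p in Set.Icc (0 : ℝ × ℝ) 1, p.1 * cross a b * curl α (coneMap a b p) = _ :=
    Eq.trans (MeasureTheory.setIntegral_congr_fun measurableSet_Icc fun p _ => by
      simp only [hpt]
      simp [L]
      ring) main
  rw [e1]
  have hb : a + d = b := by rw [hd]; ring
  simp only [coneMap, Prod.fst_one, Prod.snd_one, Prod.fst_zero, Prod.snd_zero,
    Complex.ofReal_one, Complex.ofReal_zero, one_mul, zero_mul, map_zero, add_zero, ← hd, hb,
    intervalIntegral.integral_zero, intervalIntegral.integral_neg]
  ring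

/-! ### Stokes' theorem on the regular polygon -/

/-- The circumradius of the polygon in the Klein model. -/
def circumradius (n : ℕ) : ℝ := √(1 - Real.tan (Real.pi / n) ^ 4)

/-- The central angle `2π / n` of an edge of the polygon. -/
def centralAngle (n : ℕ) : ℝ := 2 * Real.pi / n

section
variable {n : ℕ}

lemma circumradius_pos (hn : 5 ≤ n) : 0 < circumradius n := by
  have hn' : (5 : ℝ) ≤ n := by exact_mod_cast hn
  have hpi := Real.pi_pos
  have h1 : Real.pi / n < Real.pi / 4 := by gcongr; linarith
  have h0 : 0 < Real.pi / n := by positivity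
  have h2 : Real.tan (Real.pi / n) < 1 := by
    rw [← Real.tan_pi_div_four]
    exact Real.tan_lt_tan_of_lt_of_lt_pi_div_two (by linarith) (by linarith) h1
  have h3 : 0 < Real.tan (Real.pi / n) := Real.tan_pos_of_pos_of_lt_pi_div_two h0 (by linarith)
  have h4 : Real.tan (Real.pi / n) ^ 4 < 1 := pow_lt_one₀ h3.le h2 (by norm_num)
  exact Real.sqrt_pos.2 (by linarith)

lemma centralAngle_pos (hn : 5 ≤ n) : 0 < centralAngle n := by
  have : (0 : ℝ) < n := by exact_mod_cast (by omega : 0 < n)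
  have := Real.pi_pos
  unfold centralAngle
  positivity

lemma n_mul_centralAngle (hn : 5 ≤ n) : n * centralAngle n = 2 * Real.pi := by
  have : (n : ℝ) ≠ 0 := by exact_mod_cast (by omega : n ≠ 0)
  unfold centralAngle
  field_simp

lemma centralAngle_lt (hn : 5 ≤ n) : centralAngle n < Real.pi / 2 := by
  have hn' : (5 : ℝ) ≤ n := by exact_mod_cast hn
  have h := n_mul_centralAngle hn
  have hc := centralAngle_pos hn
  have := Real.pi_pos
  nlinarith

lemma vertex_eq (n j : ℕ) :
    vertex n j = circumradius n * Complex.exp ((j * centralAngle n : ℝ) * Complex.I) := by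
  rw [vertex, circumradius, centralAngle]
  congr 2
  push_cast
  ring

lemma vertex_add_self (hn : 5 ≤ n) (j : ℕ) : vertex n (j + n) = vertex n j := by
  rw [vertex_eq, vertex_eq]
  congr 1
  have e : (((j + n : ℕ) : ℝ) * centralAngle n : ℝ) = j * centralAngle n + 2 * Real.pi := by
    rw [← n_mul_centralAngle hn]; push_cast; ring
  rw [e]
  push_cast
  rw [add_mul, Complex.exp_add, Complex.exp_two_pi_mul_I, mul_one]

lemma vertex_mod (hn : 5 ≤ n) (j : ℕ) : vertex n j = vertex n (j % n) := by
  have h : ∀ q, vertex n (j % n + n * q) = vertex n (j % n) := by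
    intro q
    induction q with
    | zero => simp
    | succ q ih => rw [mul_add, mul_one, ← add_assoc, vertex_add_self hn, ih]
  rw [← h (j / n), Nat.mod_add_div]

lemma vertex_mem_polygon (n j : ℕ) : vertex n j ∈ polygon n :=
  subset_convexHull ℝ _ ⟨j, rfl⟩

lemma convex_polygon (n : ℕ) : Convex ℝ (polygon n) := convex_convexHull ℝ _

lemma isCompact_polygon (hn : 5 ≤ n) : IsCompact (polygon n) := by
  have h : (Set.range (vertex n)).Finite := by
    refine ((Set.finite_lt_nat n).image (vertex n)).subset ?_
    rintro _ ⟨j, rfl⟩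
    exact ⟨j % n, Nat.mod_lt _ (by omega), (vertex_mod hn j).symm⟩
  exact h.isCompact_convexHull ℝ

lemma zero_mem_polygon (hn : 5 ≤ n) : (0 : ℂ) ∈ polygon n := by
  have hn0 : (n : ℝ) ≠ 0 := by exact_mod_cast (by omega : n ≠ 0)
  have h := (convex_polygon n).sum_mem (t := Finset.range n) (w := fun _ => (n : ℝ)⁻¹)
    (z := vertex n) (fun _ _ => by positivity) (by simp [hn0])
    (fun j _ => vertex_mem_polygon n j)
  rw [← Finset.smul_sum] at h
  have hz : ∑ j ∈ Finset.range n, vertex n j = 0 := by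
    have hp := Complex.isPrimitiveRoot_exp n (by omega)
    have hs := hp.geom_sum_eq_zero (by omega)
    have e : ∀ j, vertex n j =
        circumradius n * Complex.exp (2 * Real.pi * Complex.I / n) ^ j := by
      intro j
      rw [vertex_eq, ← Complex.exp_nat_mul, centralAngle]
      congr 2
      push_cast
      ring
    simp only [e, ← Finset.mul_sum]
    rw [hs, mul_zero]
  rwa [hz, smul_zero] at h

lemma cross_exp (r s x y : ℝ) :
    cross (r * Complex.exp (x * Complex.I)) (s * Complex.exp (y * Complex.I)) =
      r * s * Real.sin (y - x) := by
  rw [cross_def, Complex.re_ofReal_mul, Complex.re_ofReal_mul, Complex.im_ofReal_mul,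
    Complex.im_ofReal_mul, Complex.exp_ofReal_mul_I_re, Complex.exp_ofReal_mul_I_re,
    Complex.exp_ofReal_mul_I_im, Complex.exp_ofReal_mul_I_im, Real.sin_sub]
  ring

lemma cross_vertex_succ (n j : ℕ) :
    cross (vertex n j) (vertex n (j + 1)) = circumradius n ^ 2 * Real.sin (centralAngle n) := by
  rw [vertex_eq, vertex_eq, cross_exp]
  push_cast
  ring_nf

lemma cross_vertex_succ_pos (hn : 5 ≤ n) (j : ℕ) :
    0 < cross (vertex n j) (vertex n (j + 1)) := by
  rw [cross_vertex_succ]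
  have h1 := circumradius_pos hn
  have h2 := Real.sin_pos_of_pos_of_lt_pi (centralAngle_pos hn)
    (by linarith [centralAngle_lt hn, Real.pi_pos])
  positivity

lemma coneMap_mem_polygon (hn : 5 ≤ n) (j : ℕ) {p : ℝ × ℝ} (hp : p ∈ Set.Icc (0 : ℝ × ℝ) 1) :
    coneMap (vertex n j) (vertex n (j + 1)) p ∈ polygon n := by
  obtain ⟨⟨h1, h2⟩, h3, h4⟩ := hp
  simp only [Prod.fst_zero, Prod.snd_zero, Prod.fst_one, Prod.snd_one] at h1 h2 h3 h4
  have hc := convex_polygon n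
  have h := hc (vertex_mem_polygon n j) (vertex_mem_polygon n (j + 1)) (sub_nonneg.2 h4) h2
    (by ring)
  have h' := hc (zero_mem_polygon hn) h (sub_nonneg.2 h3) h1 (by ring)
  convert h' using 1
  simp [coneMap]
  ring

lemma edge_mem_polygon (n j : ℕ) {t : ℝ} (ht : t ∈ Set.Icc (0 : ℝ) 1) :
    vertex n j + t * (vertex n (j + 1) - vertex n j) ∈ polygon n := by
  have h := convex_polygon n (vertex_mem_polygon n j) (vertex_mem_polygon n (j + 1))
    (sub_nonneg.2 ht.2) ht.1 (by ring)
  convert h using 1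
  simp
  ring

lemma cos_odd_mul_le (hn : 5 ≤ n) {m : ℤ} (h1 : -(n : ℤ) < m) (h2 : m < n) :
    Real.cos ((2 * m - 1) * (Real.pi / n)) ≤ Real.cos (Real.pi / n) := by
  have hn0 : (0 : ℝ) < n := by exact_mod_cast (by omega : 0 < n)
  have hpi := Real.pi_pos
  have hx : (n : ℝ) * (Real.pi / n) = Real.pi := by field_simp
  have hx0 : 0 < Real.pi / n := by positivity
  set x := Real.pi / n
  rw [← Real.cos_abs, abs_mul, abs_of_pos hx0]
  have hq1 : (1 : ℝ) ≤ |2 * (m : ℝ) - 1| := by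
    have : (1 : ℤ) ≤ |2 * m - 1| := by
      exact Int.one_le_abs (by omega)
    exact_mod_cast this
  have hq2 : |2 * (m : ℝ) - 1| ≤ 2 * n - 1 := by
    have : |2 * m - 1| ≤ 2 * (n : ℤ) - 1 := abs_le.2 ⟨by omega, by omega⟩
    exact_mod_cast this
  set q := |2 * (m : ℝ) - 1|
  rcases le_total (q * x) Real.pi with h | h
  · exact Real.cos_le_cos_of_nonneg_of_le_pi hx0.le h (by nlinarith)
  · rw [← Real.cos_two_pi_sub]
    exact Real.cos_le_cos_of_nonneg_of_le_pi hx0.le (by linarith) (by nlinarith)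

/-- The polygon lies on the inner side of the line through each of its edges. -/
lemma polygon_subset_halfPlane (hn : 5 ≤ n) {j : ℕ} (hj : j < n) {z : ℂ} (hz : z ∈ polygon n) :
    cross (vertex n j) z + cross z (vertex n (j + 1)) ≤
      cross (vertex n j) (vertex n (j + 1)) := by
  have hconv : Convex ℝ {z : ℂ | cross (vertex n j) z + cross z (vertex n (j + 1)) ≤
      cross (vertex n j) (vertex n (j + 1))} := by
    apply convex_halfSpace_le
    constructor
    · intro x y
      simp [cross_def]; ring
    · intro c x
      simp [cross_def]; ring
  refine convexHull_min ?_ hconv hz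
  rintro _ ⟨k, rfl⟩
  rw [vertex_mod hn k]
  have hk : k % n < n := Nat.mod_lt _ (by omega)
  set k' := k % n
  simp only [Set.mem_ofPred_eq]
  rw [cross_vertex_succ, vertex_eq, vertex_eq, vertex_eq, cross_exp, cross_exp, ← mul_add, ← sq]
  refine mul_le_mul_of_nonneg_left ?_ (sq_nonneg _)
  have hb : centralAngle n = 2 * (Real.pi / n) := by rw [centralAngle]; ring
  have h := cos_odd_mul_le hn (m := (k' : ℤ) - j) (by omega) (by omega)
  rw [hb]
  set x := Real.pi / n with hx
  have hs : 0 < Real.sin x := by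
    have hn' : (5 : ℝ) ≤ n := by exact_mod_cast hn
    have hpi := Real.pi_pos
    apply Real.sin_pos_of_pos_of_lt_pi (by positivity)
    rw [hx, div_lt_iff₀ (by linarith)]
    nlinarith
  push_cast at h ⊢
  have e1 : (k' * (2 * x) - j * (2 * x) : ℝ) = (2 * (k' - j) - 1) * x + x := by ring
  have e2 : ((j + 1) * (2 * x) - k' * (2 * x) : ℝ) = x - (2 * (k' - j) - 1) * x := by ring
  rw [e1, e2, Real.sin_add, Real.sin_sub, Real.sin_two_mul]
  nlinarith

lemma exists_angle_of_mem_triangle (hn : 5 ≤ n) {j : ℕ} {z : ℂ}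
    (hz : z ∈ triangle (vertex n j) (vertex n (j + 1))) :
    z ≠ 0 ∧ ∃ x : ℝ, j * centralAngle n ≤ x ∧ x < (j + 1) * centralAngle n ∧
      z = ‖z‖ * Complex.exp (x * Complex.I) := by
  obtain ⟨h1, h2, -⟩ := hz
  have hz0 : z ≠ 0 := by
    rintro rfl
    simp [cross] at h2
  refine ⟨hz0, ?_⟩
  set b := centralAngle n
  set y := Complex.arg (z * Complex.exp (-(j * b : ℝ) * Complex.I)) with hy
  have hzy : z = ‖z‖ * Complex.exp ((j * b + y : ℝ) * Complex.I) := by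
    have h := Complex.norm_mul_exp_arg_mul_I (z * Complex.exp (-(j * b : ℝ) * Complex.I))
    rw [← hy, norm_mul, ← Complex.ofReal_neg, Complex.norm_exp_ofReal_mul_I, mul_one] at h
    rw [Complex.ofReal_add, add_mul, Complex.exp_add, mul_left_comm, h, mul_comm, mul_assoc,
      ← Complex.exp_add]
    simp
  have hpos : 0 < circumradius n * ‖z‖ := mul_pos (circumradius_pos hn) (norm_pos_iff.2 hz0)
  rw [hzy, vertex_eq, cross_exp] at h1
  rw [hzy, vertex_eq, cross_exp] at h2
  have hs1 : 0 ≤ Real.sin y := by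
    have : (j * b + y - j * b : ℝ) = y := by ring
    rw [this] at h1
    exact nonneg_of_mul_nonneg_right h1 hpos
  have hs2 : 0 < Real.sin (b - y) := by
    have : (((j + 1 : ℕ) : ℝ) * b - (j * b + y) : ℝ) = b - y := by push_cast; ring
    rw [this, mul_comm ‖z‖] at h2
    exact (pos_iff_pos_of_mul_pos h2).1 hpos
  have hb0 : 0 < b := centralAngle_pos hn
  have hb1 : b < Real.pi / 2 := centralAngle_lt hn
  have hy1 : -Real.pi < y := Complex.neg_pi_lt_arg _
  have hy2 : y ≤ Real.pi := Complex.arg_le_pi _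
  have hy0 : 0 ≤ y := by
    by_contra! h
    exact absurd (Real.sin_neg_of_neg_of_neg_pi_lt h hy1) (by linarith)
  have hyb : y < b := by
    by_contra! h
    exact absurd (Real.sin_nonpos_of_nonpos_of_neg_pi_le (x := b - y) (by linarith)
      (by linarith)) (by linarith)
  exact ⟨j * b + y, by linarith, by linarith, hzy⟩

lemma triangle_disjoint (hn : 5 ≤ n) :
    Set.PairwiseDisjoint (Finset.range n : Set ℕ)
      fun j => triangle (vertex n j) (vertex n (j + 1)) := by
  intro j hj k hk hjk
  refine Set.disjoint_left.2 fun z hzj hzk => hjk ?_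
  have hj' : (j : ℝ) + 1 ≤ n := by exact_mod_cast Finset.mem_range.1 hj
  have hk' : (k : ℝ) + 1 ≤ n := by exact_mod_cast Finset.mem_range.1 hk
  obtain ⟨hz0, x, hx1, hx2, hx⟩ := exists_angle_of_mem_triangle hn hzj
  obtain ⟨-, y, hy1, hy2, hy⟩ := exists_angle_of_mem_triangle hn hzk
  have hz : (‖z‖ : ℂ) ≠ 0 := by simpa using hz0
  have hb := centralAngle_pos hn
  have hnb := n_mul_centralAngle hn
  have hj0 : (0 : ℝ) ≤ j := by positivity
  have hk0 : (0 : ℝ) ≤ k := by positivity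
  have hxy : x = y := by
    refine eq_of_exp_eq_of_abs_sub_lt (mul_left_cancel₀ hz (hx.symm.trans hy)) ?_
    rw [abs_lt]
    constructor <;> nlinarith
  subst hxy
  have h1 : (j : ℝ) < k + 1 := lt_of_mul_lt_mul_right (hx1.trans_lt hy2) hb.le
  have h2 : (k : ℝ) < j + 1 := lt_of_mul_lt_mul_right (hy1.trans_lt hx2) hb.le
  have h1' : j < k + 1 := by exact_mod_cast h1
  have h2' : k < j + 1 := by exact_mod_cast h2
  omega

lemma polygon_diff_zero (hn : 5 ≤ n) :
    polygon n \ {0} = ⋃ j ∈ Finset.range n, triangle (vertex n j) (vertex n (j + 1)) := by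
  have hb := centralAngle_pos hn
  have hnb := n_mul_centralAngle hn
  have hb1 := centralAngle_lt hn
  ext z
  simp only [Set.mem_sdiff, Set.mem_singleton_iff, Set.mem_iUnion, Finset.mem_range, exists_prop]
  constructor
  · rintro ⟨hz, hz0⟩
    obtain ⟨x, hx0, hx1, hx⟩ : ∃ x : ℝ, 0 ≤ x ∧ x < 2 * Real.pi ∧
        z = ‖z‖ * Complex.exp (x * Complex.I) := by
      rcases le_or_gt 0 (Complex.arg z) with h | h
      · exact ⟨Complex.arg z, h, by linarith [Complex.arg_le_pi z, Real.pi_pos],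
          (Complex.norm_mul_exp_arg_mul_I z).symm⟩
      · refine ⟨Complex.arg z + 2 * Real.pi,
          by linarith [Complex.neg_pi_lt_arg z, Real.pi_pos], by linarith, ?_⟩
        push_cast
        rw [add_mul, Complex.exp_add, Complex.exp_two_pi_mul_I, mul_one,
          Complex.norm_mul_exp_arg_mul_I]
    set j := ⌊x / centralAngle n⌋₊ with hj
    have hj1 : j * centralAngle n ≤ x :=
      (le_div_iff₀ hb).1 (Nat.floor_le (by positivity))
    have hj2 : x < (j + 1) * centralAngle n := (div_lt_iff₀ hb).1 (Nat.lt_floor_add_one _)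
    have hjn : j < n := by
      have : (j : ℝ) < n := by
        by_contra! h
        nlinarith
      exact_mod_cast this
    refine ⟨j, hjn, ?_, ?_, polygon_subset_halfPlane hn hjn hz⟩
    · rw [hx, vertex_eq, cross_exp]
      have := Real.sin_nonneg_of_nonneg_of_le_pi (x := x - j * centralAngle n) (by linarith)
        (by linarith [Real.pi_pos])
      have := circumradius_pos hn
      positivity
    · rw [hx, vertex_eq, cross_exp]
      have := Real.sin_pos_of_pos_of_lt_pi (x := ((j + 1 : ℕ) : ℝ) * centralAngle n - x)
        (by push_cast; linarith) (by push_cast; linarith [Real.pi_pos])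
      have := circumradius_pos hn
      have := norm_pos_iff.2 hz0
      positivity
  · rintro ⟨j, hj, hz⟩
    refine ⟨?_, (exists_angle_of_mem_triangle hn hz).1⟩
    rw [← coneMap_image (cross_vertex_succ_pos hn j)] at hz
    obtain ⟨p, hp, rfl⟩ := hz
    exact coneMap_mem_polygon hn j ⟨⟨hp.1.1.le, hp.2.1⟩, ⟨hp.1.2, hp.2.2.le⟩⟩

lemma integrableOn_curl (hn : 5 ≤ n) {α : ℂ → ℂ →L[ℝ] ℝ}
    (hα : ∀ z ∈ polygon n, ContDiffAt ℝ 1 α z) :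
    MeasureTheory.IntegrableOn (curl α) (polygon n) :=
  ContinuousOn.integrableOn_compact (isCompact_polygon hn)
    fun z hz => (continuousAt_curl (hα z hz)).continuousWithinAt

/-- Stokes' theorem on the polygon. In the sum of Stokes' theorems for the triangles spanned by
the centre and the edges, the integrals along the radii cancel. -/
theorem stokes_polygon (hn : 5 ≤ n) {α : ℂ → ℂ →L[ℝ] ℝ}
    (hα : ∀ z ∈ polygon n, ContDiffAt ℝ 1 α z) :
    ∫ z in polygon n, curl α z = ∑ j ∈ Finset.range n,
      ∫ t in (0 : ℝ)..1, α (vertex n j + t * (vertex n (j + 1) - vertex n j))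
        (vertex n (j + 1) - vertex n j) := by
  have hae : (polygon n \ {0} : Set ℂ) =ᵐ[MeasureTheory.volume] polygon n :=
    MeasureTheory.sdiff_null_ae_eq_self (by simp)
  have hint := (integrableOn_curl hn hα).mono_set (Set.sdiff_subset (t := {0}))
  rw [← MeasureTheory.setIntegral_congr_set hae, polygon_diff_zero hn,
    MeasureTheory.integral_biUnion_finset _ (fun j _ => measurableSet_triangle _ _)
      (triangle_disjoint hn)]
  · set G : ℕ → ℝ := fun j => ∫ s in (0 : ℝ)..1, α (s * vertex n j) (vertex n j) with hG
    have hn0 : G n = G 0 := by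
      have := vertex_add_self hn 0
      rw [zero_add] at this
      simp only [hG, this]
    have ht : ∑ j ∈ Finset.range n, (G (j + 1) - G j) = 0 := by
      rw [Finset.sum_range_sub, hn0, sub_self]
    have e : ∀ j ∈ Finset.range n, ∫ z in triangle (vertex n j) (vertex n (j + 1)), curl α z =
        (∫ t in (0 : ℝ)..1, α (vertex n j + t * (vertex n (j + 1) - vertex n j))
          (vertex n (j + 1) - vertex n j)) - (G (j + 1) - G j) := fun j _ => by
      rw [stokes_triangle (cross_vertex_succ_pos hn j)
        fun p hp => hα _ (coneMap_mem_polygon hn j hp)]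
      simp only [hG]
      ring
    rw [Finset.sum_congr rfl e, Finset.sum_sub_distrib, ht, sub_zero]
  · intro j hj
    refine hint.mono_set ?_
    rw [polygon_diff_zero hn]
    exact Set.subset_biUnion_of_mem (u := fun j => triangle (vertex n j) (vertex n (j + 1))) hj

end

/-! ### A primitive of the Kähler form -/

/-- The hermitian form as a continuous real bilinear map. -/
def hermBilin : V →L[ℝ] V →L[ℝ] ℂ :=
  (LinearMap.mk₂ ℝ herm herm_add_left
    (fun c x y => by simp [herm]; ring)
    (fun x y z => by simp [herm]; ring)
    (fun c x y => by simp [herm]; ring)).toContinuousBilinearMap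

lemma HasDerivAt.herm {f g : ℝ → V} {f' g' : V} {t : ℝ} (hf : HasDerivAt f f' t)
    (hg : HasDerivAt g g' t) :
    HasDerivAt (fun t => herm (f t) (g t)) (herm f' (g t) + herm (f t) g') t := by
  have := hermBilin.hasDerivAt_of_bilinear (fun _ => hf) (fun _ => hg)
  rw [add_comm] at this
  exact this

lemma ContDiffAt.herm {E : Type*} [NormedAddCommGroup E] [NormedSpace ℝ E] {k : WithTop ℕ∞}
    {f g : E → V} {x : E} (hf : ContDiffAt ℝ k f x) (hg : ContDiffAt ℝ k g x) :
    ContDiffAt ℝ k (fun x => herm (f x) (g x)) x :=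
  (hermBilin.contDiff.contDiffAt.comp x hf).clm_apply hg

/-- The pullback under `φ` of the `1`-form on negative vectors given by
`x ↦ Im (⟨x, p⟩ / ⟨p, p⟩ - ⟨x, c⟩ / ⟨p, c⟩)` at the point `p`. This form descends to the complex
hyperbolic plane, and its exterior derivative is twice the Kähler form. -/
def primitive (c : V) (φ : ℂ → V) (z : ℂ) : ℂ →L[ℝ] ℝ :=
  Complex.imCLM.comp (((ContinuousLinearMap.mul ℝ ℂ (herm (φ z) (φ z))⁻¹).comp
    ((hermBilin.flip (φ z)).comp (fderiv ℝ φ z))) -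
    ((ContinuousLinearMap.mul ℝ ℂ (herm (φ z) c)⁻¹).comp
    ((hermBilin.flip c).comp (fderiv ℝ φ z))))

lemma primitive_apply (c : V) (φ : ℂ → V) (z w : ℂ) :
    primitive c φ z w = (herm (fderiv ℝ φ z w) (φ z) / herm (φ z) (φ z) -
      herm (fderiv ℝ φ z w) c / herm (φ z) c).im := by
  rw [div_eq_inv_mul, div_eq_inv_mul]
  rfl

lemma contDiffAt_primitive {c : V} (hc : hnorm c < 0) {φ : ℂ → V} {z : ℂ}
    (hφ : ContDiffAt ℝ ∞ φ z) (hz : hnorm (φ z) < 0) : ContDiffAt ℝ 1 (primitive c φ) z := by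
  have h1 : ContDiffAt ℝ 1 φ z := hφ.of_le (by exact_mod_cast le_top)
  have h2 : ContDiffAt ℝ 1 (fderiv ℝ φ) z := hφ.fderiv_right (by norm_cast)
  have i1 := (ContDiffAt.herm h1 h1).inv (herm_ne_zero hz hz)
  have i2 := (ContDiffAt.herm h1 (contDiffAt_const (c := c))).inv (herm_ne_zero hz hc)
  have j1 := (ContinuousLinearMap.mul ℝ ℂ).contDiff.contDiffAt.comp z i1
  have j2 := (ContinuousLinearMap.mul ℝ ℂ).contDiff.contDiffAt.comp z i2
  have k := hermBilin.flip.contDiff.contDiffAt.comp z h1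
  exact contDiffAt_const.clm_comp ((j1.clm_comp (k.clm_comp h2)).sub
    (j2.clm_comp (contDiffAt_const.clm_comp h2)))

lemma kahler_eq {p : V} (hp : herm p p ≠ 0) (x y : V) :
    kahler p x y = (-(herm x y - herm x p * herm p y / herm p p) / herm p p).im := by
  have hc : conj (herm p p) = herm p p := herm_conj p p
  rw [kahler]
  congr 1
  simp only [herm_smul_left, herm_smul_right, herm_sub_left, herm_sub_right, map_inv₀, map_div₀,
    herm_conj, hc]
  field_simp
  ring

lemma curl_primitive {c : V} (hc : hnorm c < 0) {φ : ℂ → V} {z : ℂ}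
    (hφ : ContDiffAt ℝ ∞ φ z) (hz : hnorm (φ z) < 0) :
    curl (primitive c φ) z = 2 * pullbackKahler φ z := by
  have hα : HasFDerivAt (primitive c φ) (fderiv ℝ (primitive c φ) z) z :=
    ((contDiffAt_primitive hc hφ hz).differentiableAt one_ne_zero).hasFDerivAt
  have h1 : HasFDerivAt φ (fderiv ℝ φ z) z := (hφ.differentiableAt (by simp)).hasFDerivAt
  have h2 : HasFDerivAt (fderiv ℝ φ) (fderiv ℝ (fderiv ℝ φ) z) z :=
    ((hφ.fderiv_right (m := 1) (by norm_cast)).differentiableAt one_ne_zero).hasFDerivAt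
  have hpp := herm_ne_zero hz hz
  have hpc := herm_ne_zero hz hc
  have D : ∀ h w : ℂ, fderiv ℝ (primitive c φ) z h w =
      (((herm (fderiv ℝ (fderiv ℝ φ) z h w) (φ z) + herm (fderiv ℝ φ z w) (fderiv ℝ φ z h))
        * herm (φ z) (φ z) - herm (fderiv ℝ φ z w) (φ z) *
          (herm (fderiv ℝ φ z h) (φ z) + herm (φ z) (fderiv ℝ φ z h))) / herm (φ z) (φ z) ^ 2
      - (herm (fderiv ℝ (fderiv ℝ φ) z h w) c * herm (φ z) c - herm (fderiv ℝ φ z w) c *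
          herm (fderiv ℝ φ z h) c) / herm (φ z) c ^ 2).im := by
    intro h w
    generalize hAz : fderiv ℝ (primitive c φ) z = A at hα
    generalize hBz : fderiv ℝ φ z = B at h1
    generalize hCz : fderiv ℝ (fderiv ℝ φ) z = C at h2
    have hl : HasDerivAt (fun t : ℝ => z + t • h) h 0 := by
      simpa using ((hasDerivAt_id (0 : ℝ)).smul_const h).const_add z
    have e0 : z + (0 : ℝ) • h = z := by simp
    have a1 : HasDerivAt (fun t : ℝ => primitive c φ (z + t • h))
        (A h) 0 := by
      rw [← e0] at hα
      exact hα.comp_hasDerivAt 0 hl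
    have b1 : HasDerivAt (fun t : ℝ => φ (z + t • h)) (B h) 0 := by
      rw [← e0] at h1
      exact h1.comp_hasDerivAt 0 hl
    have c1 : HasDerivAt (fun t : ℝ => fderiv ℝ φ (z + t • h))
        (C h) 0 := by
      rw [← e0] at h2
      exact h2.comp_hasDerivAt 0 hl
    have a2 := a1.clm_apply (hasDerivAt_const (0 : ℝ) w)
    have c2 := c1.clm_apply (hasDerivAt_const (0 : ℝ) w)
    simp only [map_zero, add_zero] at a2 c2
    have hc' := hasDerivAt_const (0 : ℝ) c
    have d1 := (HasDerivAt.herm c2 b1).fun_div (HasDerivAt.herm b1 b1) (by simpa using hpp)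
    have d2 := (HasDerivAt.herm c2 hc').fun_div (HasDerivAt.herm b1 hc') (by simpa using hpc)
    have d3 := Complex.imCLM.hasFDerivAt.comp_hasDerivAt (0 : ℝ) (d1.sub d2)
    have hz0 : ∀ x : V, herm x 0 = 0 := fun x => by simp [herm]
    simp only [zero_smul, add_zero, hz0, hBz] at d3
    exact a2.unique (d3.congr_of_eventuallyEq
      (Filter.Eventually.of_forall fun t => primitive_apply c φ _ w))
  have hsymm : fderiv ℝ (fderiv ℝ φ) z 1 Complex.I = fderiv ℝ (fderiv ℝ φ) z Complex.I 1 :=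
    (hφ.isSymmSndFDerivAt
      (by simpa using WithTop.coe_le_coe.2 (le_top : (2 : ℕ∞) ≤ ⊤))) 1 Complex.I
  rw [curl, D, D, hsymm, pullbackKahler, kahler_eq hpp, ← Complex.sub_im]
  set p := φ z
  set x := fderiv ℝ φ z 1
  set y := fderiv ℝ φ z Complex.I
  have hcpp : conj (herm p p) = herm p p := herm_conj p p
  set X := -(herm x y - herm x p * herm p y / herm p p) / herm p p with hX
  have hconj : conj X = -(herm y x - herm p x * herm y p / herm p p) / herm p p := by
    simp only [hX, map_div₀, map_neg, map_sub, map_mul, herm_conj]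
  have h2im : ((2 : ℝ) * X.im : ℝ) = (X - conj X).im := by
    simp; ring
  rw [h2im, hconj, hX]
  congr 1
  field_simp
  ring

/-! ### The integral of the primitive along an edge -/

lemma continuousOn_herm {f g : ℝ → V} {s : Set ℝ} (hf : ContinuousOn f s)
    (hg : ContinuousOn g s) : ContinuousOn (fun t => herm (f t) (g t)) s := by
  have h : ∀ i, ContinuousOn (fun t => f t i) s := fun i => continuousOn_pi.1 hf i
  have h' : ∀ i, ContinuousOn (fun t => conj (g t i)) s := fun i =>
    Complex.continuous_conj.comp_continuousOn (continuousOn_pi.1 hg i)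
  unfold herm
  exact (((h 0).mul (h' 0)).neg.add ((h 1).mul (h' 1))).add ((h 2).mul (h' 2))

lemma herm_neg_right (x y : V) : herm x (-y) = -herm x y := by
  simp [herm]; ring

lemma herm_neg_left (x y : V) : herm (-x) y = -herm x y := by
  simp [herm]; ring

/-- The primitive with centre a point `a` fixed by `g` integrates to `0` along a path reversed by
`g`. -/
lemma integral_eq_zero_of_reversed {f f' : ℝ → V} {a : V} (g : U)
    (hf : ∀ s ∈ Set.Icc (0 : ℝ) 1, HasDerivAt f (f' s) s)
    (hneg : ∀ s ∈ Set.Icc (0 : ℝ) 1, hnorm (f s) < 0) (ha : hnorm a < 0)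
    (hga : g • a = -a)
    (hg : ∀ s ∈ Set.Icc (0 : ℝ) 1, ∃ μ : ℂ, f (1 - s) = μ • g • f s) :
    ∫ s in (0 : ℝ)..1, (herm (f' s) (f s) / herm (f s) (f s) - herm (f' s) a / herm (f s) a).im
      = 0 := by
  -- the lift of the path whose product with `a` is `1`
  set F : ℝ → V := fun s => (herm (f s) a)⁻¹ • f s with hF
  set F' : ℝ → V := fun s => (herm (f s) a)⁻¹ • f' s +
    (-herm (f' s) a / herm (f s) a ^ 2) • f s with hF'
  have hfa : ∀ s ∈ Set.Icc (0 : ℝ) 1, herm (f s) a ≠ 0 := fun s hs => herm_ne_zero (hneg s hs) ha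
  have hdF : ∀ s ∈ Set.Icc (0 : ℝ) 1, HasDerivAt F (F' s) s := by
    intro s hs
    have h1 := (HasDerivAt.herm (hf s hs) (hasDerivAt_const s a)).fun_inv (hfa s hs)
    have hz : herm (f s) 0 = 0 := by simp [herm]
    rw [hz, add_zero] at h1
    exact h1.fun_smul (hf s hs)
  have hrefl : ∀ {s : ℝ}, s ∈ Set.Icc (0 : ℝ) 1 → 1 - s ∈ Set.Icc (0 : ℝ) 1 := fun hs =>
    ⟨by linarith [hs.2], by linarith [hs.1]⟩
  have hFg : ∀ s ∈ Set.Icc (0 : ℝ) 1, F (1 - s) = -(g • F s) := by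
    intro s hs
    obtain ⟨μ, hμ⟩ := hg s hs
    have e : herm (f (1 - s)) a = -(μ * herm (f s) a) := by
      rw [hμ, herm_smul_left, ← herm_U g (f s) a, hga, herm_neg_right]
      ring
    have h1 := hfa s hs
    have h2 := hfa _ (hrefl hs)
    have hμ0 : μ ≠ 0 := by
      rintro rfl
      rw [e] at h2
      simp at h2
    simp only [hF, e]
    rw [hμ, smul_comm g, smul_smul, ← neg_smul]
    congr 1
    field_simp
  have hF'g : ∀ s ∈ Set.Ioo (0 : ℝ) 1, F' (1 - s) = g • F' s := by
    intro s hs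
    have hs' := Set.Ioo_subset_Icc_self hs
    have h1 := (hdF _ (hrefl hs')).scomp s ((hasDerivAt_id s).const_sub 1)
    have h2 := (((g : V ≃ₗ[ℂ] V).toLinearMap.toContinuousLinearMap.restrictScalars
      ℝ).hasFDerivAt.comp_hasDerivAt s (hdF s hs')).neg
    have h3 := h1.congr_of_eventuallyEq (f₁ := _) (by
      filter_upwards [isOpen_Ioo.mem_nhds hs] with r hr
      exact (hFg r (Set.Ioo_subset_Icc_self hr)).symm)
    have h4 := h2.unique h3
    simp only [neg_smul, one_smul, neg_inj] at h4
    exact h4.symm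
  set H : ℝ → ℝ := fun s =>
    (herm (f' s) (f s) / herm (f s) (f s) - herm (f' s) a / herm (f s) a).im with hH
  have hHF : ∀ s ∈ Set.Icc (0 : ℝ) 1, H s = (herm (F' s) (F s) / herm (F s) (F s)).im := by
    intro s hs
    have h1 := hfa s hs
    have h2 := herm_ne_zero (hneg s hs) (hneg s hs)
    have h3 : herm a (f s) ≠ 0 := herm_ne_zero ha (hneg s hs)
    simp only [hH, hF, hF', herm_smul_left, herm_smul_right, herm_add_left, map_inv₀, herm_conj]
    congr 1
    field_simp
    ring
  have hodd : ∀ s ∈ Set.Ioo (0 : ℝ) 1, H (1 - s) = -H s := by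
    intro s hs
    have hs' := Set.Ioo_subset_Icc_self hs
    rw [hHF s hs', hHF _ (hrefl hs'), hFg s hs', hF'g s hs, herm_neg_right, herm_neg_left,
      herm_neg_right, herm_U, herm_U, neg_neg, neg_div, Complex.neg_im]
  have h1 : ∫ s in (0 : ℝ)..1, H (1 - s) = ∫ s in (0 : ℝ)..1, H s := by
    simp [intervalIntegral.integral_comp_sub_left (a := 0) (b := 1) H 1]
  have h2 : ∫ s in (0 : ℝ)..1, H (1 - s) = ∫ s in (0 : ℝ)..1, -H s := by
    refine intervalIntegral.integral_congr_ae ?_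
    filter_upwards [MeasureTheory.Measure.ae_ne MeasureTheory.volume (1 : ℝ)] with s hs1 hs
    rw [Set.uIoc_of_le zero_le_one] at hs
    exact hodd s ⟨hs.1, lt_of_le_of_ne hs.2 hs1⟩
  rw [intervalIntegral.integral_neg, h1] at h2
  linarith

/-- Along a path reversed by `g`, the integral of the primitive with centre `c` is the variation of the
angular invariant with respect to `c` and a point `a` fixed by `g`. -/
lemma integral_primitive_edge {f f' : ℝ → V} {a c : V} (g : U)
    (hf : ∀ s ∈ Set.Icc (0 : ℝ) 1, HasDerivAt f (f' s) s)
    (hf' : ContinuousOn f' (Set.Icc 0 1))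
    (hneg : ∀ s ∈ Set.Icc (0 : ℝ) 1, hnorm (f s) < 0) (ha : hnorm a < 0) (hc : hnorm c < 0)
    (hga : g • a = -a)
    (hg : ∀ s ∈ Set.Icc (0 : ℝ) 1, ∃ μ : ℂ, f (1 - s) = μ • g • f s) :
    ∫ s in (0 : ℝ)..1, (herm (f' s) (f s) / herm (f s) (f s) - herm (f' s) c / herm (f s) c).im
      = cartanArg (f 1) a c - cartanArg (f 0) a c := by
  have hz : ∀ x : V, herm x 0 = 0 ∧ herm 0 x = 0 := fun x => by simp [herm]
  set T : ℝ → ℂ := fun s => -(herm (f s) a * herm a c * herm c (f s))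
  set G : ℝ → ℝ := fun s => (herm (f' s) a / herm (f s) a - herm (f' s) c / herm (f s) c).im
  have hu : Set.uIcc (0 : ℝ) 1 = Set.Icc 0 1 := Set.uIcc_of_le zero_le_one
  have hdT : ∀ s ∈ Set.uIcc (0 : ℝ) 1, HasDerivAt (fun s => cartanArg (f s) a c) (G s) s := by
    intro s hs
    rw [hu] at hs
    have h1 := HasDerivAt.herm (hf s hs) (hasDerivAt_const s a)
    have h2 := HasDerivAt.herm (hasDerivAt_const s c) (hf s hs)
    simp only [hz, add_zero, zero_add] at h1 h2
    have hT : HasDerivAt T (-(herm (f' s) a * herm a c * herm c (f s) +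
        herm (f s) a * herm a c * herm c (f' s))) s :=
      ((h1.mul_const (herm a c)).fun_mul h2).fun_neg
    have hslit : T s ∈ Complex.slitPlane := by
      left
      simpa [T] using re_triple_neg (hneg s hs) ha hc
    have h3 := Complex.imCLM.hasFDerivAt.comp_hasDerivAt s (hT.clog_real hslit)
    have i1 := herm_ne_zero (hneg s hs) ha
    have i2 := herm_ne_zero ha hc
    have i3 := herm_ne_zero hc (hneg s hs)
    have e : -(herm (f' s) a * herm a c * herm c (f s) +
        herm (f s) a * herm a c * herm c (f' s)) / T s =
        herm (f' s) a / herm (f s) a + conj (herm (f' s) c / herm (f s) c) := by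
      simp only [T, map_div₀, herm_conj]
      field_simp
    rw [e] at h3
    refine (h3.congr_of_eventuallyEq (Filter.Eventually.of_forall fun r => ?_)).congr_deriv ?_
    · simp [cartanArg, T, Complex.log_im]
    · simp only [Complex.imCLM_apply, Complex.add_im, Complex.conj_im, Complex.sub_im, G]
      ring
  have hcf : ContinuousOn f (Set.Icc 0 1) := fun s hs =>
    (hf s hs).continuousAt.continuousWithinAt
  have hquot : ∀ b : V, hnorm b < 0 →
      ContinuousOn (fun s => herm (f' s) b / herm (f s) b) (Set.Icc 0 1) := fun b hb =>
    (continuousOn_herm hf' continuousOn_const).div (continuousOn_herm hcf continuousOn_const)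
      fun s hs => herm_ne_zero (hneg s hs) hb
  have hG : IntervalIntegrable G MeasureTheory.volume 0 1 := by
    apply ContinuousOn.intervalIntegrable
    rw [hu]
    exact Complex.continuous_im.comp_continuousOn ((hquot a ha).sub (hquot c hc))
  have hH : IntervalIntegrable (fun s => (herm (f' s) (f s) / herm (f s) (f s) -
      herm (f' s) a / herm (f s) a).im) MeasureTheory.volume 0 1 := by
    apply ContinuousOn.intervalIntegrable
    rw [hu]
    exact Complex.continuous_im.comp_continuousOn
      (((continuousOn_herm hf' hcf).div (continuousOn_herm hcf hcf)
        fun s hs => herm_ne_zero (hneg s hs) (hneg s hs)).sub (hquot a ha))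
  have h := intervalIntegral.integral_eq_sub_of_hasDerivAt hdT hG
  have h0 := integral_eq_zero_of_reversed g hf hneg ha hga hg
  rw [← h, ← zero_add (∫ s in (0 : ℝ)..1, G s)]
  refine Eq.trans ?_ (congrArg (· + ∫ s in (0 : ℝ)..1, G s) h0)
  rw [← intervalIntegral.integral_add hH hG]
  congr 1
  funext s
  simp [G]

/-! ### Equivariant maps along the edges -/

/-- The negative vector of the standard basis. -/
def q₁ : V := ![1, 0, 0]

lemma herm_q₁ (x : V) : herm x q₁ = -x 0 := by
  simp [herm, q₁]

lemma hnorm_q₁ : hnorm q₁ = -1 := by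
  simp [hnorm, herm, q₁]

lemma hnorm_q₁_neg : hnorm q₁ < 0 := by
  rw [hnorm_q₁]; norm_num

/-- The orthogonal projection of `q₁` to `m^⊥`: for positive `m`, a negative vector, representing a
point of the complex geodesic polar to `m`. -/
def foot (m : V) : V := q₁ - (herm q₁ m / herm m m) • m

lemma herm_foot {m : V} (hm : 0 < hnorm m) : herm (foot m) m = 0 := by
  have h : herm m m ≠ 0 := by rw [herm_self]; exact_mod_cast hm.ne'
  rw [foot, herm_sub_left, herm_smul_left]
  field_simp
  ring

lemma hnorm_foot_neg {m : V} (hm : 0 < hnorm m) : hnorm (foot m) < 0 := by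
  have h : herm (foot m) (foot m) = ((-1 - ‖herm q₁ m‖ ^ 2 / hnorm m : ℝ) : ℂ) := by
    have e : herm (foot m) (foot m) = herm (foot m) q₁ := by
      conv_lhs => rw [foot, herm_sub_right, herm_smul_right, ← foot, herm_foot hm]
      ring
    rw [e, foot, herm_sub_left, herm_smul_left, herm_self q₁, hnorm_q₁, herm_self m]
    have e2 := herm_mul_herm q₁ m
    push_cast at e2 ⊢
    rw [← e2]
    ring
  rw [hnorm, h, Complex.ofReal_re]
  have : 0 ≤ ‖herm q₁ m‖ ^ 2 / hnorm m := by positivity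
  linarith

lemma reflU_smul (m x : V) : reflU m • x = reflLin m x := rfl

lemma herm_reflU_smul (m p : V) :
    herm p (reflU m • p) = ((2 * (‖herm p m‖ ^ 2 / hnorm m) - hnorm p : ℝ) : ℂ) := by
  have e := herm_mul_herm p m
  rw [reflU_smul, reflLin_apply, herm_sub_right, herm_smul_right]
  simp only [map_mul, map_div₀, herm_conj, map_ofNat]
  rw [herm_self m, herm_self p]
  push_cast at e ⊢
  rw [← e]
  ring

lemma reflU_reflU (m x : V) : reflU m • reflU m • x = x := reflLin_involutive m x

lemma reflU_smul_foot {m : V} (hm : 0 < hnorm m) : reflU m • foot m = -foot m := by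
  rw [reflU_smul, reflLin_apply, herm_foot hm]
  simp

lemma reflU_U_smul (g : U) (m x : V) : reflU (g • m) • g • x = g • reflU m • x := by
  simp only [reflU_smul, reflLin_apply, herm_U, smul_sub, smul_comm g]

lemma reflPU_mk (m v : V) (hv : v ≠ 0) (h : reflU m • v ≠ 0) :
    (reflPU m : Equiv.Perm (ℙ ℂ V)) (Projectivization.mk ℂ v hv) =
      Projectivization.mk ℂ (reflU m • v) h := rfl

section
variable {n : ℕ}

lemma BisectorCycle.rep_r (C : BisectorCycle n) (j : Fin n) :
    C.rep (Hn.r j) = reflPU (C.m j) :=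
  PresentedGroup.toGroup.of _

lemma norm_vertex (n j : ℕ) : ‖vertex n j‖ = circumradius n := by
  rw [vertex_eq, norm_mul, Complex.norm_exp_ofReal_mul_I, mul_one, Complex.norm_real,
    Real.norm_of_nonneg (show 0 ≤ circumradius n from Real.sqrt_nonneg _)]

lemma circumradius_lt_one (hn : 5 ≤ n) : circumradius n < 1 := by
  have hn' : (5 : ℝ) ≤ n := by exact_mod_cast hn
  have hpi := Real.pi_pos
  have h1 : Real.pi / n < Real.pi / 2 := by gcongr; linarith
  have h3 : 0 < Real.tan (Real.pi / n) := Real.tan_pos_of_pos_of_lt_pi_div_two (by positivity) h1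
  rw [circumradius, Real.sqrt_lt' one_pos]
  have : 0 < Real.tan (Real.pi / n) ^ 4 := by positivity
  linarith

/-- In the Klein model, the half-turn about the middle point of an edge acts on the edge as the
euclidean reflection in that point. -/
lemma sideTurn_edge (hn : 5 ≤ n) (j : ℕ) (t : ℝ) :
    sideTurn n j (vertex n j + t * (vertex n (j + 1) - vertex n j)) =
      vertex n j + (1 - t : ℝ) * (vertex n (j + 1) - vertex n j) := by
  have h1 := norm_vertex n j
  have h2 := norm_vertex n (j + 1)
  have h3 := circumradius_lt_one hn
  have h4 := circumradius_pos hn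
  set v := vertex n j
  set w := vertex n (j + 1)
  have hmid : midpoint ℝ v w = (v + w) / 2 := by
    rw [midpoint_eq_smul_add]; simp; ring
  have hvw : v.re ^ 2 + v.im ^ 2 = w.re ^ 2 + w.im ^ 2 := by
    have e := congrArg (· ^ 2) (h1.trans h2.symm)
    simp only [Complex.sq_norm, Complex.normSq_apply] at e
    linarith
  have hne : lorentz (midpoint ℝ v w) (midpoint ℝ v w) ≠ 0 := by
    have h5 : ‖midpoint ℝ v w‖ < 1 := by
      rw [hmid, norm_div]
      have := norm_add_le v w
      rw [h1, h2] at this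
      simp
      linarith
    rw [lorentz, Complex.mul_conj, ← Complex.sq_norm, Complex.ofReal_re]
    nlinarith [norm_nonneg (midpoint ℝ v w)]
  have heq : lorentz (v + t * (w - v)) (midpoint ℝ v w) =
      lorentz (midpoint ℝ v w) (midpoint ℝ v w) := by
    have hre : ((v + w) / 2).re = (v.re + w.re) / 2 := by simp
    have him : ((v + w) / 2).im = (v.im + w.im) / 2 := by simp
    rw [hmid, lorentz, lorentz]
    simp only [Complex.mul_re, Complex.conj_re, Complex.conj_im, hre, him, Complex.add_re,
      Complex.add_im, Complex.sub_re, Complex.sub_im, Complex.mul_im, Complex.ofReal_re, Complex.ofReal_im]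
    linear_combination (1 / 4 - t / 2) * hvw
  rw [sideTurn, halfTurn, heq, div_self hne, hmid]
  push_cast
  norm_num
  ring

/-- The integral of the pullback of the Kähler form is half the sum of the variations, along the
edges, of the angular invariant with respect to the feet of the mirrors and `q₁`. -/
lemma integral_pullbackKahler (hn : 5 ≤ n) (C : BisectorCycle n)
    {φ : ℂ → V} (hφ : IsEquivariantMap C.rep φ)
    (a : Fin n → V) (ha : ∀ j, hnorm (a j) < 0) (hma : ∀ j, reflU (C.m j) • a j = -a j) :
    ∫ z in polygon n, pullbackKahler φ z = 1 / 2 * ∑ j : Fin n,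
      (cartanArg (φ (vertex n (j + 1))) (a j) q₁ - cartanArg (φ (vertex n j)) (a j) q₁) := by
  have hα : ∀ z ∈ polygon n, ContDiffAt ℝ 1 (primitive q₁ φ) z := fun z hz =>
    contDiffAt_primitive hnorm_q₁_neg (hφ.smooth z hz) (hφ.neg z hz)
  have h1 := stokes_polygon hn hα
  have h2 : ∫ z in polygon n, curl (primitive q₁ φ) z =
      2 * ∫ z in polygon n, pullbackKahler φ z := by
    rw [← MeasureTheory.integral_const_mul]
    exact MeasureTheory.setIntegral_congr_fun (isCompact_polygon hn).measurableSet
      fun z hz => curl_primitive hnorm_q₁_neg (hφ.smooth z hz) (hφ.neg z hz)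
  rw [h2, Finset.sum_range] at h1
  have h3 : ∀ j : Fin n, (∫ t in (0 : ℝ)..1,
      primitive q₁ φ (vertex n j + t * (vertex n (j + 1) - vertex n j))
        (vertex n (j + 1) - vertex n j)) =
      cartanArg (φ (vertex n (j + 1))) (a j) q₁ - cartanArg (φ (vertex n j)) (a j) q₁ := by
    intro j
    set v := vertex n j with hv
    set d := vertex n (j + 1) - v with hd
    have hmem : ∀ t ∈ Set.Icc (0 : ℝ) 1, v + t * d ∈ polygon n := fun t ht =>
      edge_mem_polygon n j ht
    have hline : ∀ t : ℝ, HasDerivAt (fun t : ℝ => v + t * d) d t := fun t => by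
      simpa using ((hasDerivAt_id t).ofReal_comp.mul_const d).const_add v
    have hcont : ContinuousOn (fun t : ℝ => fderiv ℝ φ (v + t * d) d) (Set.Icc 0 1) := by
      intro t ht
      have c1 : ContinuousAt (fderiv ℝ φ) (v + t * d) :=
        ((hφ.smooth _ (hmem t ht)).fderiv_right (m := 0) (by norm_cast)).continuousAt
      have c2 : ContinuousAt (fun t : ℝ => fderiv ℝ φ (v + t * d)) t :=
        ContinuousAt.comp (f := fun t : ℝ => v + t * d) c1 (hline t).continuousAt
      exact (c2.clm_apply continuousAt_const).continuousWithinAt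
    have key := integral_primitive_edge (f := fun t : ℝ => φ (v + t * d))
      (f' := fun t => fderiv ℝ φ (v + t * d) d) (a := a j) (c := q₁) (reflU (C.m j))
      (fun t ht => ((hφ.smooth _ (hmem t ht)).differentiableAt
        (by simp)).hasFDerivAt.comp_hasDerivAt t (hline t)) hcont
      (fun t ht => hφ.neg _ (hmem t ht)) (ha j) hnorm_q₁_neg (hma j) (by
        intro t ht
        have hturn := sideTurn_edge hn j t
        have ht' : 1 - t ∈ Set.Icc (0 : ℝ) 1 := ⟨by linarith [ht.2], by linarith [ht.1]⟩
        have hx0 := ne_zero_of_hnorm_neg (hφ.neg _ (hmem t ht))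
        have hy0 := ne_zero_of_hnorm_neg (hφ.neg _ (hmem _ ht'))
        have hedge : v + t * d ∈ edge n j := by
          rw [edge, segment_eq_image']
          exact ⟨t, ht, by simp [hd, hv]⟩
        rw [← hv, ← hd] at hturn
        have heq := hφ.equivariant j _ hedge hx0 (by rw [hturn]; exact hy0)
        have hR0 : reflU (C.m j) • φ (v + t * d) ≠ 0 := by
          apply ne_zero_of_hnorm_neg
          rw [hnorm_U]
          exact hφ.neg _ (hmem t ht)
        rw [C.rep_r, reflPU_mk _ _ _ hR0, eq_comm, Projectivization.mk_eq_mk_iff'] at heq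
        obtain ⟨μ, hμ⟩ := heq
        rw [hturn] at hμ
        exact ⟨μ, hμ.symm⟩)
    simp only [primitive_apply]
    rw [key]
    simp [hd]
  rw [Finset.sum_congr rfl fun j _ => h3 j] at h1
  linarith

/-! ### The value of the Toledo invariant -/

/-- Consider the representation whose generators map to the conjugates `T^j R(m) T^{-j}` of a
reflection. The values at the vertices of the polygon of an arbitrary equivariant map are compared,
by means of the cocycle identity, with the orbit of `X` under `T`: the differences telescope. -/
lemma integral_pullbackKahler_eq (hn : 5 ≤ n) (C : BisectorCycle n) {m X : V} {T : U} {c : ℂ}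
    {θ : ℝ} (hT : T • q₁ = q₁) (hTn : T ^ n = 1) (hm : 0 < hnorm m)
    (hC : ∀ j, C.m j = T ^ (j : ℕ) • m) (hX : hnorm X < 0) (hc : reflU m • T • X = c • X)
    (hθ : Complex.exp (θ * Complex.I) = -c) (hθ0 : -Real.pi ≤ θ) (hθ1 : θ < Real.pi)
    {φ : ℂ → V} (hφ : IsEquivariantMap C.rep φ) :
    ∫ z in polygon n, pullbackKahler φ z = n * θ / 2 := by
  have hTq : ∀ j : ℕ, T ^ j • q₁ = q₁ := by
    intro j
    induction j with
    | zero => simp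
    | succ j ih => rw [pow_succ, mul_smul, hT, ih]
  have hc0 : c ≠ 0 := by
    rintro rfl
    rw [zero_smul] at hc
    have : hnorm (reflU m • T • X) < 0 := by rwa [hnorm_U, hnorm_U]
    rw [hc] at this
    simp [hnorm, herm] at this
  have hRX : reflU m • X = c⁻¹ • T • X := by
    rw [← reflU_reflU m (T • X), hc, smul_comm (reflU m), smul_smul, inv_mul_cancel₀ hc0, one_smul]
  set b := foot m with hb
  have hbneg : hnorm b < 0 := hnorm_foot_neg hm
  set a : ℕ → V := fun j => T ^ j • b with ha
  have haneg : ∀ j, hnorm (a j) < 0 := fun j => by simp only [ha]; rwa [hnorm_U]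
  have hma : ∀ j : Fin n, reflU (C.m j) • a j = -a j := fun j => by
    simp only [ha]
    rw [hC, reflU_U_smul, hb, reflU_smul_foot hm, smul_neg]
  rw [integral_pullbackKahler hn C hφ (fun j => a j) (fun j => haneg j) hma]
  -- the comparison points
  set y : ℕ → V := fun j => T ^ j • X with hy
  have hyneg : ∀ j, hnorm (y j) < 0 := fun j => by simp only [hy]; rwa [hnorm_U]
  set x : ℕ → V := fun j => φ (vertex n j) with hx
  have hxneg : ∀ j, hnorm (x j) < 0 := fun j => hφ.neg _ (vertex_mem_polygon n j)
  have hy1 : ∀ j, y (j + 1) = T ^ j • T • X := fun j => by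
    simp only [hy]; rw [pow_succ, mul_smul]
  have hRy : ∀ j : Fin n, reflU (C.m j) • y j = c⁻¹ • y (j + 1) := fun j => by
    rw [hy1, hC, hy]
    simp only
    rw [reflU_U_smul, hRX, smul_comm (T ^ (j : ℕ))]
  have hRx : ∀ j : Fin n, ∃ μ : ℂ, μ ≠ 0 ∧ x (j + 1) = μ • reflU (C.m j) • x j := by
    intro j
    have hturn := sideTurn_edge hn j 0
    simp only [Complex.ofReal_zero, zero_mul, add_zero, sub_zero, Complex.ofReal_one, one_mul,
      add_sub_cancel] at hturn
    have hx0 := ne_zero_of_hnorm_neg (hxneg j)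
    have hy0 := ne_zero_of_hnorm_neg (hxneg (j + 1))
    have heq := hφ.equivariant j (vertex n j) (left_mem_segment ℝ _ _) hx0
      (by rw [hturn]; exact hy0)
    have hR0 : reflU (C.m j) • x j ≠ 0 := by
      apply ne_zero_of_hnorm_neg
      rw [hnorm_U]
      exact hxneg j
    rw [C.rep_r, reflPU_mk _ _ _ hR0, eq_comm, Projectivization.mk_eq_mk_iff'] at heq
    obtain ⟨μ, hμ⟩ := heq
    rw [hturn] at hμ
    refine ⟨μ, ?_, hμ.symm⟩
    rintro rfl
    rw [zero_smul] at hμ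
    exact hy0 hμ.symm
  -- each edge contributes `θ` to the sum for the comparison points
  have hyval : ∀ j : ℕ, cartanArg (y (j + 1)) (a j) q₁ - cartanArg (y j) (a j) q₁ = θ := by
    intro j
    have e1 : cartanArg (y (j + 1)) (a j) q₁ = cartanArg (T • X) b q₁ := by
      rw [hy1, ← cartanArg_U (T ^ j) (T • X) b q₁, hTq]
    have e2 : cartanArg (y j) (a j) q₁ = cartanArg X b q₁ := by
      rw [← cartanArg_U (T ^ j) X b q₁, hTq]
    rw [e1, e2]
    have hTX : hnorm (T • X) < 0 := by rwa [hnorm_U]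
    have b1 := abs_lt.1 (abs_cartanArg_lt hTX hbneg hnorm_q₁_neg)
    have b2 := abs_lt.1 (abs_cartanArg_lt hX hbneg hnorm_q₁_neg)
    suffices h : cartanArg (T • X) b q₁ = cartanArg X b q₁ + θ by linarith
    have htr : herm (T • X) b * herm b q₁ * herm q₁ (T • X) =
        -c * (herm X b * herm b q₁ * herm q₁ X) := by
      have h1 : herm (T • X) b = -(c * herm X b) := by
        rw [← herm_U (reflU m), hc, hb, reflU_smul_foot hm, herm_smul_left, herm_neg_right]
        ring
      have h2 : herm q₁ (T • X) = herm q₁ X := by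
        rw [← herm_U T q₁ X, hT]
      rw [h1, h2]
      ring
    have n1 := norm_mul_exp_cartanArg (T • X) b q₁
    have n2 := norm_mul_exp_cartanArg X b q₁
    have hcn : ‖c‖ = 1 := by
      rw [← norm_neg, ← hθ, Complex.norm_exp_ofReal_mul_I]
    rw [htr, norm_mul, norm_neg, hcn, one_mul] at n1
    have hne : (‖herm X b * herm b q₁ * herm q₁ X‖ : ℂ) ≠ 0 := by
      have := mul_ne_zero (mul_ne_zero (herm_ne_zero hX hbneg)
        (herm_ne_zero hbneg hnorm_q₁_neg)) (herm_ne_zero hnorm_q₁_neg hX)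
      exact_mod_cast norm_ne_zero_iff.2 this
    apply eq_of_exp_eq_of_abs_sub_lt
    · apply mul_left_cancel₀ hne
      push_cast
      rw [n1, add_mul, Complex.exp_add, hθ]
      linear_combination c * n2
    · rw [abs_lt]
      constructor <;> linarith
  have hdiff : ∀ j : Fin n, cartanArg (x (j + 1)) (a j) q₁ - cartanArg (x j) (a j) q₁ =
      θ + (cartanArg (x (j + 1)) (y (j + 1)) q₁ - cartanArg (x j) (y j) q₁) := by
    intro j
    have c1 := cartanArg_cocycle (hxneg (j + 1)) (hyneg (j + 1)) (haneg j) hnorm_q₁_neg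
    have c2 := cartanArg_cocycle (hxneg j) (hyneg j) (haneg j) hnorm_q₁_neg
    have c3 : cartanArg (x (j + 1)) (y (j + 1)) (a j) = cartanArg (x j) (y j) (a j) := by
      obtain ⟨μ, hμ0, hμ⟩ := hRx j
      have hy' : y (j + 1) = c • reflU (C.m j) • y j := by
        rw [hRy, smul_smul, mul_inv_cancel₀ hc0, one_smul]
      have ha' : a j = (-1 : ℂ) • reflU (C.m j) • a j := by
        rw [hma, smul_neg, neg_smul, one_smul, neg_neg]
      rw [hμ, hy', cartanArg_smul_left hμ0, cartanArg_smul_mid hc0]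
      conv_lhs => rw [ha']
      rw [cartanArg_smul_right (by norm_num), cartanArg_U]
    have c4 := hyval j
    linarith
  have hend : cartanArg (x n) (y n) q₁ = cartanArg (x 0) (y 0) q₁ := by
    have h1 : x n = x 0 := by
      have := vertex_add_self hn 0
      rw [zero_add] at this
      simp only [hx, this]
    have h2 : y n = y 0 := by
      simp only [hy, hTn, pow_zero]
    rw [h1, h2]
  have hsum : ∑ j : Fin n, (cartanArg (x (j + 1)) (a j) q₁ - cartanArg (x j) (a j) q₁) =
      n * θ := by
    rw [Finset.sum_congr rfl fun j _ => hdiff j, Finset.sum_add_distrib,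
      ← Finset.sum_range fun j => cartanArg (x (j + 1)) (y (j + 1)) q₁ - cartanArg (x j) (y j) q₁,
      Finset.sum_range_sub (fun j => cartanArg (x j) (y j) q₁), hend]
    simp
  rw [hsum]
  ring

end

/-! ### Construction of an equivariant map -/

lemma U_smul_apply_zero {T : U} (hT : T • q₁ = q₁) (x : V) : (T • x) 0 = x 0 := by
  have h := herm_U T x q₁
  rw [hT, herm_q₁, herm_q₁] at h
  exact neg_inj.1 h

lemma zpow_smul_q₁ {T : U} (hT : T • q₁ = q₁) (k : ℤ) : T ^ k • q₁ = q₁ := by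
  have h : T ∈ MulAction.stabilizer U q₁ := hT
  exact zpow_mem h k

lemma contDiff_U_smul (T : U) : ContDiff ℝ ∞ fun x : V => T • x :=
  (((T : V ≃ₗ[ℂ] V).toLinearMap.toContinuousLinearMap.restrictScalars ℝ) : V →L[ℝ] V).contDiff

lemma contDiff_apply_zero : ContDiff ℝ ∞ fun x : V => x 0 :=
  contDiff_apply ℝ ℂ (0 : Fin 3)

/-- A path from `X` to `-R(m) X` on the segment with these ends, constant near its ends; the
parameter is reversed by `-R(m)`. -/
def edgeLift (m X : V) (s : ℝ) : V :=
  ((1 - Real.smoothTransition (3 * s - 1) : ℝ) : ℂ) • X -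
    ((Real.smoothTransition (3 * s - 1) : ℝ) : ℂ) • reflU m • X

/-- The path `edgeLift` with its first coordinate normalized. -/
def edgePath (m X : V) (s : ℝ) : V := (edgeLift m X s 0)⁻¹ • edgeLift m X s

lemma smoothTransition_one_sub (x : ℝ) :
    Real.smoothTransition (1 - x) = 1 - Real.smoothTransition x := by
  have h := (Real.smoothTransition.pos_denom x).ne'
  simp only [Real.smoothTransition, sub_sub_cancel]
  rw [add_comm (expNegInvGlue (1 - x))]
  field_simp
  ring

section
variable {m X : V} {T : U} {c : ℂ}

lemma hnorm_edgeLift_neg (hm : 0 < hnorm m) (hX : hnorm X < 0) (s : ℝ) :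
    hnorm (edgeLift m X s) < 0 := by
  set b := Real.smoothTransition (3 * s - 1) with hb
  have hb0 : 0 ≤ b := Real.smoothTransition.nonneg _
  have hb1 : b ≤ 1 := Real.smoothTransition.le_one _
  have h1 : herm (reflU m • X) (reflU m • X) = herm X X := herm_U _ _ _
  have h2 := herm_reflU_smul m X
  have h3 : herm (reflU m • X) X = ((2 * (‖herm X m‖ ^ 2 / hnorm m) - hnorm X : ℝ) : ℂ) := by
    rw [← herm_conj, h2, Complex.conj_ofReal]
  have h4 : hnorm (edgeLift m X s) = ((1 - b) ^ 2 + b ^ 2 + 2 * b * (1 - b)) * hnorm X -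
      4 * b * (1 - b) * (‖herm X m‖ ^ 2 / hnorm m) := by
    have : herm (edgeLift m X s) (edgeLift m X s) =
        ((((1 - b) ^ 2 + b ^ 2 + 2 * b * (1 - b)) * hnorm X -
          4 * b * (1 - b) * (‖herm X m‖ ^ 2 / hnorm m) : ℝ) : ℂ) := by
      rw [edgeLift, ← hb]
      simp only [herm_sub_left, herm_sub_right, herm_smul_left, herm_smul_right, h1, h2, h3,
        Complex.conj_ofReal, herm_self X]
      push_cast
      ring
    rw [hnorm, this, Complex.ofReal_re]
  have h5 : (1 - b) ^ 2 + b ^ 2 + 2 * b * (1 - b) = 1 := by ring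
  have h6 : 0 ≤ 4 * b * (1 - b) * (‖herm X m‖ ^ 2 / hnorm m) := by
    have : 0 ≤ 1 - b := by linarith
    positivity
  rw [h4, h5]
  linarith

lemma edgeLift_apply_zero_ne (hm : 0 < hnorm m) (hX : hnorm X < 0) (s : ℝ) :
    edgeLift m X s 0 ≠ 0 :=
  apply_zero_ne_zero_of_hnorm_neg (hnorm_edgeLift_neg hm hX s)

lemma reflU_smul_edgeLift (m X : V) (s : ℝ) :
    reflU m • edgeLift m X s = -edgeLift m X (1 - s) := by
  have e : 3 * (1 - s) - 1 = 1 - (3 * s - 1) := by ring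
  rw [edgeLift, edgeLift, e, smoothTransition_one_sub, smul_sub, smul_comm (reflU m),
    smul_comm (reflU m), reflU_reflU]
  rw [sub_sub_cancel]
  abel

lemma contDiff_edgePath (hm : 0 < hnorm m) (hX : hnorm X < 0) :
    ContDiff ℝ ∞ (edgePath m X) := by
  have h1 : ContDiff ℝ ∞ fun s : ℝ => Real.smoothTransition (3 * s - 1) :=
    Real.smoothTransition.contDiff.comp (by fun_prop)
  have h2 : ContDiff ℝ ∞ (edgeLift m X) :=
    ((Complex.ofRealCLM.contDiff.comp (contDiff_const.sub h1)).smul contDiff_const).sub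
      ((Complex.ofRealCLM.contDiff.comp h1).smul contDiff_const)
  exact ((contDiff_apply_zero.comp h2).inv fun s => edgeLift_apply_zero_ne hm hX s).smul h2

lemma edgePath_apply_zero (hm : 0 < hnorm m) (hX : hnorm X < 0) (s : ℝ) :
    edgePath m X s 0 = 1 := by
  rw [edgePath, Pi.smul_apply, smul_eq_mul, inv_mul_cancel₀ (edgeLift_apply_zero_ne hm hX s)]

lemma hnorm_edgePath_neg (hm : 0 < hnorm m) (hX : hnorm X < 0) (s : ℝ) :
    hnorm (edgePath m X s) < 0 :=
  hnorm_smul_neg (inv_ne_zero (edgeLift_apply_zero_ne hm hX s)) (hnorm_edgeLift_neg hm hX s)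

lemma edgePath_of_le (m X : V) {s : ℝ} (hs : s ≤ 1 / 3) :
    edgePath m X s = (X 0)⁻¹ • X := by
  have : edgeLift m X s = X := by
    rw [edgeLift, Real.smoothTransition.zero_of_nonpos (by linarith)]
    simp
  rw [edgePath, this]

lemma edgePath_of_ge (hT : T • q₁ = q₁) (hc0 : c ≠ 0) (hRX : reflU m • X = c • T • X) {s : ℝ}
    (hs : 2 / 3 ≤ s) : edgePath m X s = T • (X 0)⁻¹ • X := by
  have : edgeLift m X s = (-c) • T • X := by
    rw [edgeLift, Real.smoothTransition.one_of_one_le (by linarith), hRX]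
    simp
  rw [edgePath, this, Pi.smul_apply, U_smul_apply_zero hT, smul_comm T, smul_smul]
  congr 1
  by_cases h : X 0 = 0
  · simp [h]
  · simp only [smul_eq_mul]
    field_simp

lemma reflU_smul_edgePath (hm : 0 < hnorm m) (hX : hnorm X < 0) (s : ℝ) :
    ∃ μ : ℂ, reflU m • edgePath m X s = μ • edgePath m X (1 - s) := by
  refine ⟨-(edgeLift m X s 0)⁻¹ * edgeLift m X (1 - s) 0, ?_⟩
  rw [edgePath, edgePath, smul_comm (reflU m), reflU_smul_edgeLift, smul_smul, mul_assoc,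
    mul_inv_cancel₀ (edgeLift_apply_zero_ne hm hX _), mul_one, smul_neg, neg_smul]

/-- The concatenation of the paths `T^k • edgePath`, `k ∈ ℤ`. -/
def boundaryPath (m X : V) (T : U) (s : ℝ) : V := T ^ ⌊s⌋ • edgePath m X (Int.fract s)

lemma boundaryPath_add (hT : T • q₁ = q₁) (hc0 : c ≠ 0) (hRX : reflU m • X = c • T • X)
    (k : ℤ) {s : ℝ} (hs0 : 0 ≤ s) (hs1 : s ≤ 1) :
    boundaryPath m X T (k + s) = T ^ k • edgePath m X s := by
  rcases hs1.lt_or_eq with h | rfl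
  · have h1 : ⌊s⌋ = 0 := Int.floor_eq_zero_iff.2 ⟨hs0, h⟩
    have h2 : Int.fract s = s := Int.fract_eq_self.2 ⟨hs0, h⟩
    rw [boundaryPath, Int.floor_intCast_add, Int.fract_intCast_add, h1, h2, add_zero]
  · have h1 : ((k : ℝ) + 1) = ((k + 1 : ℤ) : ℝ) := by push_cast; ring
    rw [boundaryPath, h1, Int.floor_intCast, Int.fract_intCast,
      edgePath_of_ge hT hc0 hRX (s := 1) (by norm_num), edgePath_of_le m X (s := 0) (by norm_num),
      zpow_add_one, mul_smul]

lemma boundaryPath_periodic {n : ℕ} (hTn : T ^ n = 1) (s : ℝ) (k : ℤ) :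
    boundaryPath m X T (s + k * n) = boundaryPath m X T s := by
  have h1 : s + k * n = s + ((n * k : ℤ) : ℝ) := by push_cast; ring
  rw [boundaryPath, h1, Int.floor_add_intCast, Int.fract_add_intCast, zpow_add, zpow_mul,
    zpow_natCast, hTn, one_zpow, mul_one, boundaryPath]

lemma boundaryPath_apply_zero (hT : T • q₁ = q₁) (hm : 0 < hnorm m) (hX : hnorm X < 0) (s : ℝ) :
    boundaryPath m X T s 0 = 1 := by
  rw [boundaryPath, U_smul_apply_zero (zpow_smul_q₁ hT _), edgePath_apply_zero hm hX]

lemma hnorm_boundaryPath_neg (hm : 0 < hnorm m) (hX : hnorm X < 0) (s : ℝ) :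
    hnorm (boundaryPath m X T s) < 0 := by
  rw [boundaryPath, hnorm_U]
  exact hnorm_edgePath_neg hm hX _

lemma contDiff_boundaryPath (hT : T • q₁ = q₁) (hc0 : c ≠ 0) (hRX : reflU m • X = c • T • X)
    (hm : 0 < hnorm m) (hX : hnorm X < 0) : ContDiff ℝ ∞ (boundaryPath m X T) := by
  rw [contDiff_iff_contDiffAt]
  intro s₀
  set k := ⌊s₀⌋ with hk
  rcases (Int.floor_le s₀).eq_or_lt with h | h
  · -- near an integer, the path is constant
    have hev : ∀ᶠ s in nhds s₀, boundaryPath m X T s = T ^ k • (X 0)⁻¹ • X := by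
      have hmem : Set.Ioo (s₀ - 1 / 3) (s₀ + 1 / 3) ∈ nhds s₀ :=
        Ioo_mem_nhds (by linarith) (by linarith)
      filter_upwards [hmem] with s hs
      have hs1 := hs.1
      have hs2 := hs.2
      rw [← h, ← hk] at hs1 hs2
      rcases le_or_gt (k : ℝ) s with hks | hks
      · have e : s = k + (s - k) := by ring
        rw [e, boundaryPath_add hT hc0 hRX k (by linarith) (by linarith),
          edgePath_of_le m X (by linarith)]
      · have e : s = ((k - 1 : ℤ) : ℝ) + (s - k + 1) := by push_cast; ring
        rw [e, boundaryPath_add hT hc0 hRX (k - 1) (by linarith) (by linarith),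
          edgePath_of_ge hT hc0 hRX (by linarith), ← mul_smul, ← zpow_add_one, sub_add_cancel]
    exact contDiffAt_const.congr_of_eventuallyEq hev
  · have hev : ∀ᶠ s in nhds s₀, boundaryPath m X T s = T ^ k • edgePath m X (s - k) := by
      have hmem : Set.Ioo (k : ℝ) (k + 1) ∈ nhds s₀ := Ioo_mem_nhds h (Int.lt_floor_add_one s₀)
      filter_upwards [hmem] with s hs
      have e : s = k + (s - k) := by ring
      conv_lhs => rw [e]
      rw [boundaryPath_add hT hc0 hRX k (by linarith [hs.1]) (by linarith [hs.2])]
    refine ContDiffAt.congr_of_eventuallyEq ?_ hev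
    exact ((contDiff_U_smul (T ^ k)).comp ((contDiff_edgePath hm hX).comp
      (contDiff_id.sub contDiff_const))).contDiffAt

/-- The extension of `boundaryPath` that is constant on the open rays from the centre. -/
def radialMap (n : ℕ) (m X : V) (T : U) (z : ℂ) : V :=
  boundaryPath m X T (Complex.arg z / centralAngle n)

variable {n : ℕ}

lemma radialMap_exp (hn : 5 ≤ n) (hTn : T ^ n = 1) {r : ℝ} (hr : 0 < r) (x : ℝ) :
    radialMap n m X T (r * Complex.exp (x * Complex.I)) =
      boundaryPath m X T (x / centralAngle n) := by
  have h := Complex.norm_mul_exp_arg_mul_I (r * Complex.exp (x * Complex.I))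
  rw [norm_mul, Complex.norm_exp_ofReal_mul_I, mul_one, Complex.norm_real,
    Real.norm_of_nonneg hr.le] at h
  have h' := mul_left_cancel₀ (Complex.ofReal_ne_zero.2 hr.ne') h
  obtain ⟨k, hk⟩ := Complex.exp_eq_exp_iff_exists_int.1 h'
  have hk' : Complex.arg (r * Complex.exp (x * Complex.I)) = x + k * (2 * Real.pi) := by
    have := congrArg Complex.im hk
    simpa [Complex.mul_im, Complex.add_im] using this
  have hb := (centralAngle_pos hn).ne'
  have e : (x + k * (2 * Real.pi)) / centralAngle n = x / centralAngle n + k * n := by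
    rw [← n_mul_centralAngle hn]
    field_simp
  rw [radialMap, hk', e, boundaryPath_periodic hTn]

lemma contDiffAt_radialMap (hn : 5 ≤ n) (hT : T • q₁ = q₁) (hTn : T ^ n = 1) (hc0 : c ≠ 0)
    (hRX : reflU m • X = c • T • X) (hm : 0 < hnorm m) (hX : hnorm X < 0) {z : ℂ} (hz : z ≠ 0) :
    ContDiffAt ℝ ∞ (radialMap n m X T) z := by
  have hB := contDiff_boundaryPath hT hc0 hRX hm hX
  have harg : ∀ {w : ℂ}, w ∈ Complex.slitPlane → ContDiffAt ℝ ∞ Complex.arg w := fun hw => by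
    have h := Complex.imCLM.contDiff.contDiffAt.comp _
      ((Complex.contDiffAt_log (n := ∞) hw).restrict_scalars ℝ)
    exact h.congr_of_eventuallyEq (Filter.Eventually.of_forall fun z => (Complex.log_im z).symm)
  by_cases hs : z ∈ Complex.slitPlane
  · exact hB.contDiffAt.comp z ((harg hs).div_const _)
  · -- near the negative half-axis, the angle is measured from this half-axis
    have hs' : -z ∈ Complex.slitPlane := by
      rcases Complex.mem_slitPlane_or_neg_mem_slitPlane hz with h | h
      · exact absurd h hs
      · exact h
    have hev : ∀ᶠ w in nhds z, radialMap n m X T w =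
        boundaryPath m X T ((Complex.arg (-w) + Real.pi) / centralAngle n) := by
      filter_upwards [isOpen_ne.mem_nhds hz] with w hw
      have e : w = (‖w‖ : ℝ) * Complex.exp ((Complex.arg (-w) + Real.pi : ℝ) * Complex.I) := by
        have h := Complex.norm_mul_exp_arg_mul_I (-w)
        rw [norm_neg] at h
        push_cast
        rw [add_mul, Complex.exp_add, Complex.exp_pi_mul_I, ← mul_assoc, h]
        ring
      conv_lhs => rw [e]
      exact radialMap_exp hn hTn (norm_pos_iff.2 hw) _
    refine ContDiffAt.congr_of_eventuallyEq ?_ hev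
    exact hB.contDiffAt.comp z
      ((((harg hs').comp z contDiff_neg.contDiffAt).add contDiffAt_const).div_const _)

/-- An equivariant map: the radial extension of the boundary path, deformed to the constant `q₁`
near the centre of the polygon. -/
def modelMap (n : ℕ) (m X : V) (T : U) (z : ℂ) : V :=
  q₁ + ((Real.smoothTransition (4 / circumradius n ^ 2 * Complex.normSq z - 1) : ℝ) : ℂ) •
    (radialMap n m X T z - q₁)

lemma hnorm_modelMap_neg (hT : T • q₁ = q₁) (hm : 0 < hnorm m) (hX : hnorm X < 0) (z : ℂ) :
    hnorm (modelMap n m X T z) < 0 := by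
  have h0 : radialMap n m X T z 0 = 1 := boundaryPath_apply_zero hT hm hX _
  have h1 : hnorm (radialMap n m X T z) < 0 := hnorm_boundaryPath_neg hm hX _
  rw [hnorm_eq, h0] at h1
  rw [hnorm_eq, modelMap]
  set y := radialMap n m X T z
  set b := Real.smoothTransition (4 / circumradius n ^ 2 * Complex.normSq z - 1)
  have hb0 : 0 ≤ b := Real.smoothTransition.nonneg _
  have hb1 : b ≤ 1 := Real.smoothTransition.le_one _
  simp only [q₁, Pi.add_apply, Pi.smul_apply, Pi.sub_apply, Matrix.cons_val_zero,
    Matrix.cons_val_one, Matrix.cons_val, h0, sub_self, mul_zero, add_zero, sub_zero, zero_add,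
    smul_eq_mul, norm_mul, norm_one, Complex.norm_real, Real.norm_of_nonneg hb0] at h1 ⊢
  nlinarith [sq_nonneg ‖y 1‖, sq_nonneg ‖y 2‖, mul_le_one₀ hb1 hb0 hb1]

lemma contDiff_modelMap (hn : 5 ≤ n) (hT : T • q₁ = q₁) (hTn : T ^ n = 1) (hc0 : c ≠ 0)
    (hRX : reflU m • X = c • T • X) (hm : 0 < hnorm m) (hX : hnorm X < 0) :
    ContDiff ℝ ∞ (modelMap n m X T) := by
  rw [contDiff_iff_contDiffAt]
  intro z
  have hN : ContDiff ℝ ∞ Complex.normSq := by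
    have : (Complex.normSq : ℂ → ℝ) = fun z => z.re * z.re + z.im * z.im := by
      funext z; exact Complex.normSq_apply z
    rw [this]
    exact (Complex.reCLM.contDiff.mul Complex.reCLM.contDiff).add
      (Complex.imCLM.contDiff.mul Complex.imCLM.contDiff)
  have hχ : ContDiff ℝ ∞ fun z : ℂ => 4 / circumradius n ^ 2 * Complex.normSq z - 1 :=
    (contDiff_const.mul hN).sub contDiff_const
  by_cases hz : z = 0
  · subst hz
    have hev : ∀ᶠ w in nhds (0 : ℂ), modelMap n m X T w = q₁ := by
      have h0 : (4 / circumradius n ^ 2 * Complex.normSq 0 - 1 : ℝ) < 0 := by simp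
      filter_upwards [hχ.continuous.continuousAt.eventually (gt_mem_nhds h0)] with w hw
      rw [modelMap, Real.smoothTransition.zero_of_nonpos hw.le]
      simp
    exact contDiffAt_const.congr_of_eventuallyEq hev
  · exact contDiffAt_const.add ((Complex.ofRealCLM.contDiff.comp
      (Real.smoothTransition.contDiff.comp hχ)).contDiffAt.smul
      ((contDiffAt_radialMap hn hT hTn hc0 hRX hm hX hz).sub contDiffAt_const))

lemma normSq_edge_ge (hn : 5 ≤ n) (j : ℕ) (t : ℝ) :
    circumradius n ^ 2 / 2 ≤
      Complex.normSq (vertex n j + t * (vertex n (j + 1) - vertex n j)) := by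
  have hcos : 0 ≤ Real.cos (centralAngle n) := Real.cos_nonneg_of_neg_pi_div_two_le_of_le
    (by linarith [centralAngle_pos hn, Real.pi_pos]) (centralAngle_lt hn).le
  have e1 : Complex.normSq (vertex n j) = circumradius n ^ 2 := by
    rw [← Complex.sq_norm, norm_vertex]
  have e2 : Complex.normSq (vertex n (j + 1)) = circumradius n ^ 2 := by
    rw [← Complex.sq_norm, norm_vertex]
  have e3 : (vertex n j).re * (vertex n (j + 1)).re + (vertex n j).im * (vertex n (j + 1)).im =
      circumradius n ^ 2 * Real.cos (centralAngle n) := by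
    rw [vertex_eq, vertex_eq, Complex.re_ofReal_mul, Complex.re_ofReal_mul, Complex.im_ofReal_mul,
      Complex.im_ofReal_mul, Complex.exp_ofReal_mul_I_re, Complex.exp_ofReal_mul_I_re,
      Complex.exp_ofReal_mul_I_im, Complex.exp_ofReal_mul_I_im]
    have : centralAngle n = ((j + 1 : ℕ) : ℝ) * centralAngle n - j * centralAngle n := by
      push_cast; ring
    conv_rhs => rw [this, Real.cos_sub]
    ring
  have h1 : 0 ≤ circumradius n ^ 2 := sq_nonneg _
  have h2 : 0 ≤ circumradius n ^ 2 * Real.cos (centralAngle n) := mul_nonneg h1 hcos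
  have h3 := mul_le_mul_of_nonneg_left (Real.cos_le_one (centralAngle n)) h1
  rw [Complex.normSq_apply] at e1 e2 ⊢
  simp only [Complex.add_re, Complex.add_im, Complex.re_ofReal_mul, Complex.im_ofReal_mul,
    Complex.sub_re, Complex.sub_im]
  set p := circumradius n ^ 2 * Real.cos (centralAngle n)
  have h4 : 0 ≤ (t - 1 / 2) ^ 2 * (circumradius n ^ 2 - p) :=
    mul_nonneg (sq_nonneg _) (by linarith)
  linear_combination h4 * 2 + h2 / 2 + (1 - t) ^ 2 * e1.symm.le + t ^ 2 * e2.symm.le -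
    2 * t * (1 - t) * e3

lemma exists_angle_edge (hn : 5 ≤ n) (j : ℕ) {t : ℝ} (ht : t ∈ Set.Icc (0 : ℝ) 1) :
    ∃ r s : ℝ, 0 < r ∧ 0 ≤ s ∧ s ≤ 1 ∧
      vertex n j + t * (vertex n (j + 1) - vertex n j) =
        r * Complex.exp (((j + s) * centralAngle n : ℝ) * Complex.I) ∧
      vertex n j + (1 - t : ℝ) * (vertex n (j + 1) - vertex n j) =
        r * Complex.exp (((j + (1 - s)) * centralAngle n : ℝ) * Complex.I) := by
  have hρ := circumradius_pos hn
  have hb := centralAngle_pos hn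
  rcases ht.2.eq_or_lt with rfl | ht1
  · refine ⟨circumradius n, 1, hρ, zero_le_one, le_rfl, ?_, ?_⟩
    · rw [Complex.ofReal_one, one_mul, add_sub_cancel, vertex_eq]
      push_cast
      rfl
    · rw [sub_self, Complex.ofReal_zero, zero_mul, add_zero, add_zero, vertex_eq]
  · have hmem : coneMap (vertex n j) (vertex n (j + 1)) (1, t) ∈
        triangle (vertex n j) (vertex n (j + 1)) := by
      rw [← coneMap_image (cross_vertex_succ_pos hn j)]
      exact ⟨(1, t), ⟨⟨one_pos, le_rfl⟩, ht.1, ht1⟩, rfl⟩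
    obtain ⟨hz0, x, hx1, hx2, hx⟩ := exists_angle_of_mem_triangle hn hmem
    have hcm : coneMap (vertex n j) (vertex n (j + 1)) (1, t) =
        vertex n j + t * (vertex n (j + 1) - vertex n j) := by
      simp [coneMap]
    rw [hcm] at hz0 hx
    set z := vertex n j + t * (vertex n (j + 1) - vertex n j) with hz
    refine ⟨‖z‖, x / centralAngle n - j, norm_pos_iff.2 hz0, ?_, ?_, ?_, ?_⟩
    · rw [sub_nonneg, le_div_iff₀ hb]; exact hx1
    · rw [sub_le_iff_le_add', div_le_iff₀ hb]; linarith
    · rw [add_sub_cancel, div_mul_cancel₀ _ hb.ne']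
      exact hx
    · -- the two points of the edge are symmetric with respect to the bisector of its angle
      have hsymm : (circumradius n : ℂ) ^ 2 *
          (vertex n j + (1 - t : ℝ) * (vertex n (j + 1) - vertex n j)) =
          vertex n j * vertex n (j + 1) * conj z := by
        have e1 : vertex n j * conj (vertex n j) = (circumradius n : ℂ) ^ 2 := by
          rw [Complex.mul_conj, ← Complex.sq_norm, norm_vertex]; push_cast; ring
        have e2 : vertex n (j + 1) * conj (vertex n (j + 1)) = (circumradius n : ℂ) ^ 2 := by
          rw [Complex.mul_conj, ← Complex.sq_norm, norm_vertex]; push_cast; ring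
        simp only [hz, map_add, map_mul, map_sub, Complex.conj_ofReal]
        push_cast
        linear_combination (t - 1) * vertex n (j + 1) * e1 - t * vertex n j * e2
      have hρ' : (circumradius n : ℂ) ^ 2 ≠ 0 := by
        exact_mod_cast (pow_pos hρ 2).ne'
      apply mul_left_cancel₀ hρ'
      have hconj : conj z = ‖z‖ * Complex.exp ((-x : ℝ) * Complex.I) := by
        conv_lhs => rw [hx]
        rw [map_mul, Complex.conj_ofReal, ← Complex.exp_conj, map_mul, Complex.conj_ofReal,
          Complex.conj_I]
        push_cast
        ring_nf
      have hsum : Complex.exp ((((j : ℝ) + (1 - (x / centralAngle n - j))) * centralAngle n : ℝ) *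
          Complex.I) = Complex.exp ((j * centralAngle n : ℝ) * Complex.I) *
          Complex.exp ((((j + 1 : ℕ) : ℝ) * centralAngle n : ℝ) * Complex.I) *
          Complex.exp ((-x : ℝ) * Complex.I) := by
        rw [← Complex.exp_add, ← Complex.exp_add, ← add_mul, ← add_mul]
        congr 2
        have : ((j : ℝ) + (1 - (x / centralAngle n - j))) * centralAngle n =
            j * centralAngle n + ((j + 1 : ℕ) : ℝ) * centralAngle n + -x := by
          push_cast
          field_simp
          ring
        rw [this]
        push_cast
        ring
      rw [hsymm, hconj, hsum, vertex_eq, vertex_eq]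
      ring

theorem isEquivariantMap_modelMap (hn : 5 ≤ n) (C : BisectorCycle n) (hT : T • q₁ = q₁)
    (hTn : T ^ n = 1) (hm : 0 < hnorm m) (hC : ∀ j, C.m j = T ^ (j : ℕ) • m) (hX : hnorm X < 0)
    (hc0 : c ≠ 0) (hRX : reflU m • X = c • T • X) :
    IsEquivariantMap C.rep (modelMap n m X T) where
  neg z _ := hnorm_modelMap_neg hT hm hX z
  smooth z _ := (contDiff_modelMap hn hT hTn hc0 hRX hm hX).contDiffAt
  equivariant j x hx hx0 hy0 := by
    rw [edge, segment_eq_image'] at hx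
    obtain ⟨t, ht, rfl⟩ := hx
    have hedge : vertex n j + t • (vertex n (j + 1) - vertex n j) =
        vertex n j + (t : ℂ) * (vertex n (j + 1) - vertex n j) := by simp
    have hmodel : ∀ t : ℝ, modelMap n m X T (vertex n j + t * (vertex n (j + 1) - vertex n j)) =
        radialMap n m X T (vertex n j + t * (vertex n (j + 1) - vertex n j)) := by
      intro t
      have h1 := normSq_edge_ge hn j t
      have hρ := circumradius_pos hn
      have h2 : 1 ≤ 4 / circumradius n ^ 2 *
          Complex.normSq (vertex n j + t * (vertex n (j + 1) - vertex n j)) - 1 := by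
        have h3 := mul_le_mul_of_nonneg_left h1 (show 0 ≤ 4 / circumradius n ^ 2 by positivity)
        have h4 : 4 / circumradius n ^ 2 * (circumradius n ^ 2 / 2) = 2 := by
          field_simp; norm_num
        linarith
      rw [modelMap, Real.smoothTransition.one_of_one_le h2]
      simp
    obtain ⟨r, s, hr, hs0, hs1, e1, e2⟩ := exists_angle_edge hn j ht
    have hb := (centralAngle_pos hn).ne'
    have v1 : modelMap n m X T (vertex n j + t • (vertex n (j + 1) - vertex n j)) =
        T ^ (j : ℕ) • edgePath m X s := by
      rw [hedge, hmodel, e1, radialMap_exp hn hTn hr, mul_div_cancel_right₀ _ hb]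
      have := boundaryPath_add hT hc0 hRX (j : ℤ) hs0 hs1
      rw [zpow_natCast] at this
      exact_mod_cast this
    have v2 : modelMap n m X T (sideTurn n j (vertex n j + t • (vertex n (j + 1) - vertex n j))) =
        T ^ (j : ℕ) • edgePath m X (1 - s) := by
      rw [hedge, sideTurn_edge hn, hmodel, e2, radialMap_exp hn hTn hr, mul_div_cancel_right₀ _ hb]
      have := boundaryPath_add hT hc0 hRX (j : ℤ) (s := 1 - s) (by linarith) (by linarith)
      rw [zpow_natCast] at this
      exact_mod_cast this
    have hR0 : reflU (C.m j) •
        modelMap n m X T (vertex n j + t • (vertex n (j + 1) - vertex n j)) ≠ 0 := by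
      apply ne_zero_of_hnorm_neg
      rw [hnorm_U]
      exact hnorm_modelMap_neg hT hm hX _
    rw [C.rep_r, reflPU_mk _ _ _ hR0, Projectivization.mk_eq_mk_iff']
    obtain ⟨μ, hμ⟩ := reflU_smul_edgePath hm hX s
    refine ⟨μ, ?_⟩
    rw [v1, v2, hC, reflU_U_smul, hμ, smul_comm μ]

/-- The Toledo invariant of a cycle of bisectors with a rotational symmetry `T`, where
`R(m) T X = c X`. -/
theorem isToledoInvariant_of_rotation (hn : 5 ≤ n) (C : BisectorCycle n) {θ : ℝ}
    (hT : T • q₁ = q₁) (hTn : T ^ n = 1) (hm : 0 < hnorm m)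
    (hC : ∀ j, C.m j = T ^ (j : ℕ) • m) (hX : hnorm X < 0) (hc : reflU m • T • X = c • X)
    (hθ : Complex.exp (θ * Complex.I) = -c) (hθ0 : -Real.pi ≤ θ) (hθ1 : θ < Real.pi) :
    IsToledoInvariant C.rep (n * θ / Real.pi) := by
  have hc0 : c ≠ 0 := by
    rintro rfl
    exact Complex.exp_ne_zero _ (hθ.trans neg_zero)
  have hRX : reflU m • X = c⁻¹ • T • X := by
    rw [← reflU_reflU m (T • X), hc, smul_comm (reflU m), smul_smul, inv_mul_cancel₀ hc0, one_smul]
  refine ⟨⟨_, isEquivariantMap_modelMap hn C hT hTn hm hC hX (inv_ne_zero hc0) hRX⟩,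
    fun φ hφ => ⟨?_, ?_⟩⟩
  · have h := integrableOn_curl hn fun z hz =>
      contDiffAt_primitive hnorm_q₁_neg (hφ.smooth z hz) (hφ.neg z hz)
    refine MeasureTheory.IntegrableOn.congr_fun (h.const_mul (1 / 2)) (fun z hz => ?_)
      (isCompact_polygon hn).measurableSet
    simp only [curl_primitive hnorm_q₁_neg (hφ.smooth z hz) (hφ.neg z hz)]
    ring
  · rw [integral_pullbackKahler_eq hn C hT hTn hm hC hX hc hθ hθ0 hθ1 hφ]
    have := Real.pi_pos.ne'
    field_simp
    ring

end

/-! ### Cycles of bisectors with a rotational symmetry -/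

/-- The diagonal unitary map with the given entries of absolute value `1`. -/
def diagU (d : Fin 3 → ℂ) (hd : ∀ i, ‖d i‖ = 1) : U :=
  ⟨{ toFun := fun x i => d i * x i
     map_add' := fun x y => by ext i; simp [mul_add]
     map_smul' := fun c x => by ext i; simp [mul_left_comm]
     invFun := fun x i => (d i)⁻¹ * x i
     left_inv := fun x => by
       ext i
       exact inv_mul_cancel_left₀ (norm_ne_zero_iff.1 (by rw [hd i]; exact one_ne_zero)) _
     right_inv := fun x => by
       ext i
       exact mul_inv_cancel_left₀ (norm_ne_zero_iff.1 (by rw [hd i]; exact one_ne_zero)) _ },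
   fun x y => by
    have h : ∀ i, d i * conj (d i) = 1 := fun i => by
      rw [Complex.mul_conj, ← Complex.sq_norm, hd i]; simp
    change herm (fun i => d i * x i) (fun i => d i * y i) = herm x y
    simp only [herm, map_mul]
    linear_combination -(x 0 * conj (y 0)) * h 0 + x 1 * conj (y 1) * h 1 +
      x 2 * conj (y 2) * h 2⟩

lemma diagU_smul (d : Fin 3 → ℂ) (hd : ∀ i, ‖d i‖ = 1) (x : V) (i : Fin 3) :
    (diagU d hd • x) i = d i * x i := rfl

lemma diagU_pow_smul (d : Fin 3 → ℂ) (hd : ∀ i, ‖d i‖ = 1) (k : ℕ) (x : V) (i : Fin 3) :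
    (diagU d hd ^ k • x) i = d i ^ k * x i := by
  induction k generalizing x with
  | zero => simp
  | succ k ih => rw [pow_succ, mul_smul, ih, diagU_smul, pow_succ, mul_assoc]

lemma tance_eq (x y : V) : tance x y = ‖herm x y‖ ^ 2 / (hnorm x * hnorm y) := by
  rw [tance, herm_mul_herm, herm_self, herm_self, ← Complex.ofReal_mul, ← Complex.ofReal_div,
    Complex.ofReal_re]

lemma hnorm_mul_lt_of_one_lt_tance {x y : V} (hx : 0 < hnorm x) (hy : 0 < hnorm y)
    (h : 1 < tance x y) : hnorm x * hnorm y < ‖herm x y‖ ^ 2 := by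
  rw [tance_eq, one_lt_div (mul_pos hx hy)] at h
  exact h

section
variable {m p : V} {c : ℂ}

lemma hnorm_lt_herm_reflU (hm : 0 < hnorm m) (hp : 0 < hnorm p) (h : 1 < tance m p) :
    hnorm p < 2 * (‖herm p m‖ ^ 2 / hnorm m) - hnorm p := by
  have h1 := hnorm_mul_lt_of_one_lt_tance hm hp h
  rw [norm_herm_comm] at h1
  have h2 : hnorm p < ‖herm p m‖ ^ 2 / hnorm m := by
    rw [lt_div_iff₀ hm, mul_comm]; exact h1
  linarith

lemma one_lt_tance_reflU (hm : 0 < hnorm m) (hp : 0 < hnorm p) (h : 1 < tance m p)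
    (hc : c ≠ 0) : 1 < tance p (c • reflU m • p) := by
  have h1 := hnorm_lt_herm_reflU hm hp h
  set L := 2 * (‖herm p m‖ ^ 2 / hnorm m) - hnorm p with hL
  have hL0 : 0 < L := hp.trans h1
  have hc' : 0 < ‖c‖ := norm_pos_iff.2 hc
  rw [tance_eq, hnorm_smul, hnorm_U, herm_smul_right, herm_reflU_smul, ← hL, norm_mul,
    Complex.norm_conj, Complex.norm_real, Real.norm_of_nonneg hL0.le, one_lt_div (by positivity)]
  have h2 : hnorm p * hnorm p < L * L := mul_lt_mul'' h1 h1 hp.le hp.le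
  have h3 := mul_lt_mul_of_pos_left h2 (pow_pos hc' 2)
  linarith

lemma isMiddleSlice_reflU (hm : 0 < hnorm m) (hp : 0 < hnorm p) (h : 1 < tance m p)
    (hc : c ≠ 0) : IsMiddleSlice p (c • reflU m • p) m := by
  have h1 := hnorm_lt_herm_reflU hm hp h
  set L := 2 * (‖herm p m‖ ^ 2 / hnorm m) - hnorm p with hL
  have hL0 : 0 < L := hp.trans h1
  have hc' : 0 < ‖c‖ := norm_pos_iff.2 hc
  have hpm : herm p m ≠ 0 := by
    have h2 := hnorm_mul_lt_of_one_lt_tance hm hp h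
    rw [norm_herm_comm] at h2
    intro h0
    rw [h0, norm_zero] at h2
    nlinarith [mul_pos hm hp]
  have hmm : herm m m ≠ 0 := by rw [herm_self]; exact_mod_cast hm.ne'
  refine ⟨⟨1, 1 / (‖c‖ ^ 2 * L), zero_le_one, by positivity, Or.inl one_ne_zero,
    herm m m / (2 * herm p m), by simp [hpm, hmm], ?_⟩, ⟨c⁻¹, ?_⟩, ⟨c, ?_⟩⟩
  · have hcc : conj c * c = ((‖c‖ ^ 2 : ℝ) : ℂ) := by
      rw [mul_comm, Complex.mul_conj, Complex.sq_norm]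
    have hcL : ((‖c‖ ^ 2 * L : ℝ) : ℂ) ≠ 0 := by exact_mod_cast (by positivity)
    have e : ((1 / (‖c‖ ^ 2 * L) : ℝ) : ℂ) * herm p (c • reflU m • p) * c = 1 := by
      rw [herm_smul_right, herm_reflU_smul, ← hL, mul_assoc,
        show conj c * (L : ℂ) * c = conj c * c * L by ring, hcc, ← Complex.ofReal_mul,
        ← Complex.ofReal_mul, one_div_mul_cancel (by positivity), Complex.ofReal_one]
    rw [smul_smul, e, one_smul, Complex.ofReal_one, one_smul, reflU_smul, reflLin_apply,
      add_sub_cancel, smul_smul]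
    have e2 : herm m m / (2 * herm p m) * (2 * (herm p m / herm m m)) = 1 := by
      field_simp
    rw [e2, one_smul]
  · rw [smul_smul, inv_mul_cancel₀ hc, one_smul, reflU_smul]
  · rw [← reflU_smul, smul_comm (reflU m), reflU_reflU]

end

lemma toPU_eq_one {g : U} {c : ℂ} (hg : ∀ x : V, g • x = c • x) : toPU g = 1 := by
  apply Subtype.ext
  apply Equiv.ext
  intro P
  induction P using Projectivization.ind with
  | h v hv =>
    change g • Projectivization.mk ℂ v hv = Projectivization.mk ℂ v hv
    exact (Projectivization.mk_eq_mk_iff' ℂ _ _ ((smul_ne_zero_iff_ne g).2 hv) hv).2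
      ⟨c, (hg v).symm⟩

/-- Over a basis of eigenvectors, an endomorphism whose eigenvalues have the same `n`-th power has
a scalar `n`-th power. -/
lemma pow_smul_eq_of_eigenvectors {g : U} {x : Fin 3 → V} {μ : Fin 3 → ℂ} {κ : ℂ} {n : ℕ}
    (hx : ∀ i, g • x i = μ i • x i) (hx0 : ∀ i, x i ≠ 0) (hμ : Function.Injective μ)
    (hκ : ∀ i, μ i ^ n = κ) (y : V) : g ^ n • y = κ • y := by
  have hlin : LinearIndependent ℂ x :=
    Module.End.eigenvectors_linearIndependent' (g : V ≃ₗ[ℂ] V).toLinearMap μ hμ x fun i =>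
      ⟨Module.End.mem_eigenspace_iff.2 (hx i), hx0 i⟩
  have hspan := hlin.span_eq_top_of_card_eq_finrank (by simp)
  have hpow : ∀ (k : ℕ) (i : Fin 3), g ^ k • x i = μ i ^ k • x i := by
    intro k i
    induction k with
    | zero => simp
    | succ k ih => rw [pow_succ, mul_smul, hx, smul_comm, ih, smul_smul, pow_succ, mul_comm]
  have h : ((g ^ n : U) : V ≃ₗ[ℂ] V).toLinearMap = κ • LinearMap.id :=
    LinearMap.ext_on_range hspan fun i => by
      change g ^ n • x i = κ • x i
      rw [hpow, hκ]
  exact LinearMap.congr_fun h y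

lemma list_prod_conj_pow {G : Type*} [Group G] (T R : G) (n : ℕ) :
    (List.ofFn fun j : Fin n => T ^ (j : ℕ) * R * (T ^ (j : ℕ))⁻¹).reverse.prod =
      T ^ n * (T⁻¹ * R) ^ n := by
  induction n with
  | zero => simp
  | succ n ih =>
    rw [List.ofFn_succ', List.concat_eq_append, List.reverse_append, List.prod_append]
    simp only [Fin.val_castSucc, Fin.val_last, List.reverse_singleton, List.prod_singleton]
    rw [ih, pow_succ' (T⁻¹ * R), pow_succ]
    simp only [mul_assoc, inv_mul_cancel_left, mul_inv_cancel_left]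

lemma reflU_conj (T : U) (m : V) (k : ℕ) :
    reflU (T ^ k • m) = T ^ k * reflU m * (T ^ k)⁻¹ := by
  rw [eq_mul_inv_iff_mul_eq]
  apply Subtype.ext
  apply LinearEquiv.ext
  intro x
  exact reflU_U_smul (T ^ k) m x

section
variable {n : ℕ} {T : U} {m : V} {x : Fin 3 → V} {μ : Fin 3 → ℂ} {κ : ℂ}

lemma prod_reflPU_eq_one (hTn : T ^ n = 1) (hx : ∀ i, reflU m • T • x i = μ i • x i)
    (hx0 : ∀ i, x i ≠ 0) (hμ : Function.Injective μ) (hκ : ∀ i, μ i ^ n = κ) :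
    (List.ofFn fun j : Fin n => reflPU (T ^ (j : ℕ) • m)).reverse.prod = 1 := by
  have h1 : (List.ofFn fun j : Fin n => reflPU (T ^ (j : ℕ) • m)).reverse.prod =
      toPU (List.ofFn fun j : Fin n =>
        T ^ (j : ℕ) * reflU m * (T ^ (j : ℕ))⁻¹).reverse.prod := by
    rw [map_list_prod, List.map_reverse, List.map_ofFn]
    congr 3
    funext j
    rw [reflPU, reflU_conj]
    rfl
  have hinv : (reflU m)⁻¹ = reflU m := inv_eq_of_mul_eq_one_left (reflU_mul_self m)
  have h2 : T⁻¹ * reflU m = (reflU m * T)⁻¹ := by rw [mul_inv_rev, hinv]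
  rw [h1, list_prod_conj_pow, hTn, one_mul, h2, inv_pow, map_inv, inv_eq_one]
  exact toPU_eq_one (pow_smul_eq_of_eigenvectors (fun i => by rw [mul_smul, hx]) hx0 hμ hκ)

/-- The cycle of bisectors whose complex geodesics have polar points `T^j S`, where `S` is an
eigenvector of `R(m) T`. -/
theorem exists_bisectorCycle (hTn : T ^ n = 1) (hm : 0 < hnorm m)
    (hx : ∀ i, reflU m • T • x i = μ i • x i) (hx0 : ∀ i, x i ≠ 0) (hμ : Function.Injective μ)
    (hκ : ∀ i, μ i ^ n = κ) {i₀ : Fin 3} (hpos : 0 < hnorm (x i₀)) (hμ0 : μ i₀ ≠ 0)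
    (hta : 1 < tance m (x i₀)) {s : Fin n → V} {ν : Fin n → ℂ} (hν : ∀ j, ν j ≠ 0)
    (hs : ∀ j, s j = ν j • T ^ (j : ℕ) • x i₀) :
    ∃ C : BisectorCycle n, C.s = s ∧ ∀ j, C.m j = T ^ (j : ℕ) • m := by
  have hspos : ∀ j, 0 < hnorm (s j) := fun j => by
    have := norm_pos_iff.2 (hν j)
    rw [hs, hnorm_smul, hnorm_U]
    positivity
  have hmpos : ∀ j : Fin n, 0 < hnorm (T ^ (j : ℕ) • m) := fun j => by rwa [hnorm_U]
  have hstance : ∀ j : Fin n, 1 < tance (T ^ (j : ℕ) • m) (s j) := fun j => by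
    have h0 := norm_ne_zero_iff.2 (hν j)
    rw [tance_eq] at hta ⊢
    rw [hs, hnorm_smul, hnorm_U, hnorm_U, herm_smul_right, herm_U, norm_mul, Complex.norm_conj]
    convert hta using 1
    field_simp
  have hRx : reflU m • x i₀ = (μ i₀)⁻¹ • T • x i₀ := by
    rw [← reflU_reflU m (T • x i₀), hx, smul_comm (reflU m), smul_smul, inv_mul_cancel₀ hμ0,
      one_smul]
  -- up to a scalar, consecutive polar points are exchanged by the reflections
  have hnext : ∀ j : Fin n, ∃ c : ℂ, c ≠ 0 ∧
      s (finRotate n j) = c • reflU (T ^ (j : ℕ) • m) • s j := by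
    intro j
    have hval : T ^ ((finRotate n j : Fin n) : ℕ) = T ^ ((j : ℕ) + 1) := by
      have : NeZero n := ⟨fun h => by subst h; exact j.elim0⟩
      have hv : ((finRotate n j : Fin n) : ℕ) = (j + 1) % n := by
        rw [finRotate_apply, Fin.val_add, Fin.val_one', Nat.add_mod_mod]
      rw [hv]
      conv_rhs => rw [← Nat.mod_add_div ((j : ℕ) + 1) n, pow_add, pow_mul, hTn, one_pow, mul_one]
    refine ⟨ν (finRotate n j) * μ i₀ * (ν j)⁻¹,
      mul_ne_zero (mul_ne_zero (hν _) hμ0) (inv_ne_zero (hν j)), ?_⟩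
    rw [hs, hs j, hval, smul_comm (reflU _), reflU_U_smul, hRx, smul_comm (T ^ (j : ℕ)), smul_smul,
      smul_smul, pow_succ, mul_smul]
    congr 1
    have := hν j
    field_simp
  refine ⟨⟨s, fun j => T ^ (j : ℕ) • m, hspos, fun j => ?_, fun j => ?_,
    prod_reflPU_eq_one hTn hx hx0 hμ hκ⟩, rfl, fun _ => rfl⟩
  · obtain ⟨c, hc, h⟩ := hnext j
    rw [h]
    exact one_lt_tance_reflU (hmpos j) (hspos j) (hstance j) hc
  · obtain ⟨c, hc, h⟩ := hnext j
    rw [h]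
    exact isMiddleSlice_reflU (hmpos j) (hspos j) (hstance j) hc

end

/-! ### The eigenvectors of the explicit family -/

/-- The arguments of `u₁, u₂, u₃`. -/
def uAngle (n : ℕ) (k p : ℤ) : Fin 3 → ℝ := ![(2 * n * p - k) * Real.pi / (3 * n),
  (2 * n * p - k - 3) * Real.pi / (3 * n), (2 * n * p + 2 * k + 3) * Real.pi / (3 * n)]

/-- The arguments of `w₁, w₂, w₃`. -/
def wAngle (n : ℕ) (l : ℤ) : Fin 3 → ℝ := ![l * Real.pi / (3 * n),
  (l + 3) * Real.pi / (3 * n), -(2 * l + 3) * Real.pi / (3 * n)]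

section
variable {n : ℕ} {k l p : ℤ}

lemma uu_eq (n : ℕ) (k p : ℤ) (i : Fin 3) :
    uu n k p i = Complex.exp (uAngle n k p i * Complex.I) := by
  fin_cases i <;> simp [uu, uAngle] <;> congr 1 <;> ring

lemma ww_eq (n : ℕ) (l : ℤ) (i : Fin 3) :
    ww n l i = Complex.exp (wAngle n l i * Complex.I) := by
  fin_cases i <;> simp [ww, wAngle] <;> congr 1 <;> ring

lemma norm_uu (n : ℕ) (k p : ℤ) (i : Fin 3) : ‖uu n k p i‖ = 1 := by
  rw [uu_eq, Complex.norm_exp_ofReal_mul_I]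

lemma norm_ww (n : ℕ) (l : ℤ) (i : Fin 3) : ‖ww n l i‖ = 1 := by
  rw [ww_eq, Complex.norm_exp_ofReal_mul_I]

lemma uu_ne_zero (n : ℕ) (k p : ℤ) (i : Fin 3) : uu n k p i ≠ 0 := by
  rw [uu_eq]; exact Complex.exp_ne_zero _

lemma ww_ne_zero (n : ℕ) (l : ℤ) (i : Fin 3) : ww n l i ≠ 0 := by
  rw [ww_eq]; exact Complex.exp_ne_zero _

lemma prod_ww (n : ℕ) (l : ℤ) : ww n l 0 * ww n l 1 * ww n l 2 = 1 := by
  rw [ww_eq, ww_eq, ww_eq, ← Complex.exp_add, ← Complex.exp_add, Complex.exp_eq_one_iff]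
  refine ⟨0, ?_⟩
  simp [wAngle]
  ring

lemma prod_uu (hn : 5 ≤ n) (k p : ℤ) : uu n k p 0 * uu n k p 1 * uu n k p 2 = 1 := by
  rw [uu_eq, uu_eq, uu_eq, ← Complex.exp_add, ← Complex.exp_add, Complex.exp_eq_one_iff]
  refine ⟨p, ?_⟩
  have : (n : ℂ) ≠ 0 := by exact_mod_cast (by omega : n ≠ 0)
  simp [uAngle]
  field_simp
  ring

lemma conj_eq_inv_of_norm_eq_one {z : ℂ} (hz : ‖z‖ = 1) : conj z = z⁻¹ := by
  rw [Complex.inv_def, ← Complex.sq_norm, hz]; simp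

/-- The real part of `(w_i² - w_j²) w_j` for unit complex numbers with product `1` is a product of
two sines. -/
lemma re_sq_sub_sq_mul {a b c : ℝ} (h : a + b + c = 0) :
    ((Complex.exp (a * Complex.I) ^ 2 - Complex.exp (b * Complex.I) ^ 2) *
      Complex.exp (b * Complex.I)).re = 2 * Real.sin (b - a) * Real.sin (b - c) := by
  have e1 : (Complex.exp (a * Complex.I) ^ 2 - Complex.exp (b * Complex.I) ^ 2) *
      Complex.exp (b * Complex.I) = Complex.exp ((2 * a + b : ℝ) * Complex.I) -
        Complex.exp ((3 * b : ℝ) * Complex.I) := by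
    rw [sub_mul, ← Complex.exp_nat_mul, ← Complex.exp_nat_mul, ← Complex.exp_add,
      ← Complex.exp_add]
    congr 2 <;> push_cast <;> ring
  rw [e1, Complex.sub_re, Complex.exp_ofReal_mul_I_re, Complex.exp_ofReal_mul_I_re,
    Real.cos_sub_cos]
  have hc : c = -a - b := by linarith
  rw [hc, show (2 * a + b - 3 * b) / 2 = -(b - a) by ring, Real.sin_neg,
    show (2 * a + b + 3 * b) / 2 = b - (-a - b) by ring]
  ring

/-- For unit complex numbers with product `1`, the number `(w_1² - w_3²) w_2` is purely
imaginary. -/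
lemma re_sq_sub_sq_mul_eq_zero {a b c : ℂ} (ha : ‖a‖ = 1) (hc : ‖c‖ = 1) (h : a * b * c = 1) :
    ((a ^ 2 - c ^ 2) * b).re = 0 := by
  have ha0 : a ≠ 0 := norm_ne_zero_iff.1 (by rw [ha]; exact one_ne_zero)
  have hc0 : c ≠ 0 := norm_ne_zero_iff.1 (by rw [hc]; exact one_ne_zero)
  have e : (a ^ 2 - c ^ 2) * b = a * conj c - conj (a * conj c) := by
    rw [map_mul, Complex.conj_conj, conj_eq_inv_of_norm_eq_one ha, conj_eq_inv_of_norm_eq_one hc]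
    field_simp
    linear_combination (a ^ 2 - c ^ 2) * h
  rw [e, Complex.sub_conj]
  simp

lemma sum_wAngle (n : ℕ) (l : ℤ) : wAngle n l 0 + wAngle n l 1 + wAngle n l 2 = 0 := by
  simp [wAngle]; ring

/-- The sines of the differences of the arguments of `w₁, w₂, w₃` are positive. -/
lemma sin_wAngle_pos (hn : 5 ≤ n) (hl0 : 0 ≤ l) (hl : l ≤ (n : ℤ) - 3) :
    0 < Real.sin (wAngle n l 1 - wAngle n l 0) ∧ 0 < Real.sin (wAngle n l 1 - wAngle n l 2) ∧
      0 < Real.sin (wAngle n l 0 - wAngle n l 2) := by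
  have hn0 : (0 : ℝ) < n := by exact_mod_cast (by omega : 0 < n)
  have hn1 : (5 : ℝ) ≤ n := by exact_mod_cast hn
  have hl0' : (0 : ℝ) ≤ l := by exact_mod_cast hl0
  have hl' : (l : ℝ) ≤ n - 3 := by exact_mod_cast hl
  have hpi := Real.pi_pos
  have key : ∀ q : ℝ, 0 < q → q < n → 0 < Real.sin (q * Real.pi / n) := by
    intro q hq0 hq1
    apply Real.sin_pos_of_pos_of_lt_pi (by positivity)
    rw [div_lt_iff₀ hn0]
    nlinarith
  have e1 : wAngle n l 1 - wAngle n l 0 = 1 * Real.pi / n := by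
    simp [wAngle]; field_simp; ring
  have e2 : wAngle n l 1 - wAngle n l 2 = (l + 2) * Real.pi / n := by
    simp [wAngle]; field_simp; ring
  have e3 : wAngle n l 0 - wAngle n l 2 = (l + 1) * Real.pi / n := by
    simp [wAngle]; field_simp; ring
  rw [e1, e2, e3]
  exact ⟨key _ (by norm_num) (by linarith), key _ (by linarith) (by linarith),
    key _ (by linarith) (by linarith)⟩

lemma eq_zero_of_re_mul_eq_zero {z : ℂ} {a b : ℝ} (hab : Real.sin (a - b) ≠ 0)
    (ha : (z * Complex.exp (a * Complex.I)).re = 0)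
    (hb : (z * Complex.exp (b * Complex.I)).re = 0) : z = 0 := by
  rw [Complex.mul_re, Complex.exp_ofReal_mul_I_re, Complex.exp_ofReal_mul_I_im] at ha hb
  rw [Real.sin_sub] at hab
  apply Complex.ext
  · apply mul_left_cancel₀ hab
    rw [Complex.zero_re, mul_zero]
    linear_combination Real.sin a * hb - Real.sin b * ha
  · apply mul_left_cancel₀ hab
    rw [Complex.zero_im, mul_zero]
    linear_combination Real.cos a * hb - Real.cos b * ha

/-- For a root `x` of `(x - b₀)(x - b₁)(x - b₂)`, the weighted sum of the fractions `a_j / (x + a_j)`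
is `1/2`: the partial fraction expansion behind the eigenvectors of the product of a reflection and
a diagonal map. -/
lemma sum_weight_div {s₀ s₁ s₂ a₀ a₁ a₂ b₀ b₁ b₂ x : ℂ} (hs : s₀ + s₁ + s₂ = 1)
    (ha : a₀ * a₁ * a₂ = 1) (hb : b₀ * b₁ * b₂ = 1)
    (h₁ : s₀ * a₀ + s₁ * a₁ + s₂ * a₂ = (b₀ + b₁ + b₂ + (a₀ + a₁ + a₂)) / 2)
    (h₂ : s₀ * (a₁ * a₂) + s₁ * (a₀ * a₂) + s₂ * (a₀ * a₁) =
      (b₁ * b₂ + b₀ * b₂ + b₀ * b₁ + (a₁ * a₂ + a₀ * a₂ + a₀ * a₁)) / 2)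
    (hx : (x - b₀) * (x - b₁) * (x - b₂) = 0) (h₀' : x + a₀ ≠ 0) (h₁' : x + a₁ ≠ 0)
    (h₂' : x + a₂ ≠ 0) :
    s₀ * a₀ / (x + a₀) + s₁ * a₁ / (x + a₁) + s₂ * a₂ / (x + a₂) = 1 / 2 := by
  rw [div_add_div _ _ h₀' h₁', div_add_div _ _ (mul_ne_zero h₀' h₁') h₂',
    div_eq_div_iff (mul_ne_zero (mul_ne_zero h₀' h₁') h₂') two_ne_zero]
  linear_combination 2 * x ^ 2 * h₁ - 2 * x * h₂ +
    2 * (x * (a₁ * a₂ + a₀ * a₂ + a₀ * a₁) + a₀ * a₁ * a₂) * hs + ha - hb - hx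

lemma re_sub_mul_pos (hq : QuadrangleConditions n k l p) :
    0 < ((ww n l 1 ^ 2 - vv n k l p) * ww n l 1).re := by
  have h := hq.re_w₂
  rw [sub_mul, Complex.sub_re, ← pow_succ]
  linarith

lemma re_sub_mul_nonneg (hq : QuadrangleConditions n k l p) :
    0 ≤ ((ww n l 0 ^ 2 - vv n k l p) * ww n l 2).re := by
  have h := hq.re_w₃
  rw [sub_mul, Complex.sub_re]
  linarith

lemma re_w₂_pos (hn : 5 ≤ n) (hq : QuadrangleConditions n k l p) :
    0 < ((ww n l 0 ^ 2 - ww n l 1 ^ 2) * ww n l 1).re := by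
  obtain ⟨h1, h2, -⟩ := sin_wAngle_pos hn (hq.k_nonneg.trans hq.k_le_l) hq.l_le
  rw [ww_eq, ww_eq, re_sq_sub_sq_mul (sum_wAngle n l)]
  positivity

lemma re_w₃_pos (hn : 5 ≤ n) (hq : QuadrangleConditions n k l p) :
    0 < ((ww n l 0 ^ 2 - ww n l 2 ^ 2) * ww n l 2).re := by
  obtain ⟨-, h2, h3⟩ := sin_wAngle_pos hn (hq.k_nonneg.trans hq.k_le_l) hq.l_le
  have hs : wAngle n l 0 + wAngle n l 2 + wAngle n l 1 = 0 := by linarith [sum_wAngle n l]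
  rw [ww_eq, ww_eq, re_sq_sub_sq_mul hs, ← neg_sub, ← neg_sub (wAngle n l 1), Real.sin_neg,
    Real.sin_neg]
  nlinarith [mul_pos h2 h3]

lemma m₂_sq (hn : 5 ≤ n) (hq : QuadrangleConditions n k l p) : m₂ n k l p ^ 2 =
    ((ww n l 0 ^ 2 - vv n k l p) * ww n l 1).re / ((ww n l 0 ^ 2 - ww n l 1 ^ 2) * ww n l 1).re := by
  refine Real.sq_sqrt (div_nonneg ?_ (re_w₂_pos hn hq).le)
  have e : (ww n l 0 ^ 2 - vv n k l p) * ww n l 1 = (ww n l 0 ^ 2 - ww n l 1 ^ 2) * ww n l 1 +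
      (ww n l 1 ^ 2 - vv n k l p) * ww n l 1 := by ring
  rw [e, Complex.add_re]
  exact (add_pos (re_w₂_pos hn hq) (re_sub_mul_pos hq)).le

lemma one_le_m₂_sq (hn : 5 ≤ n) (hq : QuadrangleConditions n k l p) : 1 ≤ m₂ n k l p ^ 2 := by
  have e : (ww n l 0 ^ 2 - vv n k l p) * ww n l 1 = (ww n l 0 ^ 2 - ww n l 1 ^ 2) * ww n l 1 +
      (ww n l 1 ^ 2 - vv n k l p) * ww n l 1 := by ring
  rw [m₂_sq hn hq, one_le_div (re_w₂_pos hn hq), e, Complex.add_re]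
  linarith [re_sub_mul_pos hq]

lemma m₃_sq (hn : 5 ≤ n) (hq : QuadrangleConditions n k l p) : m₃ n k l p ^ 2 =
    ((ww n l 0 ^ 2 - vv n k l p) * ww n l 2).re / ((ww n l 0 ^ 2 - ww n l 2 ^ 2) * ww n l 2).re :=
  Real.sq_sqrt (div_nonneg (re_sub_mul_nonneg hq) (re_w₃_pos hn hq).le)

lemma m₁_sq (hn : 5 ≤ n) (hq : QuadrangleConditions n k l p) :
    m₁ n k l p ^ 2 = m₂ n k l p ^ 2 + m₃ n k l p ^ 2 - 1 :=
  Real.sq_sqrt (by linarith [one_le_m₂_sq hn hq, sq_nonneg (m₃ n k l p)])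

lemma herm_mm_self (hn : 5 ≤ n) (hq : QuadrangleConditions n k l p) :
    herm (mm n k l p) (mm n k l p) = 1 := by
  have h : (m₁ n k l p : ℂ) ^ 2 = m₂ n k l p ^ 2 + m₃ n k l p ^ 2 - 1 := by
    exact_mod_cast m₁_sq hn hq
  simp only [herm, mm, Matrix.cons_val, Complex.conj_ofReal]
  linear_combination -h

/-- The squares of the coordinates of `m` are the solution of a real linear system which expresses
that the trace of `R(m) W` is prescribed. -/
lemma sum_mm_sq_mul (hn : 5 ≤ n) (hq : QuadrangleConditions n k l p) :
    -(m₁ n k l p : ℂ) ^ 2 * ww n l 0 ^ 2 + (m₂ n k l p : ℂ) ^ 2 * ww n l 1 ^ 2 +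
      (m₃ n k l p : ℂ) ^ 2 * ww n l 2 ^ 2 = vv n k l p := by
  have h : (m₁ n k l p : ℂ) ^ 2 = m₂ n k l p ^ 2 + m₃ n k l p ^ 2 - 1 := by
    exact_mod_cast m₁_sq hn hq
  have hP := prod_ww n l
  have hs := (sin_wAngle_pos hn (hq.k_nonneg.trans hq.k_le_l) hq.l_le).2.1.ne'
  have e : ((m₂ n k l p ^ 2 : ℝ) : ℂ) * (ww n l 0 ^ 2 - ww n l 1 ^ 2) +
      ((m₃ n k l p ^ 2 : ℝ) : ℂ) * (ww n l 0 ^ 2 - ww n l 2 ^ 2) -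
        (ww n l 0 ^ 2 - vv n k l p) = 0 := by
    refine eq_zero_of_re_mul_eq_zero hs ?_ ?_
    · rw [← ww_eq, sub_mul, add_mul, mul_assoc, mul_assoc, Complex.sub_re, Complex.add_re,
        Complex.re_ofReal_mul, Complex.re_ofReal_mul,
        re_sq_sub_sq_mul_eq_zero (norm_ww n l 0) (norm_ww n l 2) hP, m₂_sq hn hq,
        div_mul_cancel₀ _ (re_w₂_pos hn hq).ne']
      ring
    · rw [← ww_eq, sub_mul, add_mul, mul_assoc, mul_assoc, Complex.sub_re, Complex.add_re,
        Complex.re_ofReal_mul, Complex.re_ofReal_mul,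
        re_sq_sub_sq_mul_eq_zero (norm_ww n l 0) (norm_ww n l 1) (by linear_combination hP),
        m₃_sq hn hq, div_mul_cancel₀ _ (re_w₃_pos hn hq).ne']
      ring
  push_cast at e
  linear_combination -e - h * ww n l 0 ^ 2

lemma conj_sq_eq_mul {a b c : ℂ} (ha : ‖a‖ = 1) (h : a * b * c = 1) :
    conj (a ^ 2) = b ^ 2 * c ^ 2 := by
  have ha0 : a ≠ 0 := norm_ne_zero_iff.1 (by rw [ha]; exact one_ne_zero)
  rw [map_pow, conj_eq_inv_of_norm_eq_one ha, ← mul_pow, ← eq_inv_of_mul_eq_one_right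
    ((mul_assoc a b c).symm.trans h)]

/-- The vectors `h_i` are normalized by `⟨h_i, m⟩ = 1/2`. -/
lemma herm_hh_mm (hn : 5 ≤ n) (hq : QuadrangleConditions n k l p) (i : Fin 3) :
    herm (hh n k l p i) (mm n k l p) = 1 / 2 := by
  have hm : (m₁ n k l p : ℂ) ^ 2 = m₂ n k l p ^ 2 + m₃ n k l p ^ 2 - 1 := by
    exact_mod_cast m₁_sq hn hq
  have hP := prod_ww n l
  have hQ := prod_uu hn k p
  have h1 := sum_mm_sq_mul hn hq
  have h2 := congrArg conj h1
  have hv : vv n k l p = (uu n k p 0 ^ 2 + uu n k p 1 ^ 2 + uu n k p 2 ^ 2 +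
      (ww n l 0 ^ 2 + ww n l 1 ^ 2 + ww n l 2 ^ 2)) / 2 := by
    rw [vv, Fin.sum_univ_three, Fin.sum_univ_three]
  rw [hv] at h1 h2
  rw [map_add, map_add, map_mul, map_mul, map_mul, map_div₀, map_add, map_add, map_add, map_add,
    map_add, conj_sq_eq_mul (norm_ww n l 0) hP,
    conj_sq_eq_mul (norm_ww n l 1) (b := ww n l 0) (c := ww n l 2) (by linear_combination hP),
    conj_sq_eq_mul (norm_ww n l 2) (b := ww n l 0) (c := ww n l 1) (by linear_combination hP),
    conj_sq_eq_mul (norm_uu n k p 0) hQ,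
    conj_sq_eq_mul (norm_uu n k p 1) (b := uu n k p 0) (c := uu n k p 2)
      (by linear_combination hQ),
    conj_sq_eq_mul (norm_uu n k p 2) (b := uu n k p 0) (c := uu n k p 1)
      (by linear_combination hQ), map_neg, map_pow, map_pow, map_pow, Complex.conj_ofReal,
    Complex.conj_ofReal, Complex.conj_ofReal, map_ofNat] at h2
  have hx : (uu n k p i ^ 2 - uu n k p 0 ^ 2) * (uu n k p i ^ 2 - uu n k p 1 ^ 2) *
      (uu n k p i ^ 2 - uu n k p 2 ^ 2) = 0 := by
    fin_cases i <;> simp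
  have key := sum_weight_div (by linear_combination -hm)
    (show ww n l 0 ^ 2 * ww n l 1 ^ 2 * ww n l 2 ^ 2 = 1 by rw [← mul_pow, ← mul_pow, hP, one_pow])
    (show uu n k p 0 ^ 2 * uu n k p 1 ^ 2 * uu n k p 2 ^ 2 = 1 by
      rw [← mul_pow, ← mul_pow, hQ, one_pow])
    h1 h2 hx (hq.nontrivial i 0) (hq.nontrivial i 1) (hq.nontrivial i 2)
  have hfrac : ∀ j, (uu n k p i ^ 2 * (ww n l j ^ 2)⁻¹ + 1)⁻¹ =
      ww n l j ^ 2 / (uu n k p i ^ 2 + ww n l j ^ 2) := by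
    intro j
    have h0 := pow_ne_zero 2 (ww_ne_zero n l j)
    have h0' := hq.nontrivial i j
    have e : uu n k p i ^ 2 * (ww n l j ^ 2)⁻¹ + 1 =
        (uu n k p i ^ 2 + ww n l j ^ 2) / ww n l j ^ 2 := by
      rw [add_div, div_self h0, div_eq_mul_inv]
    rw [e, inv_div]
  rw [← key]
  simp only [herm, hh, div_eq_mul_inv _ (uu n k p i ^ 2 * _ + 1), hfrac, mm, Matrix.cons_val,
    Complex.conj_ofReal]
  ring

/-- The vectors `W⁻¹ h_i`. -/
def hhInv (n : ℕ) (k l p : ℤ) (i : Fin 3) : V := fun j => (ww n l j ^ 2)⁻¹ * hh n k l p i j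

lemma reflU_smul_hh (hn : 5 ≤ n) (hq : QuadrangleConditions n k l p) (i : Fin 3) :
    reflU (mm n k l p) • hh n k l p i = uu n k p i ^ 2 • hhInv n k l p i := by
  ext j
  have h0' : uu n k p i ^ 2 * (ww n l j ^ 2)⁻¹ + 1 ≠ 0 := by
    have h0 := pow_ne_zero 2 (ww_ne_zero n l j)
    have e : uu n k p i ^ 2 * (ww n l j ^ 2)⁻¹ + 1 =
        (uu n k p i ^ 2 + ww n l j ^ 2) / ww n l j ^ 2 := by
      rw [add_div, div_self h0, div_eq_mul_inv]
    rw [e]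
    exact div_ne_zero (hq.nontrivial i j) h0
  have hh_mul : hh n k l p i j * (uu n k p i ^ 2 * (ww n l j ^ 2)⁻¹ + 1) = mm n k l p j :=
    div_mul_cancel₀ _ h0'
  rw [reflU_smul, reflLin_apply, herm_hh_mm hn hq, herm_mm_self hn hq]
  simp only [Pi.sub_apply, Pi.smul_apply, smul_eq_mul, hhInv]
  linear_combination -hh_mul

/-- The isometry `W`, normalized so as to fix `q₁`. -/
def rotU (n : ℕ) (l : ℤ) : U :=
  diagU (fun i => ww n l i ^ 2 / ww n l 0 ^ 2) fun i => by simp [norm_ww]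

lemma rotU_smul_hhInv (n : ℕ) (k l p : ℤ) (i : Fin 3) :
    rotU n l • hhInv n k l p i = (ww n l 0 ^ 2)⁻¹ • hh n k l p i := by
  ext j
  have := ww_ne_zero n l j
  rw [rotU, diagU_smul, hhInv, Pi.smul_apply, smul_eq_mul]
  field_simp

lemma rotU_smul_q₁ (n : ℕ) (l : ℤ) : rotU n l • q₁ = q₁ := by
  ext j
  rw [rotU, diagU_smul]
  have := ww_ne_zero n l 0
  fin_cases j <;> simp [q₁, this]

lemma rotU_pow (hn : 5 ≤ n) (l : ℤ) : rotU n l ^ n = 1 := by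
  have h : ∀ j, (ww n l j ^ 2 / ww n l 0 ^ 2) ^ n = 1 := by
    intro j
    have hn0 : (n : ℂ) ≠ 0 := by exact_mod_cast (by omega : n ≠ 0)
    rw [ww_eq, ww_eq, ← Complex.exp_nat_mul, ← Complex.exp_nat_mul, ← Complex.exp_sub,
      ← Complex.exp_nat_mul, Complex.exp_eq_one_iff]
    refine ⟨(![0, 1, -(l + 1)] : Fin 3 → ℤ) j, ?_⟩
    fin_cases j <;> simp [wAngle] <;> field_simp <;> ring
  apply Subtype.ext
  apply LinearEquiv.ext
  intro x
  change rotU n l ^ n • x = x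
  ext j
  rw [rotU, diagU_pow_smul, h, one_mul]

lemma reflU_rotU_smul_hhInv (hn : 5 ≤ n) (hq : QuadrangleConditions n k l p) (i : Fin 3) :
    reflU (mm n k l p) • rotU n l • hhInv n k l p i =
      (uu n k p i ^ 2 / ww n l 0 ^ 2) • hhInv n k l p i := by
  rw [rotU_smul_hhInv, smul_comm, reflU_smul_hh hn hq, smul_smul, inv_mul_eq_div]

lemma uAngle_eq (hn : 5 ≤ n) (k p : ℤ) (i : Fin 3) : uAngle n k p i =
    uAngle n k p 0 + (![0, -1, k + 1] : Fin 3 → ℤ) i * Real.pi / n := by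
  have hn0 : (n : ℝ) ≠ 0 := by exact_mod_cast (by omega : n ≠ 0)
  fin_cases i <;> simp [uAngle] <;> field_simp <;> ring

lemma uu_sq_pow (hn : 5 ≤ n) (k p : ℤ) (i : Fin 3) :
    (uu n k p i ^ 2) ^ n = (uu n k p 0 ^ 2) ^ n := by
  have hn0 : (n : ℂ) ≠ 0 := by exact_mod_cast (by omega : n ≠ 0)
  rw [uu_eq, uu_eq, uAngle_eq hn k p i, ← Complex.exp_nat_mul, ← Complex.exp_nat_mul,
    ← Complex.exp_nat_mul, ← Complex.exp_nat_mul, Complex.exp_eq_exp_iff_exists_int]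
  refine ⟨(![0, -1, k + 1] : Fin 3 → ℤ) i, ?_⟩
  push_cast
  field_simp

lemma uu_sq_injective (hn : 5 ≤ n) (hq : QuadrangleConditions n k l p) :
    Function.Injective fun i => uu n k p i ^ 2 := by
  have hn0 : (n : ℂ) ≠ 0 := by exact_mod_cast (by omega : n ≠ 0)
  have hk := hq.k_nonneg
  have hkn : k ≤ (n : ℤ) - 3 := hq.k_le_l.trans hq.l_le
  intro i j hij
  dsimp only at hij
  rw [uu_eq, uu_eq, uAngle_eq hn k p i, uAngle_eq hn k p j, ← Complex.exp_nat_mul,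
    ← Complex.exp_nat_mul, Complex.exp_eq_exp_iff_exists_int] at hij
  obtain ⟨N, hN⟩ := hij
  have hd : (![0, -1, k + 1] : Fin 3 → ℤ) i - (![0, -1, k + 1] : Fin 3 → ℤ) j = n * N := by
    have h1 : (Real.pi : ℂ) ≠ 0 := by exact_mod_cast Real.pi_ne_zero
    have h2 : (((![0, -1, k + 1] : Fin 3 → ℤ) i - (![0, -1, k + 1] : Fin 3 → ℤ) j : ℤ) : ℂ) =
        (n * N : ℤ) := by
      push_cast at hN ⊢
      field_simp at hN
      apply mul_left_cancel₀ h1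
      linear_combination hN
    exact_mod_cast h2
  have h0 : (![0, -1, k + 1] : Fin 3 → ℤ) i - (![0, -1, k + 1] : Fin 3 → ℤ) j = 0 := by
    refine Int.eq_zero_of_abs_lt_dvd ⟨N, hd⟩ ?_
    rw [abs_lt]
    fin_cases i <;> fin_cases j <;> simp <;> omega
  fin_cases i <;> fin_cases j <;> simp at h0 ⊢ <;> omega

lemma hhInv_ne_zero (hn : 5 ≤ n) (hq : QuadrangleConditions n k l p) (i : Fin 3) :
    hhInv n k l p i ≠ 0 := by
  intro h
  have h1 := herm_hh_mm hn hq i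
  have h2 := reflU_smul_hh hn hq i
  rw [h, smul_zero, smul_eq_zero_iff_eq] at h2
  rw [h2] at h1
  simp [herm] at h1

lemma hnorm_hhInv (hn : 5 ≤ n) (hq : QuadrangleConditions n k l p) (i : Fin 3) :
    hnorm (hhInv n k l p i) = hnorm (hh n k l p i) := by
  have h := congrArg hnorm (reflU_smul_hh hn hq i)
  rw [hnorm_U, hnorm_smul, norm_pow, norm_uu, one_pow, one_pow, one_mul] at h
  exact h.symm

lemma reflU_smul_self {m : V} (hm : 0 < hnorm m) : reflU m • m = m := by
  have h : herm m m ≠ 0 := by rw [herm_self]; exact_mod_cast hm.ne'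
  rw [reflU_smul, reflLin_apply, div_self h]
  module

lemma tance_mm_hhInv (hn : 5 ≤ n) (hq : QuadrangleConditions n k l p) (i : Fin 3) :
    tance (mm n k l p) (hhInv n k l p i) = tance (mm n k l p) (hh n k l p i) := by
  have hm : 0 < hnorm (mm n k l p) := by rw [hnorm, herm_mm_self hn hq]; simp
  rw [tance_eq, tance_eq, hnorm_hhInv hn hq]
  have h : herm (mm n k l p) (hh n k l p i) = conj (uu n k p i ^ 2) *
      herm (mm n k l p) (hhInv n k l p i) := by
    have h1 := herm_U (reflU (mm n k l p)) (mm n k l p) (hh n k l p i)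
    rwa [reflU_smul_self hm, reflU_smul_hh hn hq, herm_smul_right, eq_comm] at h1
  rw [h, norm_mul, Complex.norm_conj, norm_pow, norm_uu, one_pow, one_mul]

lemma hnorm_hh_one_pos (hn : 5 ≤ n) (hq : QuadrangleConditions n k l p) :
    0 < hnorm (hh n k l p 1) := by
  have h := hq.tance_m_h₂
  rw [tance_eq, hnorm, herm_mm_self hn hq, Complex.one_re, one_mul] at h
  by_contra! h0
  have := div_nonpos_of_nonneg_of_nonpos (sq_nonneg ‖herm (mm n k l p) (hh n k l p 1)‖) h0
  linarith

lemma W_zpow (n : ℕ) (l : ℤ) (j : ℕ) : W n l ^ ((j : ℤ) - 1) =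
    Matrix.diagonal fun i => (ww n l i ^ 2) ^ j * (ww n l i ^ 2)⁻¹ := by
  have hinv : W n l * Matrix.diagonal (fun i => (ww n l i ^ 2)⁻¹) = 1 := by
    rw [W, Matrix.diagonal_mul_diagonal, ← Matrix.diagonal_one]
    congr 1
    funext i
    exact mul_inv_cancel₀ (pow_ne_zero 2 (ww_ne_zero n l i))
  have hdet : IsUnit (W n l).det :=
    (Matrix.isUnit_iff_isUnit_det _).1 (IsUnit.of_mul_eq_one _ hinv)
  rw [Matrix.zpow_sub_one hdet, zpow_natCast, Matrix.inv_eq_right_inv hinv, W, Matrix.diagonal_pow,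
    Matrix.diagonal_mul_diagonal]
  rfl

lemma familyPolar_eq (n : ℕ) (k l p : ℤ) (j : Fin n) : familyPolar n k l p j =
    (ww n l 0 ^ 2) ^ (j : ℕ) • rotU n l ^ (j : ℕ) • hhInv n k l p 1 := by
  ext i
  have := ww_ne_zero n l 0
  rw [familyPolar, W_zpow, Matrix.mulVec_diagonal, Pi.smul_apply, smul_eq_mul, rotU,
    diagU_pow_smul, hhInv, div_pow]
  field_simp

/-- The eigenvalue `u₁² / w₁²` of `W⁻¹ h₁` under `R(m) T` is `e^{2πit/3n}`; its negative is written as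
`e^{iθ}` with the angle `θ` which lies in `[-π, π)` for `0 ≤ t < 3n`. -/
lemma exp_eq_neg_div (hn : 5 ≤ n) {t : ℤ} (ht : t ≡ 2 * n * p - k - l [ZMOD 3 * n]) :
    Complex.exp (((2 * Real.pi * t / (3 * n) - Real.pi : ℝ) : ℂ) * Complex.I) =
      -(uu n k p 0 ^ 2 / ww n l 0 ^ 2) := by
  have hn0 : (n : ℂ) ≠ 0 := by exact_mod_cast (by omega : n ≠ 0)
  obtain ⟨q, hq⟩ := ht.symm.dvd
  have ht' : (t : ℂ) = 2 * n * p - k - l + 3 * n * q := by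
    have : t = 2 * n * p - k - l + 3 * n * q := by linarith
    rw [this]
    push_cast
    ring
  have e : ((2 * Real.pi * t / (3 * n) - Real.pi : ℝ) : ℂ) * Complex.I =
      (2 * (uAngle n k p 0 * Complex.I) - 2 * (wAngle n l 0 * Complex.I)) -
        Real.pi * Complex.I + q * (2 * Real.pi * Complex.I) := by
    simp [uAngle, wAngle, ht']
    field_simp
    ring
  rw [e, Complex.exp_add, Complex.exp_int_mul_two_pi_mul_I, mul_one, Complex.exp_sub,
    Complex.exp_pi_mul_I, Complex.exp_sub, uu_eq, ww_eq, ← Complex.exp_nat_mul,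
    ← Complex.exp_nat_mul, div_neg, div_one]
  norm_num

end

end CHyp

end

theorem proposition3p2p6 (n : ℕ) (hn : 5 ≤ n) (k l p t : ℤ)
    (hquad : CHyp.QuadrangleConditions n k l p)
    (ht0 : 0 ≤ t) (ht1 : t < 3 * (n : ℤ))
    (ht : t ≡ 2 * n * p - k - l [ZMOD 3 * n]) :
    ∃ C : CHyp.BisectorCycle n, C.s = CHyp.familyPolar n k l p ∧
      CHyp.IsToledoInvariant C.rep (2 / 3 * t - n) := by
  open CHyp in
  have hn0 : (0 : ℝ) < n := by exact_mod_cast (by omega : 0 < n)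
  have ht0' : (0 : ℝ) ≤ t := by exact_mod_cast ht0
  have ht1' : (t : ℝ) < 3 * n := by exact_mod_cast ht1
  have hpi := Real.pi_pos
  have hm : 0 < hnorm (mm n k l p) := by rw [hnorm, herm_mm_self hn hquad]; simp
  have hw : ww n l 0 ^ 2 ≠ 0 := pow_ne_zero 2 (ww_ne_zero n l 0)
  obtain ⟨C, hCs, hCm⟩ := exists_bisectorCycle (κ := (uu n k p 0 ^ 2 / ww n l 0 ^ 2) ^ n)
    (i₀ := 1) (s := familyPolar n k l p) (rotU_pow hn l) hm (reflU_rotU_smul_hhInv hn hquad)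
    (hhInv_ne_zero hn hquad)
    (fun i j hij => uu_sq_injective hn hquad (by simpa [div_left_inj' hw] using hij))
    (fun i => by rw [div_pow, div_pow, uu_sq_pow hn])
    (by rw [hnorm_hhInv hn hquad]; exact hnorm_hh_one_pos hn hquad)
    (div_ne_zero (pow_ne_zero 2 (uu_ne_zero n k p 1)) hw)
    (by rw [tance_mm_hhInv hn hquad]; exact hquad.tance_m_h₂)
    (ν := fun j => (ww n l 0 ^ 2) ^ (j : ℕ)) (fun j => pow_ne_zero _ hw)
    (familyPolar_eq n k l p)
  refine ⟨C, hCs, ?_⟩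
  have h := isToledoInvariant_of_rotation hn C (θ := 2 * Real.pi * t / (3 * n) - Real.pi)
    (rotU_smul_q₁ n l) (rotU_pow hn l) hm hCm
    (by rw [hnorm_hhInv hn hquad]; exact hquad.h₁_neg) (reflU_rotU_smul_hhInv hn hquad 0)
    (exp_eq_neg_div hn ht) (by
      have : 0 ≤ 2 * Real.pi * t / (3 * n) := by positivity
      linarith) (by
      have : 2 * Real.pi * t / (3 * n) < 2 * Real.pi := by
        rw [div_lt_iff₀ (by positivity)]
        nlinarith
      linarith)
  convert h using 1
  field_simp
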